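/- **Conventions.** "Operad" means a small coloured operad in sets with identity operations, either planar (no permutation actions) or symmetric (permutations of the inputs act on the right on operations). Morphisms of operads may change colours. $p\circ_i q$ denotes the partial composite and $p^\sigma$ the action of a permutation $\sigma$ (only $\sigma=1$ in the planar case). Presheaves are presheaves of (small) sets. *Twisted arrow category.* Let $P$ be a planar or symmetric operad. The objects of $\mathrm{Tw}(P)$ are the operations of $P$, of all arities. A morphism $p\to r$ is an element $E(x)$ of the coproduct (in operads with the colours of $P$) of $P$ with the free operad on one operation $x$ having the same input and output colours as $p$, such that $x$ occurs in $E$ exactly once and such that $E(p)=r$. Composition is substitution. A morphism of operads $f:P_1\to P$ induces a functor $f_*:\mathrm{Tw}(P_1)\to\mathrm{Tw}(P)$. *Active and inert morphisms.* A morphism is *upper* if it is represented by an expression in which no operation of $P$ is placed below $x$, i.e. it is obtained from $x$ by grafting operations of $P$ onto its inputs and permuting the leaves. It is *lower* if it is represented by $(q\circ_i x)^\sigma$ for some operation $q$ of $P$ and some $\sigma$ such that the leaves above $x$ keep their relative order. A morphism is *active* if it is an upper morphism followed by a lower isomorphism, and *inert* if it is an upper isomorphism followed by a lower morphism. *2-Segal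 presheaves.* A presheaf on $\mathrm{Tw}(P)$ is a *2-Segal presheaf* (a *discrete decomposition space* over $\mathrm{Tw}(P)$) if it sends every pushout square in $\mathrm{Tw}(P)$ of an active morphism along an inert morphism with the same source to a pullback square of sets. *Discrete fibrations.* A functor $F:\mathcal E\to\mathcal B$ is a discrete fibration if for every morphism $g:b\to b'$ of $\mathcal B$ and every object $e$ with $F(e)=b'$ there is exactly one morphism of $\mathcal E$ with target $e$ whose image is $g$. The corresponding presheaf on $\mathcal B$ sends $b$ to the fibre $\{e: F(e)=b\}$ and sends $g$ to the map taking $e$ to the source of the lift of $g$ with target $e$. A morphism of operads $f:P_1\to P$ is a *decomposition morphism* if $f_*$ is a discrete fibration. The *category of decomposition morphisms over $P$* has the decomposition morphisms with target $P$ as objects and the morphisms of operads over $P$ as morphisms. **Theorem.** Let $P$ be a planar or symmetric operad. 1. A presheaf $Y$ on $\mathrm{Tw}(P)$ is isomorphic to the presheaf corresponding to a discrete fibration $f_*:\mathrm{Tw}(P_1)\to\mathrm{Tw}(P)$ for some operad $P_1$ (of the same kind as $P$) and some morphism of operads $f:P_1\to P$ if and only if $Y$ is a 2-Segal presheaf.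 2. Sending a decomposition morphism $f:P_1\to P$ to the presheaf of fibres of $f_*$ gives an equivalence between the category of decomposition morphisms over $P$ and the category of 2-Segal presheaves (discrete decomposition spaces) over $\mathrm{Tw}(P)$, the latter being a full subcategory of the category of presheaves on $\mathrm{Tw}(P)$. -/

import Mathlib

open CategoryTheory

universe u

/-! ## Leaves and permutations of a partial composite

Let `p` have `n` inputs and `q` have `m` inputs.  The partial composite `p ∘ᵢ q` has `k` inputs,
where `n + m = k + 1`.  We number everything from `0`. -/

/-- The position in `p ∘ᵢ q` of the input `a ≠ i` of `p`. -/
def leafL {n m k : ℕ} (hk : n + m = k + 1) (i a : Fin n) (ha : a ≠ i) : Fin k :=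
  ⟨if a.val < i.val then a.val else a.val + m - 1, by
    have h1 := a.isLt
    have h2 := i.isLt
    have h3 : a.val ≠ i.val := fun h => ha (Fin.ext h)
    split_ifs <;> omega⟩

/-- The position in `p ∘ᵢ q` of the input `b` of `q`. -/
def leafR {n m k : ℕ} (hk : n + m = k + 1) (i : Fin n) (b : Fin m) : Fin k :=
  ⟨i.val + b.val, by
    have h1 := b.isLt
    have h2 := i.isLt
    omega⟩

theorem leaf_bijective {n m k : ℕ} (hk : n + m = k + 1) (i : Fin n) :
    Function.Bijective (Sum.elim (fun a : {a : Fin n // a ≠ i} => leafL hk i a.1 a.2)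
      (fun b : Fin m => leafR hk i b)) := by
  have hi := i.isLt
  constructor
  · rintro (⟨a, ha⟩ | b) (⟨a', ha'⟩ | b') h
    · have h1 := a.isLt
      have h1' := a'.isLt
      have h3 : a.val ≠ i.val := fun h => ha (Fin.ext h)
      have h3' : a'.val ≠ i.val := fun h => ha' (Fin.ext h)
      have h' : (if a.val < i.val then a.val else a.val + m - 1) =
        (if a'.val < i.val then a'.val else a'.val + m - 1) := congrArg Fin.val h
      have : a = a' := by
        apply Fin.ext
        split_ifs at h' <;> omega
      subst this
      rfl
    · exfalso
      have h1 := a.isLt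
      have h2 := b'.isLt
      have h3 : a.val ≠ i.val := fun h => ha (Fin.ext h)
      have h' : (if a.val < i.val then a.val else a.val + m - 1) = i.val + b'.val :=
        congrArg Fin.val h
      split_ifs at h' <;> omega
    · exfalso
      have h1 := a'.isLt
      have h2 := b.isLt
      have h3 : a'.val ≠ i.val := fun h => ha' (Fin.ext h)
      have h' : i.val + b.val = (if a'.val < i.val then a'.val else a'.val + m - 1) :=
        congrArg Fin.val h
      split_ifs at h' <;> omega
    · have h' : i.val + b.val = i.val + b'.val := congrArg Fin.val h
      have : b = b' := Fin.ext (by omega)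
      subst this
      rfl
  · intro c
    have hc := c.isLt
    by_cases h1 : c.val < i.val
    · refine ⟨Sum.inl ⟨⟨c.val, by omega⟩, fun h => ?_⟩, ?_⟩
      · exact absurd (congrArg Fin.val h) (Nat.ne_of_lt h1)
      · apply Fin.ext
        exact if_pos h1
    · by_cases h2 : c.val < i.val + m
      · refine ⟨Sum.inr ⟨c.val - i.val, by omega⟩, ?_⟩
        apply Fin.ext
        simp only [Sum.elim_inr, leafR]
        omega
      · refine ⟨Sum.inl ⟨⟨c.val + 1 - m, by omega⟩, fun h => ?_⟩, ?_⟩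
        · have := congrArg Fin.val h
          simp only at this
          omega
        · apply Fin.ext
          have h3 : ¬ (c.val + 1 - m < i.val) := by omega
          simp only [Sum.elim_inl, leafL, h3, if_false]
          omega

/-- The inputs of `p ∘ᵢ q` are the inputs of `p` other than `i` together with the inputs of `q`. -/
noncomputable def leafEquiv {n m k : ℕ} (hk : n + m = k + 1) (i : Fin n) :
    {a : Fin n // a ≠ i} ⊕ Fin m ≃ Fin k :=
  Equiv.ofBijective _ (leaf_bijective hk i)

/-- The permutation `σ ∘ᵢ τ` for which `p^σ ∘ᵢ q^τ = (p ∘_{σ i} q)^(σ ∘ᵢ τ)`: it sends the position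
in `p^σ ∘ᵢ q^τ` of an input `a ≠ i` of `p^σ` (an input `b` of `q^τ`) to the position in
`p ∘_{σ i} q` of the input `σ a` of `p` (the input `τ b` of `q`). -/
noncomputable def blockPerm {n m k : ℕ} (hk : n + m = k + 1) (i : Fin n)
    (σ : Equiv.Perm (Fin n)) (τ : Equiv.Perm (Fin m)) : Equiv.Perm (Fin k) :=
  (leafEquiv hk i).symm.trans
    ((Equiv.sumCongr (σ.subtypeEquiv (fun a => (σ.injective.ne_iff (x := a) (y := i)).symm)) τ).trans
      (leafEquiv hk (σ i)))

theorem blockPerm_leafL {n m k : ℕ} (hk : n + m = k + 1) (i : Fin n)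
    (σ : Equiv.Perm (Fin n)) (τ : Equiv.Perm (Fin m)) (a : Fin n) (ha : a ≠ i) :
    blockPerm hk i σ τ (leafL hk i a ha) = leafL hk (σ i) (σ a) (σ.injective.ne ha) := by
  have h : leafL hk i a ha = leafEquiv hk i (Sum.inl ⟨a, ha⟩) := rfl
  rw [h]
  simp only [blockPerm, Equiv.trans_apply, Equiv.symm_apply_apply]
  rfl

theorem blockPerm_leafR {n m k : ℕ} (hk : n + m = k + 1) (i : Fin n)
    (σ : Equiv.Perm (Fin n)) (τ : Equiv.Perm (Fin m)) (b : Fin m) :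
    blockPerm hk i σ τ (leafR hk i b) = leafR hk (σ i) (τ b) := by
  have h : leafR hk i b = leafEquiv hk i (Sum.inr b) := rfl
  rw [h]
  simp only [blockPerm, Equiv.trans_apply, Equiv.symm_apply_apply]
  rfl

/-! ## Planar and symmetric coloured operads in sets -/

/-- The two kinds of operads. -/
inductive OperadKind : Type
  | planar
  | symmetric

/-- The permutations of inputs that act on operations: only the identity permutation for planar
operads (so that a planar operad carries no permutation structure at all), and all permutations for
symmetric operads. -/
def OperadKind.perms : (s : OperadKind) → (n : ℕ) → Subgroup (Equiv.Perm (Fin n))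
  | .planar, _ => ⊥
  | .symmetric, _ => ⊤

/-- The block permutation, as an element of the group of permitted permutations. -/
noncomputable def OperadKind.block (s : OperadKind) {n m k : ℕ} (hk : n + m = k + 1) (i : Fin n)
    (σ : s.perms n) (τ : s.perms m) : s.perms k :=
  ⟨blockPerm hk i σ.1 τ.1, by
    cases s with
    | symmetric => exact Subgroup.mem_top _
    | planar =>
      obtain ⟨σ, hσ⟩ := σ
      obtain ⟨τ, hτ⟩ := τ
      have hσ' : σ = 1 := Subgroup.mem_bot.mp hσ
      have hτ' : τ = 1 := Subgroup.mem_bot.mp hτ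
      subst hσ' hτ'
      refine Subgroup.mem_bot.mpr (Equiv.ext fun c => ?_)
      obtain ⟨x, rfl⟩ := (leaf_bijective hk i).2 c
      rcases x with ⟨a, ha⟩ | b
      · exact blockPerm_leafL hk i 1 1 a ha
      · exact blockPerm_leafR hk i 1 1 b⟩

/-- A coloured operad in sets with identity operations, presented by partial compositions; planar or
symmetric according to `s`.  `Op n` is the set of all operations of arity `n`; an operation `p` has
input colours `inp p 0, …, inp p (n - 1)` and output colour `out p`.  Permutations act on the right,
the `a`-th input of `p^σ` being the `σ a`-th input of `p`. -/
structure Operad (s : OperadKind) : Type (u + 1) where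
  Colour : Type u
  Op : ℕ → Type u
  inp : ∀ {n : ℕ}, Op n → Fin n → Colour
  out : ∀ {n : ℕ}, Op n → Colour
  one : Colour → Op 1
  /-- `comp hk p i q e` is the partial composite `p ∘ᵢ q`. -/
  comp : ∀ {n m k : ℕ} (_ : n + m = k + 1) (p : Op n) (i : Fin n) (q : Op m),
    out q = inp p i → Op k
  act : ∀ {n : ℕ}, Op n → s.perms n → Op n
  inp_one : ∀ (c : Colour) (a : Fin 1), inp (one c) a = c
  out_one : ∀ c : Colour, out (one c) = c
  inp_comp_left : ∀ {n m k : ℕ} (hk : n + m = k + 1) (p : Op n) (i : Fin n) (q : Op m)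
    (e : out q = inp p i) (a : Fin n) (ha : a ≠ i),
    inp (comp hk p i q e) (leafL hk i a ha) = inp p a
  inp_comp_right : ∀ {n m k : ℕ} (hk : n + m = k + 1) (p : Op n) (i : Fin n) (q : Op m)
    (e : out q = inp p i) (b : Fin m),
    inp (comp hk p i q e) (leafR hk i b) = inp q b
  out_comp : ∀ {n m k : ℕ} (hk : n + m = k + 1) (p : Op n) (i : Fin n) (q : Op m)
    (e : out q = inp p i), out (comp hk p i q e) = out p
  inp_act : ∀ {n : ℕ} (p : Op n) (σ : s.perms n) (a : Fin n), inp (act p σ) a = inp p (σ.1 a)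
  out_act : ∀ {n : ℕ} (p : Op n) (σ : s.perms n), out (act p σ) = out p
  /-- `(p ∘ᵢ q) ∘ⱼ r = p ∘ᵢ (q ∘ⱼ r)` for an input `j` of `q`. -/
  assoc : ∀ {n m l k₁ k₂ k : ℕ} (h₁ : n + m = k₁ + 1) (h₂ : k₁ + l = k + 1) (h₃ : m + l = k₂ + 1)
    (h₄ : n + k₂ = k + 1) (p : Op n) (i : Fin n) (q : Op m) (j : Fin m) (r : Op l)
    (e₁ : out q = inp p i) (e₂ : out r = inp (comp h₁ p i q e₁) (leafR h₁ i j))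
    (e₃ : out r = inp q j) (e₄ : out (comp h₃ q j r e₃) = inp p i),
    comp h₂ (comp h₁ p i q e₁) (leafR h₁ i j) r e₂ = comp h₄ p i (comp h₃ q j r e₃) e₄
  /-- `(p ∘ᵢ q) ∘ₐ r = (p ∘ₐ r) ∘ᵢ q` for distinct inputs `i` and `a` of `p`. -/
  parallel : ∀ {n m l k₁ k₂ k : ℕ} (h₁ : n + m = k₁ + 1) (h₂ : k₁ + l = k + 1)
    (h₃ : n + l = k₂ + 1) (h₄ : k₂ + m = k + 1) (p : Op n) (i a : Fin n) (ha : a ≠ i)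
    (q : Op m) (r : Op l)
    (e₁ : out q = inp p i) (e₂ : out r = inp (comp h₁ p i q e₁) (leafL h₁ i a ha))
    (e₃ : out r = inp p a) (e₄ : out q = inp (comp h₃ p a r e₃) (leafL h₃ a i ha.symm)),
    comp h₂ (comp h₁ p i q e₁) (leafL h₁ i a ha) r e₂ =
      comp h₄ (comp h₃ p a r e₃) (leafL h₃ a i ha.symm) q e₄
  comp_one : ∀ {n : ℕ} (hk : n + 1 = n + 1) (p : Op n) (i : Fin n) (c : Colour)
    (e : out (one c) = inp p i), comp hk p i (one c) e = p
  one_comp : ∀ {n : ℕ} (hk : 1 + n = n + 1) (c : Colour) (i : Fin 1) (p : Op n)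
    (e : out p = inp (one c) i), comp hk (one c) i p e = p
  act_one : ∀ {n : ℕ} (p : Op n), act p 1 = p
  act_mul : ∀ {n : ℕ} (p : Op n) (σ τ : s.perms n), act p (σ * τ) = act (act p σ) τ
  act_comp : ∀ {n m k : ℕ} (hk : n + m = k + 1) (p : Op n) (i : Fin n) (q : Op m)
    (σ : s.perms n) (τ : s.perms m) (e : out (act q τ) = inp (act p σ) i)
    (e' : out q = inp p (σ.1 i)),
    comp hk (act p σ) i (act q τ) e = act (comp hk p (σ.1 i) q e') (s.block hk i σ τ)

namespace Operad

variable {s : OperadKind}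

/-- Morphisms of operads (which may change the set of colours). -/
@[ext]
structure Hom (P Q : Operad.{u} s) : Type u where
  colour : P.Colour → Q.Colour
  op : ∀ {n : ℕ}, P.Op n → Q.Op n
  inp_op : ∀ {n : ℕ} (p : P.Op n) (a : Fin n), Q.inp (op p) a = colour (P.inp p a)
  out_op : ∀ {n : ℕ} (p : P.Op n), Q.out (op p) = colour (P.out p)
  op_one : ∀ c : P.Colour, op (P.one c) = Q.one (colour c)
  op_comp : ∀ {n m k : ℕ} (hk : n + m = k + 1) (p : P.Op n) (i : Fin n) (q : P.Op m)
    (e : P.out q = P.inp p i) (e' : Q.out (op q) = Q.inp (op p) i),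
    op (P.comp hk p i q e) = Q.comp hk (op p) i (op q) e'
  op_act : ∀ {n : ℕ} (p : P.Op n) (σ : s.perms n), op (P.act p σ) = Q.act (op p) σ

theorem Hom.compat {P Q : Operad.{u} s} (f : Hom P Q) {n m : ℕ} {p : P.Op n} {i : Fin n}
    {q : P.Op m} (e : P.out q = P.inp p i) : Q.out (f.op q) = Q.inp (f.op p) i := by
  rw [f.out_op, f.inp_op, e]

instance : Category (Operad.{u} s) where
  Hom := Hom
  id P :=
    { colour := fun c => c
      op := fun p => p
      inp_op := fun _ _ => rfl
      out_op := fun _ => rfl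
      op_one := fun _ => rfl
      op_comp := fun _ _ _ _ _ _ => rfl
      op_act := fun _ _ => rfl }
  comp f g :=
    { colour := fun c => g.colour (f.colour c)
      op := fun p => g.op (f.op p)
      inp_op := fun p a => by rw [g.inp_op, f.inp_op]
      out_op := fun p => by rw [g.out_op, f.out_op]
      op_one := fun c => by rw [f.op_one, g.op_one]
      op_comp := fun hk p i q e e' => by
        rw [f.op_comp hk p i q e (f.compat e), g.op_comp hk _ i _ (f.compat e) e']
      op_act := fun p σ => by rw [f.op_act, g.op_act] }
  id_comp _ := rfl
  comp_id _ := rfl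
  assoc _ _ _ := rfl

/-! ## The twisted arrow category

Objects are the operations of `P`.  A morphism `p ⟶ r` is an expression `[E(x)]` in the operad
freely generated by `P` and one further operation `x` with the same input and output colours as `p`
(i.e. an element of the coproduct of `P` with the free operad on `x`), such that `x` occurs in `E`
exactly once and such that the evaluation `E(p)` is equal to `r`.  Composition is substitution.

Such an expression is built from `x` by a sequence of steps `E ↦ E ∘ᵢ q`, `E ↦ q ∘ᵢ E`,
`E ↦ E^σ` with `q` in `P`, and two sequences give the same element exactly when they are related
by the operad axioms.  So the category is generated by these three families of steps, with the
relations that are the instances of operad axioms in which exactly one of the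
operations is the variable one and the remaining ones are operations of `P`. -/

/-- The objects of the twisted arrow category of `P`: the operations of `P`, of all arities. -/
structure Tw (P : Operad.{u} s) : Type u where
  arity : ℕ
  op : P.Op arity

namespace Tw

/-- The steps from which expressions are built. -/
inductive Step (P : Operad.{u} s) : Tw P → Tw P → Type u
  /-- The step `E ↦ E ∘ᵢ q`, where `E` has value `p` and `E ∘ᵢ q` has value `z`. -/
  | above {n m k : ℕ} (hk : n + m = k + 1) (p : P.Op n) (i : Fin n) (q : P.Op m)
      (e : P.out q = P.inp p i) (z : P.Op k) (hz : P.comp hk p i q e = z) :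
      Step P ⟨n, p⟩ ⟨k, z⟩
  /-- The step `E ↦ p ∘ᵢ E`, where `E` has value `q` and `p ∘ᵢ E` has value `z`. -/
  | below {n m k : ℕ} (hk : n + m = k + 1) (p : P.Op n) (i : Fin n) (q : P.Op m)
      (e : P.out q = P.inp p i) (z : P.Op k) (hz : P.comp hk p i q e = z) :
      Step P ⟨m, q⟩ ⟨k, z⟩
  /-- The step `E ↦ E^σ`, where `E` has value `p` and `E^σ` has value `z`. -/
  | perm {n : ℕ} (p : P.Op n) (σ : s.perms n) (z : P.Op n) (hz : P.act p σ = z) :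
      Step P ⟨n, p⟩ ⟨n, z⟩

/-- Expressions with value `b` in a variable operation `x` of the same colours as `a`, with value
`a` assigned to `x`. -/
inductive Expr (P : Operad.{u} s) (a : Tw P) : Tw P → Type u
  | var : Expr P a a
  | step {b c : Tw P} (E : Expr P a b) (g : Step P b c) : Expr P a c

/-- The relation on expressions generated by the operad axioms in which one operation is an
expression `E` in the variable, and the others are in `P`.  (The instance of the parallel axiom with
`E` in place of `r` is the one with `E` in place of `q`, the roles of `i` and `a` being exchanged.) -/
inductive ExprRel (P : Operad.{u} s) {o : Tw P} : {b : Tw P} → Expr P o b → Expr P o b → Prop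
  /-- equal expressions stay equal after a further step -/
  | step {b c : Tw P} {E E' : Expr P o b} (g : Step P b c) :
      ExprRel P E E' → ExprRel P (E.step g) (E'.step g)
  /-- `(E ∘ᵢ q) ∘ⱼ r = E ∘ᵢ (q ∘ⱼ r)` -/
  | assoc₁ {n m l k₁ k₂ k : ℕ} (h₁ : n + m = k₁ + 1) (h₂ : k₁ + l = k + 1) (h₃ : m + l = k₂ + 1)
      (h₄ : n + k₂ = k + 1) (p : P.Op n) (i : Fin n) (q : P.Op m) (j : Fin m) (r : P.Op l)
      (e₁ : P.out q = P.inp p i) (pq : P.Op k₁) (hpq : P.comp h₁ p i q e₁ = pq)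
      (e₃ : P.out r = P.inp q j) (qr : P.Op k₂) (hqr : P.comp h₃ q j r e₃ = qr)
      (e₂ : P.out r = P.inp pq (leafR h₁ i j)) (e₄ : P.out qr = P.inp p i)
      (z : P.Op k) (hz : P.comp h₂ pq (leafR h₁ i j) r e₂ = z) (hz' : P.comp h₄ p i qr e₄ = z)
      (E : Expr P o ⟨n, p⟩) :
      ExprRel P
        ((E.step (.above h₁ p i q e₁ pq hpq)).step
          (.above h₂ pq (leafR h₁ i j) r e₂ z hz))
        (E.step (.above h₄ p i qr e₄ z hz'))
  /-- `(p ∘ᵢ E) ∘ⱼ r = p ∘ᵢ (E ∘ⱼ r)` -/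
  | assoc₂ {n m l k₁ k₂ k : ℕ} (h₁ : n + m = k₁ + 1) (h₂ : k₁ + l = k + 1) (h₃ : m + l = k₂ + 1)
      (h₄ : n + k₂ = k + 1) (p : P.Op n) (i : Fin n) (q : P.Op m) (j : Fin m) (r : P.Op l)
      (e₁ : P.out q = P.inp p i) (pq : P.Op k₁) (hpq : P.comp h₁ p i q e₁ = pq)
      (e₃ : P.out r = P.inp q j) (qr : P.Op k₂) (hqr : P.comp h₃ q j r e₃ = qr)
      (e₂ : P.out r = P.inp pq (leafR h₁ i j)) (e₄ : P.out qr = P.inp p i)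
      (z : P.Op k) (hz : P.comp h₂ pq (leafR h₁ i j) r e₂ = z) (hz' : P.comp h₄ p i qr e₄ = z)
      (E : Expr P o ⟨m, q⟩) :
      ExprRel P
        ((E.step (.below h₁ p i q e₁ pq hpq)).step
          (.above h₂ pq (leafR h₁ i j) r e₂ z hz))
        ((E.step (.above h₃ q j r e₃ qr hqr)).step
          (.below h₄ p i qr e₄ z hz'))
  /-- `(p ∘ᵢ q) ∘ⱼ E = p ∘ᵢ (q ∘ⱼ E)` -/
  | assoc₃ {n m l k₁ k₂ k : ℕ} (h₁ : n + m = k₁ + 1) (h₂ : k₁ + l = k + 1) (h₃ : m + l = k₂ + 1)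
      (h₄ : n + k₂ = k + 1) (p : P.Op n) (i : Fin n) (q : P.Op m) (j : Fin m) (r : P.Op l)
      (e₁ : P.out q = P.inp p i) (pq : P.Op k₁) (hpq : P.comp h₁ p i q e₁ = pq)
      (e₃ : P.out r = P.inp q j) (qr : P.Op k₂) (hqr : P.comp h₃ q j r e₃ = qr)
      (e₂ : P.out r = P.inp pq (leafR h₁ i j)) (e₄ : P.out qr = P.inp p i)
      (z : P.Op k) (hz : P.comp h₂ pq (leafR h₁ i j) r e₂ = z) (hz' : P.comp h₄ p i qr e₄ = z)
      (E : Expr P o ⟨l, r⟩) :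
      ExprRel P
        (E.step (.below h₂ pq (leafR h₁ i j) r e₂ z hz))
        ((E.step (.below h₃ q j r e₃ qr hqr)).step
          (.below h₄ p i qr e₄ z hz'))
  /-- `(E ∘ᵢ q) ∘ₐ r = (E ∘ₐ r) ∘ᵢ q` -/
  | parallel₁ {n m l k₁ k₂ k : ℕ} (h₁ : n + m = k₁ + 1) (h₂ : k₁ + l = k + 1) (h₃ : n + l = k₂ + 1)
      (h₄ : k₂ + m = k + 1) (p : P.Op n) (i a : Fin n) (ha : a ≠ i) (q : P.Op m) (r : P.Op l)
      (e₁ : P.out q = P.inp p i) (pq : P.Op k₁) (hpq : P.comp h₁ p i q e₁ = pq)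
      (e₃ : P.out r = P.inp p a) (pr : P.Op k₂) (hpr : P.comp h₃ p a r e₃ = pr)
      (e₂ : P.out r = P.inp pq (leafL h₁ i a ha)) (e₄ : P.out q = P.inp pr (leafL h₃ a i ha.symm))
      (z : P.Op k) (hz : P.comp h₂ pq (leafL h₁ i a ha) r e₂ = z)
      (hz' : P.comp h₄ pr (leafL h₃ a i ha.symm) q e₄ = z)
      (E : Expr P o ⟨n, p⟩) :
      ExprRel P
        ((E.step (.above h₁ p i q e₁ pq hpq)).step
          (.above h₂ pq (leafL h₁ i a ha) r e₂ z hz))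
        ((E.step (.above h₃ p a r e₃ pr hpr)).step
          (.above h₄ pr (leafL h₃ a i ha.symm) q e₄ z hz'))
  /-- `(p ∘ᵢ E) ∘ₐ r = (p ∘ₐ r) ∘ᵢ E` -/
  | parallel₂ {n m l k₁ k₂ k : ℕ} (h₁ : n + m = k₁ + 1) (h₂ : k₁ + l = k + 1) (h₃ : n + l = k₂ + 1)
      (h₄ : k₂ + m = k + 1) (p : P.Op n) (i a : Fin n) (ha : a ≠ i) (q : P.Op m) (r : P.Op l)
      (e₁ : P.out q = P.inp p i) (pq : P.Op k₁) (hpq : P.comp h₁ p i q e₁ = pq)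
      (e₃ : P.out r = P.inp p a) (pr : P.Op k₂) (hpr : P.comp h₃ p a r e₃ = pr)
      (e₂ : P.out r = P.inp pq (leafL h₁ i a ha)) (e₄ : P.out q = P.inp pr (leafL h₃ a i ha.symm))
      (z : P.Op k) (hz : P.comp h₂ pq (leafL h₁ i a ha) r e₂ = z)
      (hz' : P.comp h₄ pr (leafL h₃ a i ha.symm) q e₄ = z)
      (E : Expr P o ⟨m, q⟩) :
      ExprRel P
        ((E.step (.below h₁ p i q e₁ pq hpq)).step
          (.above h₂ pq (leafL h₁ i a ha) r e₂ z hz))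
        (E.step (.below h₄ pr (leafL h₃ a i ha.symm) q e₄ z hz'))
  /-- `E ∘ᵢ id = E` -/
  | comp_one {n : ℕ} (hk : n + 1 = n + 1) (p : P.Op n) (i : Fin n) (c : P.Colour)
      (e : P.out (P.one c) = P.inp p i) (hz : P.comp hk p i (P.one c) e = p)
      (E : Expr P o ⟨n, p⟩) :
      ExprRel P (E.step (.above hk p i (P.one c) e p hz)) E
  /-- `id ∘ E = E` -/
  | one_comp {n : ℕ} (hk : 1 + n = n + 1) (c : P.Colour) (i : Fin 1) (p : P.Op n)
      (e : P.out p = P.inp (P.one c) i) (hz : P.comp hk (P.one c) i p e = p)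
      (E : Expr P o ⟨n, p⟩) :
      ExprRel P (E.step (.below hk (P.one c) i p e p hz)) E
  /-- `E^1 = E` -/
  | act_one {n : ℕ} (p : P.Op n) (hz : P.act p 1 = p)
      (E : Expr P o ⟨n, p⟩) :
      ExprRel P (E.step (.perm p 1 p hz)) E
  /-- `E^(σ * τ) = (E^σ)^τ` -/
  | act_mul {n : ℕ} (p : P.Op n) (σ τ : s.perms n) (pσ z : P.Op n) (hpσ : P.act p σ = pσ)
      (hz : P.act p (σ * τ) = z) (hz' : P.act pσ τ = z)
      (E : Expr P o ⟨n, p⟩) :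
      ExprRel P (E.step (.perm p (σ * τ) z hz)) ((E.step (.perm p σ pσ hpσ)).step
          (.perm pσ τ z hz'))
  /-- `E^σ ∘ᵢ q^τ = (E ∘_{σ i} q)^(σ ∘ᵢ τ)` -/
  | act_comp₁ {n m k : ℕ} (hk : n + m = k + 1) (p : P.Op n) (i : Fin n) (q : P.Op m)
      (σ : s.perms n) (τ : s.perms m) (pσ : P.Op n) (hpσ : P.act p σ = pσ)
      (qτ : P.Op m) (hqτ : P.act q τ = qτ)
      (e : P.out qτ = P.inp pσ i) (e' : P.out q = P.inp p (σ.1 i))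
      (pq : P.Op k) (hpq : P.comp hk p (σ.1 i) q e' = pq)
      (z : P.Op k) (hz : P.comp hk pσ i qτ e = z) (hz' : P.act pq (s.block hk i σ τ) = z)
      (E : Expr P o ⟨n, p⟩) :
      ExprRel P ((E.step (.perm p σ pσ hpσ)).step
          (.above hk pσ i qτ e z hz))
        ((E.step (.above hk p (σ.1 i) q e' pq hpq)).step
          (.perm pq (s.block hk i σ τ) z hz'))
  /-- `p^σ ∘ᵢ E^τ = (p ∘_{σ i} E)^(σ ∘ᵢ τ)` -/
  | act_comp₂ {n m k : ℕ} (hk : n + m = k + 1) (p : P.Op n) (i : Fin n) (q : P.Op m)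
      (σ : s.perms n) (τ : s.perms m) (pσ : P.Op n) (hpσ : P.act p σ = pσ)
      (qτ : P.Op m) (hqτ : P.act q τ = qτ)
      (e : P.out qτ = P.inp pσ i) (e' : P.out q = P.inp p (σ.1 i))
      (pq : P.Op k) (hpq : P.comp hk p (σ.1 i) q e' = pq)
      (z : P.Op k) (hz : P.comp hk pσ i qτ e = z) (hz' : P.act pq (s.block hk i σ τ) = z)
      (E : Expr P o ⟨m, q⟩) :
      ExprRel P ((E.step (.perm q τ qτ hqτ)).step
          (.below hk pσ i qτ e z hz))
        ((E.step (.below hk p (σ.1 i) q e' pq hpq)).step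
          (.perm pq (s.block hk i σ τ) z hz'))

/-- Substitution of the expression `E` for the variable of `F`. -/
def Expr.subst {P : Operad.{u} s} {a b : Tw P} (E : Expr P a b) :
    {c : Tw P} → Expr P b c → Expr P a c
  | _, .var => E
  | _, .step F g => .step (E.subst F) g

theorem Expr.var_subst {P : Operad.{u} s} {a b : Tw P} (E : Expr P a b) :
    Expr.subst .var E = E := by
  induction E with
  | var => rfl
  | step E g ih => exact congrArg (fun E' => Expr.step E' g) ih

theorem Expr.subst_assoc {P : Operad.{u} s} {a b c d : Tw P} (E : Expr P a b) (F : Expr P b c)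
    (G : Expr P c d) : (E.subst F).subst G = E.subst (F.subst G) := by
  induction G with
  | var => rfl
  | step G g ih => exact congrArg (fun E' => Expr.step E' g) ih

theorem ExprRel.subst_left {P : Operad.{u} s} {a b c : Tw P} {E E' : Expr P a b} (h : ExprRel P E E')
    (F : Expr P b c) : ExprRel P (E.subst F) (E'.subst F) := by
  induction F with
  | var => exact h
  | step F g ih => exact .step g ih

theorem ExprRel.subst_right {P : Operad.{u} s} {a b c : Tw P} (E : Expr P a b) {F F' : Expr P b c}
    (h : ExprRel P F F') : ExprRel P (E.subst F) (E.subst F') := by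
  induction h with
  | step g _ ih => exact .step g ih
  | _ => constructor <;> assumption

/-- Morphisms `a ⟶ b`: the classes of expressions with value `b` in a variable with value `a`.
Composition is substitution. -/
instance (P : Operad.{u} s) : Category.{u} (Tw P) where
  Hom a b := Quot (ExprRel P (o := a) (b := b))
  id a := Quot.mk _ .var
  comp := Quot.map₂ (fun E F => E.subst F) (fun E _ _ h => h.subst_right E)
    (fun _ _ F h => h.subst_left F)
  id_comp := by
    rintro a b ⟨E⟩
    exact congrArg (Quot.mk _) E.var_subst
  comp_id := by
    rintro a b ⟨E⟩
    rfl
  assoc := by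
    rintro a b c d ⟨E⟩ ⟨F⟩ ⟨G⟩
    exact congrArg (Quot.mk _) (E.subst_assoc F G)

/-- The morphism given by an expression. -/
def Expr.hom {P : Operad.{u} s} {a b : Tw P} (E : Expr P a b) : a ⟶ b := Quot.mk _ E

/-- The morphism given by an expression with one step. -/
def Step.hom {P : Operad.{u} s} {a b : Tw P} (g : Step P a b) : a ⟶ b := (Expr.var.step g).hom

/-- The map on objects induced by a morphism of operads. -/
def mapObj {P Q : Operad.{u} s} (f : P ⟶ Q) (p : Tw P) : Tw Q :=
  ⟨p.arity, Hom.op f p.op⟩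

/-- The map on steps induced by a morphism of operads. -/
def Step.map {P Q : Operad.{u} s} (f : P ⟶ Q) : {a b : Tw P} → Step P a b →
    Step Q (mapObj f a) (mapObj f b)
  | _, _, .above hk p i q e z hz => .above hk (Hom.op f p) i (Hom.op f q) (Hom.compat f e)
      (Hom.op f z) (by rw [← hz, Hom.op_comp f])
  | _, _, .below hk p i q e z hz => .below hk (Hom.op f p) i (Hom.op f q) (Hom.compat f e)
      (Hom.op f z) (by rw [← hz, Hom.op_comp f])
  | _, _, .perm p σ z hz => .perm (Hom.op f p) σ (Hom.op f z) (by rw [← hz, Hom.op_act f])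

/-- The map on expressions induced by a morphism of operads. -/
def Expr.map {P Q : Operad.{u} s} (f : P ⟶ Q) {a : Tw P} : {b : Tw P} → Expr P a b →
    Expr Q (mapObj f a) (mapObj f b)
  | _, .var => .var
  | _, .step E g => .step (Expr.map f E) (g.map f)

theorem Expr.map_subst {P Q : Operad.{u} s} (f : P ⟶ Q) {a b c : Tw P} (E : Expr P a b)
    (F : Expr P b c) : (E.subst F).map f = (E.map f).subst (F.map f) := by
  induction F with
  | var => rfl
  | step F g ih => exact congrArg (fun E' => Expr.step E' (g.map f)) ih

theorem ExprRel.map {P Q : Operad.{u} s} (f : P ⟶ Q) {a b : Tw P} {E E' : Expr P a b}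
    (h : ExprRel P E E') : ExprRel Q (E.map f) (E'.map f) := by
  induction h with
  | step g _ ih => exact .step _ ih
  | assoc₁ h₁ h₂ h₃ h₄ p i q j r e₁ pq hpq e₃ qr hqr e₂ e₄ z hz hz' E =>
    exact .assoc₁ h₁ h₂ h₃ h₄ (Hom.op f p) i (Hom.op f q) j (Hom.op f r) (Hom.compat f e₁)
      (Hom.op f pq) (by rw [← hpq, Hom.op_comp f]) (Hom.compat f e₃) (Hom.op f qr)
      (by rw [← hqr, Hom.op_comp f]) _ _ _ _ _ _
  | assoc₂ h₁ h₂ h₃ h₄ p i q j r e₁ pq hpq e₃ qr hqr e₂ e₄ z hz hz' E =>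
    exact .assoc₂ h₁ h₂ h₃ h₄ (Hom.op f p) i (Hom.op f q) j (Hom.op f r) (Hom.compat f e₁)
      (Hom.op f pq) (by rw [← hpq, Hom.op_comp f]) (Hom.compat f e₃) (Hom.op f qr)
      (by rw [← hqr, Hom.op_comp f]) _ _ _ _ _ _
  | assoc₃ h₁ h₂ h₃ h₄ p i q j r e₁ pq hpq e₃ qr hqr e₂ e₄ z hz hz' E =>
    exact .assoc₃ h₁ h₂ h₃ h₄ (Hom.op f p) i (Hom.op f q) j (Hom.op f r) (Hom.compat f e₁)
      (Hom.op f pq) (by rw [← hpq, Hom.op_comp f]) (Hom.compat f e₃) (Hom.op f qr)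
      (by rw [← hqr, Hom.op_comp f]) _ _ _ _ _ _
  | parallel₁ h₁ h₂ h₃ h₄ p i a ha q r e₁ pq hpq e₃ pr hpr e₂ e₄ z hz hz' E =>
    exact .parallel₁ h₁ h₂ h₃ h₄ (Hom.op f p) i a ha (Hom.op f q) (Hom.op f r)
      (Hom.compat f e₁) (Hom.op f pq) (by rw [← hpq, Hom.op_comp f]) (Hom.compat f e₃)
      (Hom.op f pr) (by rw [← hpr, Hom.op_comp f]) _ _ _ _ _ _
  | parallel₂ h₁ h₂ h₃ h₄ p i a ha q r e₁ pq hpq e₃ pr hpr e₂ e₄ z hz hz' E =>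
    exact .parallel₂ h₁ h₂ h₃ h₄ (Hom.op f p) i a ha (Hom.op f q) (Hom.op f r)
      (Hom.compat f e₁) (Hom.op f pq) (by rw [← hpq, Hom.op_comp f]) (Hom.compat f e₃)
      (Hom.op f pr) (by rw [← hpr, Hom.op_comp f]) _ _ _ _ _ _
  | comp_one hk p i c e hz E =>
    have aux : ∀ (q : Q.Op 1) (_ : q = Q.one (Hom.colour f c)) (e : Q.out q = Q.inp (Hom.op f p) i)
        (hz : Q.comp hk (Hom.op f p) i q e = Hom.op f p),
        ExprRel Q ((E.map f).step (.above hk (Hom.op f p) i q e (Hom.op f p) hz)) (E.map f) := by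
      rintro q rfl e hz
      exact .comp_one hk _ i _ e hz _
    exact aux _ (Hom.op_one f c) _ _
  | one_comp hk c i p e hz E =>
    have aux : ∀ (q : Q.Op 1) (_ : q = Q.one (Hom.colour f c)) (e : Q.out (Hom.op f p) = Q.inp q i)
        (hz : Q.comp hk q i (Hom.op f p) e = Hom.op f p),
        ExprRel Q ((E.map f).step (.below hk q i (Hom.op f p) e (Hom.op f p) hz)) (E.map f) := by
      rintro q rfl e hz
      exact .one_comp hk _ i _ e hz _
    exact aux _ (Hom.op_one f c) _ _
  | act_one p hz E => exact .act_one (Hom.op f p) _ _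
  | act_mul p σ τ pσ z hpσ hz hz' =>
    exact .act_mul (Hom.op f p) σ τ (Hom.op f pσ) (Hom.op f z) _ _ _ _
  | act_comp₁ hk p i q σ τ pσ hpσ qτ hqτ e e' pq hpq z hz hz' E =>
    exact .act_comp₁ hk (Hom.op f p) i (Hom.op f q) σ τ (Hom.op f pσ) _ (Hom.op f qτ)
      (by rw [← hqτ, Hom.op_act f]) _ _ (Hom.op f pq) _ (Hom.op f z) _ _ _
  | act_comp₂ hk p i q σ τ pσ hpσ qτ hqτ e e' pq hpq z hz hz' E =>
    exact .act_comp₂ hk (Hom.op f p) i (Hom.op f q) σ τ (Hom.op f pσ)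
      (by rw [← hpσ, Hom.op_act f]) (Hom.op f qτ) _ _ _ (Hom.op f pq) _ (Hom.op f z) _ _ _

/-- The functor `f_* : Tw P ⥤ Tw Q` induced by a morphism of operads `f : P ⟶ Q`. -/
def map {P Q : Operad.{u} s} (f : P ⟶ Q) : Tw P ⥤ Tw Q where
  obj a := mapObj f a
  map := Quot.map (fun E => E.map f) (fun _ _ h => h.map f)
  map_id _ := rfl
  map_comp := by
    rintro a b c ⟨E⟩ ⟨F⟩
    exact congrArg (Quot.mk _) (E.map_subst f F)

theorem Expr.map_id (P : Operad.{u} s) {a b : Tw P} (E : Expr P a b) : E.map (𝟙 P) = E := by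
  induction E with
  | var => rfl
  | step E g ih => cases g <;> exact congrArg (fun E' => Expr.step E' _) ih

theorem Expr.map_comp {P Q R : Operad.{u} s} (f : P ⟶ Q) (g : Q ⟶ R) {a b : Tw P}
    (E : Expr P a b) : E.map (f ≫ g) = (E.map f).map g := by
  induction E with
  | var => rfl
  | step E t ih => cases t <;> exact congrArg (fun E' => Expr.step E' _) ih

protected theorem map_id (P : Operad.{u} s) : map (𝟙 P) = 𝟭 (Tw P) := by
  refine CategoryTheory.Functor.ext (fun _ => rfl) ?_
  rintro a b ⟨E⟩
  exact (congrArg Expr.hom E.map_id).trans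
    ((Category.id_comp _).trans (Category.comp_id E.hom)).symm

protected theorem map_comp {P Q R : Operad.{u} s} (f : P ⟶ Q) (g : Q ⟶ R) :
    map (f ≫ g) = map f ⋙ map g := by
  refine CategoryTheory.Functor.ext (fun _ => rfl) ?_
  rintro a b ⟨E⟩
  exact (congrArg Expr.hom (E.map_comp f g)).trans
    ((Category.id_comp _).trans (Category.comp_id ((E.map f).map g).hom)).symm

/-! ## Upper, lower, active and inert morphisms -/

/-- Upper morphisms: those represented by expressions in which no operation of `P` is below the
variable. -/
inductive IsUpper (P : Operad.{u} s) : ∀ {a b : Tw P}, (a ⟶ b) → Prop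
  | id (a : Tw P) : IsUpper P (𝟙 a)
  | above {n m k : ℕ} (hk : n + m = k + 1) (p : P.Op n) (i : Fin n) (q : P.Op m)
      (e : P.out q = P.inp p i) (z : P.Op k) (hz : P.comp hk p i q e = z) :
      IsUpper P (Step.above hk p i q e z hz).hom
  | perm {n : ℕ} (p : P.Op n) (σ : s.perms n) (z : P.Op n) (hz : P.act p σ = z) :
      IsUpper P (Step.perm p σ z hz).hom
  | comp {a b c : Tw P} (f : a ⟶ b) (g : b ⟶ c) : IsUpper P f → IsUpper P g → IsUpper P (f ≫ g)

/-- Lower morphisms: those represented by expressions `(p ∘ᵢ x)^σ` in which the leaves above the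
variable `x` keep their order.  (The `c`-th leaf of `y^σ` is the `σ c`-th leaf of `y`, so that the
leaf of `p ∘ᵢ x` above the `b`-th input of `x` gets the number `σ⁻¹ (leafR hk i b)`.) -/
inductive IsLower (P : Operad.{u} s) : ∀ {a b : Tw P}, (a ⟶ b) → Prop
  | mk {n m k : ℕ} (hk : n + m = k + 1) (p : P.Op n) (i : Fin n) (q : P.Op m)
      (e : P.out q = P.inp p i) (y : P.Op k) (hy : P.comp hk p i q e = y)
      (σ : s.perms k) (z : P.Op k) (hz : P.act y σ = z)
      (hσ : ∀ b b' : Fin m, b < b' → σ.1.symm (leafR hk i b) < σ.1.symm (leafR hk i b')) :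
      IsLower P ((Step.below hk p i q e y hy).hom ≫ (Step.perm y σ z hz).hom)

/-- Active morphisms: the left class of the orthogonal factorization system generated by the strict
factorization system of upper and lower morphisms, i.e. the composites of an upper morphism followed
by a lower isomorphism. -/
def IsActive (P : Operad.{u} s) {a b : Tw P} (f : a ⟶ b) : Prop :=
  ∃ (c : Tw P) (g : a ⟶ c) (h : c ⟶ b), IsUpper P g ∧ IsLower P h ∧ IsIso h ∧ g ≫ h = f

/-- Inert morphisms: the right class of that orthogonal factorization system, i.e. the composites of
an upper isomorphism followed by a lower morphism. -/
def IsInert (P : Operad.{u} s) {a b : Tw P} (f : a ⟶ b) : Prop :=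
  ∃ (c : Tw P) (g : a ⟶ c) (h : c ⟶ b), IsUpper P g ∧ IsIso g ∧ IsLower P h ∧ g ≫ h = f

/-- 2-Segal presheaves (discrete decomposition spaces) over `Tw P`: every pushout of an active map
along an inert map is sent to a pullback. -/
def IsTwoSegal (P : Operad.{u} s) : ObjectProperty ((Tw P)ᵒᵖ ⥤ Type u) := fun X =>
  ∀ {a b c d : Tw P} (f : a ⟶ b) (g : a ⟶ c) (g' : b ⟶ d) (f' : c ⟶ d),
    IsActive P f → IsInert P g → IsPushout f g g' f' →
      IsPullback (X.map g'.op) (X.map f'.op) (X.map f.op) (X.map g.op)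

end Tw

end Operad

/-! ## Discrete fibrations and the corresponding presheaves -/

section DiscreteFibration

variable {E : Type u} [Category.{u} E] {B : Type u} [Category.{u} B]

/-- A functor `F : E ⥤ B` is a discrete fibration if every morphism `g : b ⟶ b'` of `B` and every
object `e` over `b'` admit a unique lift of `g` with target `e`. -/
def IsDiscreteFibration (F : E ⥤ B) : Prop :=
  ∀ {b b' : B} (g : b ⟶ b') (e : E), F.obj e = b' →
    ∃! x : (Σ e' : E, (e' ⟶ e)), F.IsHomLift g x.2

namespace IsDiscreteFibration

/-- The source of the lift of `g` with target `e`. -/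
noncomputable def source {F : E ⥤ B} (hF : IsDiscreteFibration F) {b b' : B} (g : b ⟶ b')
    (e : {e : E // F.obj e = b'}) : {e : E // F.obj e = b} :=
  ⟨(hF g e.1 e.2).choose.1,
    haveI := (hF g e.1 e.2).choose_spec.1
    IsHomLift.domain_eq F g (hF g e.1 e.2).choose.2⟩

theorem source_eq {F : E ⥤ B} (hF : IsDiscreteFibration F) {b b' : B} (g : b ⟶ b')
    (e : {e : E // F.obj e = b'}) (e' : {e : E // F.obj e = b}) (h : e'.1 ⟶ e.1)
    (hh : F.IsHomLift g h) : hF.source g e = e' := by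
  have := (hF g e.1 e.2).choose_spec.2 ⟨e'.1, h⟩ hh
  exact Subtype.ext (congrArg Sigma.fst this).symm

theorem source_spec {F : E ⥤ B} (hF : IsDiscreteFibration F) {b b' : B} (g : b ⟶ b')
    (e : {e : E // F.obj e = b'}) :
    ∃ h : (hF.source g e).1 ⟶ e.1, F.IsHomLift g h :=
  ⟨(hF g e.1 e.2).choose.2, (hF g e.1 e.2).choose_spec.1⟩

/-- The presheaf corresponding to a discrete fibration `F`: its value at `b` is the fibre of `F`
over `b`, and a morphism `g : b ⟶ b'` sends an object over `b'` to the source of the lift of `g`. -/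
noncomputable def presheaf {F : E ⥤ B} (hF : IsDiscreteFibration F) : Bᵒᵖ ⥤ Type u where
  obj b := {e : E // F.obj e = b.unop}
  map g := ↾(hF.source g.unop)
  map_id b := by
    ext e
    exact congrArg Subtype.val (hF.source_eq _ e e (𝟙 _) (IsHomLift.id e.2))
  map_comp g g' := by
    ext e
    obtain ⟨h, hh⟩ := hF.source_spec g.unop e
    obtain ⟨h', hh'⟩ := hF.source_spec g'.unop (hF.source g.unop e)
    exact congrArg Subtype.val
      (hF.source_eq _ e _ (h' ≫ h) (IsHomLift.comp F g'.unop g.unop h' h))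

/-- A functor over the base between discrete fibrations induces a morphism of presheaves, sending an
object of a fibre to its image. -/
noncomputable def presheafMap {E' : Type u} [Category.{u} E'] {F : E ⥤ B} {F' : E' ⥤ B}
    (hF : IsDiscreteFibration F) (hF' : IsDiscreteFibration F') (H : E ⥤ E') (hH : H ⋙ F' = F) :
    hF.presheaf ⟶ hF'.presheaf where
  app b := ↾(fun e => ⟨H.obj e.1, (Functor.congr_obj hH e.1).trans e.2⟩)
  naturality b b' g := by
    ext e
    obtain ⟨h, hh⟩ := hF.source_spec g.unop e
    refine (hF'.source_eq g.unop ⟨H.obj e.1, _⟩ ⟨H.obj (hF.source g.unop e).1,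
      (Functor.congr_obj hH _).trans (hF.source g.unop e).2⟩ (H.map h) ?_).symm
    subst hH
    refine IsHomLift.of_fac F' _ _ (hF.source g.unop e).2 e.2
      (IsHomLift.fac (H ⋙ F') g.unop h)

end IsDiscreteFibration

end DiscreteFibration

namespace Operad

variable {s : OperadKind}

/-- A morphism of operads `f` is a decomposition morphism if `f_*` is a discrete fibration. -/
def IsDecomposition {P₁ P : Operad.{u} s} (f : P₁ ⟶ P) : Prop :=
  IsDiscreteFibration (Tw.map f)

/-- The category of decomposition morphisms over `P`: the objects are the decomposition morphisms
with target `P`, and the morphisms are the morphisms of operads over `P`. -/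
abbrev DecompositionOver (P : Operad.{u} s) : Type (u + 1) :=
  ObjectProperty.FullSubcategory (fun f : Over P => IsDecomposition f.hom)

/-- The category of 2-Segal presheaves over `Tw P` and morphisms of presheaves. -/
abbrev TwoSegal (P : Operad.{u} s) : Type (u + 1) :=
  ObjectProperty.FullSubcategory (Tw.IsTwoSegal P)

/-- The functor sending a decomposition morphism `f` to the presheaf that corresponds to the
discrete fibration `f_*`. -/
noncomputable def fibrePresheaf (P : Operad.{u} s) :
    DecompositionOver P ⥤ ((Tw P)ᵒᵖ ⥤ Type u) where
  obj f := IsDiscreteFibration.presheaf f.property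
  map {f f'} h := IsDiscreteFibration.presheafMap f.property f'.property (Tw.map h.hom.left)
    (by rw [← Tw.map_comp, Over.w])
  map_id f := by
    ext b e
    exact Subtype.ext (Functor.congr_obj (Tw.map_id _) e.1)
  map_comp {f f' f''} h h' := by
    ext b e
    exact Subtype.ext (Functor.congr_obj (Tw.map_comp h.hom.left h'.hom.left) e.1)

end Operad

/-! ## Positions of leaves in iterated partial composites -/

/-! Write `1_c` for the identity operation of a colour `c`. Everything rests on one fact
(`isPushout_comp`): a partial composite `p ∘ᵢ q` is the pushout in `Tw P` of `p ← 1_c → q`, where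
`c` is the shared colour, `1_c ⟶ p` is the expression `p ∘ᵢ x` and `1_c ⟶ q` is `x ∘ q`. So the
category `Tw P` remembers composition, and a presheaf that sends these pushouts to pullbacks
(`SendsComp`) has elements that can be composed.

Why it is a pushout. A cut of `r` is a presentation `r = (A ∘ⱼ b)^σ`, up to permuting the inputs of
`A` and of `b`. Steps of expressions act on cuts: a graft goes to whichever part carries the leaf
concerned, and an operation placed below goes to `A`. Checking the operad axioms makes cuts a
functor on `Tw P`, so no normal form of expressions is needed. The same works for cuts with
decorations of `A` and `b`. A morphism `F : p ⟶ r` sends the cut of `p` at its input `i` to a cut of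
`r` whose part `A` is decorated by a morphism from `p` keeping that input. A morphism `G : q ⟶ r`
similarly decorates the part `b` of a cut. If `F` and `G` agree on `1_c`, the two underlying cuts
coincide, the decorations combine (`Cut.exists_glue`), and evaluating the result gives `p ∘ᵢ q ⟶ r`.
Uniqueness holds because a doubly decorated cut is determined by its two halves (`Cut.glue_ext`) and
a morphism is recovered from its action on the cut of `p ∘ᵢ q` decorated by identities.

2-Segal is equivalent to `SendsComp`. The leg `1_c ⟶ p` is inert and `1_c ⟶ q` is active, which
gives one direction. Conversely, upper morphisms are generated by grafts and permutations, and
cancellation of pushouts shows that the pushout of a graft along `A ∘ⱼ x` is again sent to a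
pullback. Isomorphisms account for the rest (`isTwoSegal_of_sendsComp`).

Discrete fibrations. If `f_*` is one, compatible operations of `P₁` over `p` and `q` have a
composite over `p ∘ᵢ q`. Any other operation with the same restrictions receives a morphism from
this composite, by the pushout property in `Tw P₁`. That morphism lies over an identity, so
uniqueness of lifts makes the two operations equal. Hence the fibres satisfy `SendsComp`.
Conversely, the elements of a presheaf with `SendsComp` form an operad over `P`. Each generating
step lifts uniquely, and the relations lift to relations, so the projection induces a discrete
fibration with the given fibres. Finally, a map of presheaves of fibres preserves restrictions,
which characterize composites, so it comes from a unique morphism of operads over `P`. -/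

theorem leaf_cases {n m k : ℕ} (hk : n + m = k + 1) (i : Fin n) (c : Fin k) :
    (∃ (a : Fin n) (ha : a ≠ i), c = leafL hk i a ha) ∨ ∃ b : Fin m, c = leafR hk i b := by
  obtain ⟨x, rfl⟩ := (leaf_bijective hk i).2 c
  rcases x with ⟨a, ha⟩ | b
  · exact Or.inl ⟨a, ha, rfl⟩
  · exact Or.inr ⟨b, rfl⟩

theorem leafL_injective {n m k : ℕ} (hk : n + m = k + 1) (i : Fin n) {a a' : Fin n} {ha : a ≠ i}
    {ha' : a' ≠ i} (h : leafL hk i a ha = leafL hk i a' ha') : a = a' := by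
  have := (leaf_bijective hk i).1 (a₁ := .inl ⟨a, ha⟩) (a₂ := .inl ⟨a', ha'⟩) h
  simpa using this

theorem leafR_injective {n m k : ℕ} (hk : n + m = k + 1) (i : Fin n) {b b' : Fin m}
    (h : leafR hk i b = leafR hk i b') : b = b' := by
  have := (leaf_bijective hk i).1 (a₁ := .inr b) (a₂ := .inr b') h
  simpa using this

theorem leafL_ne_leafR {n m k : ℕ} (hk : n + m = k + 1) (i : Fin n) {a : Fin n} (ha : a ≠ i)
    (b : Fin m) : leafL hk i a ha ≠ leafR hk i b := by
  intro h
  have := (leaf_bijective hk i).1 (a₁ := .inl ⟨a, ha⟩) (a₂ := .inr b) h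
  simp at this

theorem leafL_ne_leafL {n m k : ℕ} (hk : n + m = k + 1) (i : Fin n) {a a' : Fin n} (ha : a ≠ i)
    (ha' : a' ≠ i) (h : a ≠ a') : leafL hk i a ha ≠ leafL hk i a' ha' :=
  fun h' => h (leafL_injective hk i h')

theorem leafR_ne_leafR {n m k : ℕ} (hk : n + m = k + 1) (i : Fin n) {b b' : Fin m} (h : b ≠ b') :
    leafR hk i b ≠ leafR hk i b' :=
  fun h' => h (leafR_injective hk i h')

section Assoc

variable {n m l k₁ k₂ k : ℕ} (h₁ : n + m = k₁ + 1) (h₂ : k₁ + l = k + 1) (h₃ : m + l = k₂ + 1)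
  (h₄ : n + k₂ = k + 1)

/-- The three identities of this section follow an input of `r`, an input of `q` other than `j`, and
an input of `p` other than `i` through the two sides of `(p ∘ᵢ q) ∘ⱼ r = p ∘ᵢ (q ∘ⱼ r)`. -/
theorem leafR_leafR (i : Fin n) (j : Fin m) (t : Fin l) :
    leafR h₂ (leafR h₁ i j) t = leafR h₄ i (leafR h₃ j t) := by
  apply Fin.ext
  simp only [leafR]
  omega

theorem leafL_leafR_leafR (i : Fin n) (j b : Fin m) (hb : b ≠ j)
    (hb' : leafR h₁ i b ≠ leafR h₁ i j) :
    leafL h₂ (leafR h₁ i j) (leafR h₁ i b) hb' = leafR h₄ i (leafL h₃ j b hb) := by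
  apply Fin.ext
  have h0 : b.val ≠ j.val := fun h => hb (Fin.ext h)
  have h6 := j.isLt
  simp only [leafR, leafL]
  rcases lt_or_gt_of_ne h0 with h | h
  · rw [if_pos h]
    exact if_pos (by omega)
  · rw [if_neg (by omega : ¬ b.val < j.val)]
    exact (if_neg (by omega)).trans (by omega)

theorem leafL_leafR_leafL (i a : Fin n) (j : Fin m) (ha : a ≠ i)
    (ha' : leafL h₁ i a ha ≠ leafR h₁ i j) :
    leafL h₂ (leafR h₁ i j) (leafL h₁ i a ha) ha' = leafL h₄ i a ha := by
  apply Fin.ext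
  have h0 : a.val ≠ i.val := fun h => ha (Fin.ext h)
  have h5 := i.isLt
  have h6 := j.isLt
  have h7 := a.isLt
  simp only [leafR, leafL]
  split_ifs <;> omega

end Assoc

section Parallel

variable {n m l k₁ k₂ k : ℕ} (h₁ : n + m = k₁ + 1) (h₂ : k₁ + l = k + 1) (h₃ : n + l = k₂ + 1)
  (h₄ : k₂ + m = k + 1)

/-- In `(p ∘ᵢ q) ∘ₐ r = (p ∘ₐ r) ∘ᵢ q` this follows an input of `r`. The inputs of `q` are the same
case with the roles of `i` and `a` exchanged, and the remaining inputs of `p` are treated next. -/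
theorem leafR_leafL (i a : Fin n) (ha : a ≠ i) (ha' : i ≠ a) (t : Fin l)
    (h : leafR h₃ a t ≠ leafL h₃ a i ha') :
    leafR h₂ (leafL h₁ i a ha) t = leafL h₄ (leafL h₃ a i ha') (leafR h₃ a t) h := by
  apply Fin.ext
  have h0 : a.val ≠ i.val := fun h => ha (Fin.ext h)
  have h5 := i.isLt
  have h6 := t.isLt
  have h7 := a.isLt
  simp only [leafR, leafL]
  split_ifs <;> omega

theorem leafL_leafL_leafL (i a d : Fin n) (ha : a ≠ i) (ha' : i ≠ a) (hd : d ≠ i) (hd' : d ≠ a)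
    (h : leafL h₁ i d hd ≠ leafL h₁ i a ha) (h' : leafL h₃ a d hd' ≠ leafL h₃ a i ha') :
    leafL h₂ (leafL h₁ i a ha) (leafL h₁ i d hd) h =
      leafL h₄ (leafL h₃ a i ha') (leafL h₃ a d hd') h' := by
  apply Fin.ext
  have h0 : a.val ≠ i.val := fun h => ha (Fin.ext h)
  have h01 : d.val ≠ i.val := fun h => hd (Fin.ext h)
  have h02 : d.val ≠ a.val := fun h => hd' (Fin.ext h)
  have h5 := i.isLt
  have h6 := d.isLt
  have h7 := a.isLt
  simp only [leafL]
  split_ifs <;> omega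

end Parallel

theorem leafR_zero {n k : ℕ} (hk : n + 1 = k + 1) (i : Fin n) (b : Fin 1) :
    leafR hk i b = i.cast (by omega) := by
  apply Fin.ext
  simp [leafR]

theorem leafL_one {n k : ℕ} (hk : n + 1 = k + 1) (i a : Fin n) (ha : a ≠ i) :
    leafL hk i a ha = a.cast (by omega) := by
  apply Fin.ext
  simp [leafL]

theorem leafR_one {n k : ℕ} (hk : 1 + n = k + 1) (i : Fin 1) (b : Fin n) :
    leafR hk i b = b.cast (by omega) := by
  apply Fin.ext
  simp [leafR]

namespace OperadKind

/-! ## Identities between block permutations -/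

variable (s : OperadKind)

theorem perm_ext {n : ℕ} {σ τ : s.perms n} (h : ∀ a, σ.1 a = τ.1 a) : σ = τ :=
  Subtype.ext (Equiv.ext h)

theorem block_leafL {n m k : ℕ} (hk : n + m = k + 1) (i : Fin n) (σ : s.perms n) (τ : s.perms m)
    (a : Fin n) (ha : a ≠ i) :
    (s.block hk i σ τ).1 (leafL hk i a ha) = leafL hk (σ.1 i) (σ.1 a) (σ.1.injective.ne ha) :=
  blockPerm_leafL hk i σ.1 τ.1 a ha

theorem block_leafR {n m k : ℕ} (hk : n + m = k + 1) (i : Fin n) (σ : s.perms n) (τ : s.perms m)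
    (b : Fin m) : (s.block hk i σ τ).1 (leafR hk i b) = leafR hk (σ.1 i) (τ.1 b) :=
  blockPerm_leafR hk i σ.1 τ.1 b

theorem perm_mul_apply {n : ℕ} (σ τ : s.perms n) (a : Fin n) : (σ * τ).1 a = σ.1 (τ.1 a) := rfl

theorem perm_one_apply {n : ℕ} (a : Fin n) : (1 : s.perms n).1 a = a := rfl

theorem leafL_congr {n m k : ℕ} {hk : n + m = k + 1} {i i' a a' : Fin n} {ha : a ≠ i} (hi : i = i')
    (h : a = a') : leafL hk i a ha = leafL hk i' a' (hi ▸ h ▸ ha) := by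
  subst hi h
  rfl

/-- The left factor is based at `τ i` because the action is on the right: the input `i` of `(p^σ)^τ`
is the input `τ i` of `p^σ`. -/
theorem block_mul {n m k : ℕ} (hk : n + m = k + 1) (i : Fin n) (σ τ : s.perms n)
    (σ' τ' : s.perms m) :
    s.block hk i (σ * τ) (σ' * τ') = s.block hk (τ.1 i) σ σ' * s.block hk i τ τ' := by
  refine s.perm_ext fun c => ?_
  rcases leaf_cases hk i c with ⟨a, ha, rfl⟩ | ⟨b, rfl⟩
  · rw [perm_mul_apply, block_leafL, block_leafL, block_leafL]
    rfl
  · rw [perm_mul_apply, block_leafR, block_leafR, block_leafR]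
    rfl

theorem block_one {n m k : ℕ} (hk : n + m = k + 1) (i : Fin n) : s.block hk i 1 1 = 1 := by
  refine s.perm_ext fun c => ?_
  rcases leaf_cases hk i c with ⟨a, ha, rfl⟩ | ⟨b, rfl⟩
  · rw [block_leafL]
    rfl
  · rw [block_leafR]
    rfl

/-- The images of `i` and `a` are variables here, so that nested block permutations can be evaluated
without rewriting inside the proof argument of `leafL`. -/
theorem block_leafL_eq {n m k : ℕ} (hk : n + m = k + 1) {i : Fin n} {σ : s.perms n}
    (τ : s.perms m) {a : Fin n} (ha : a ≠ i) {i' a' : Fin n} (hi : σ.1 i = i') (h : σ.1 a = a')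
    (ha' : a' ≠ i') : (s.block hk i σ τ).1 (leafL hk i a ha) = leafL hk i' a' ha' := by
  subst hi h
  exact s.block_leafL hk i σ τ a ha

theorem block_leafR_eq {n m k : ℕ} (hk : n + m = k + 1) {i : Fin n} {σ : s.perms n}
    {τ : s.perms m} {b : Fin m} {i' : Fin n} {b' : Fin m} (hi : σ.1 i = i') (h : τ.1 b = b') :
    (s.block hk i σ τ).1 (leafR hk i b) = leafR hk i' b' := by
  subst hi h
  exact s.block_leafR hk i σ τ b

/-- Permutations compose like operations. Both sides agree on each of the three kinds of leaves of a
double composite, by the corresponding identity between leaf positions. -/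
theorem block_assoc {n m l k₁ k₂ k : ℕ} (h₁ : n + m = k₁ + 1) (h₂ : k₁ + l = k + 1)
    (h₃ : m + l = k₂ + 1) (h₄ : n + k₂ = k + 1) (i : Fin n) (j : Fin m) (σ : s.perms n)
    (τ : s.perms m) (ρ : s.perms l) :
    s.block h₂ (leafR h₁ i j) (s.block h₁ i σ τ) ρ = s.block h₄ i σ (s.block h₃ j τ ρ) := by
  refine s.perm_ext fun c => ?_
  have hj := s.block_leafR h₁ i σ τ j
  rcases leaf_cases h₄ i c with ⟨a, ha, rfl⟩ | ⟨b, rfl⟩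
  · have hσ : σ.1 a ≠ σ.1 i := σ.1.injective.ne ha
    refine (congrArg _ (leafL_leafR_leafL h₁ h₂ h₄ i a j ha (leafL_ne_leafR _ _ _ _)).symm).trans ?_
    refine (s.block_leafL_eq h₂ ρ _ hj (s.block_leafL h₁ i σ τ a ha) (leafL_ne_leafR _ _ _ _)).trans ?_
    exact (leafL_leafR_leafL h₁ h₂ h₄ _ _ _ hσ _).trans (s.block_leafL h₄ ..).symm
  · rcases leaf_cases h₃ j b with ⟨b, hb, rfl⟩ | ⟨t, rfl⟩
    · have hτ : τ.1 b ≠ τ.1 j := τ.1.injective.ne hb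
      refine (congrArg _ (leafL_leafR_leafR h₁ h₂ h₃ h₄ i j b hb
        (leafR_ne_leafR _ _ hb)).symm).trans ?_
      refine (s.block_leafL_eq h₂ ρ _ hj (s.block_leafR h₁ i σ τ b)
        (leafR_ne_leafR _ _ hτ)).trans ?_
      refine (leafL_leafR_leafR h₁ h₂ h₃ h₄ _ _ _ hτ _).trans ?_
      exact (s.block_leafR_eq h₄ rfl (s.block_leafL h₃ j τ ρ b hb)).symm
    · refine (congrArg _ (leafR_leafR h₁ h₂ h₃ h₄ i j t).symm).trans ?_
      refine (s.block_leafR_eq h₂ hj rfl).trans ?_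
      refine (leafR_leafR h₁ h₂ h₃ h₄ _ _ _).trans ?_
      exact (s.block_leafR_eq h₄ rfl (s.block_leafR h₃ j τ ρ t)).symm

theorem block_parallel {n m l k₁ k₂ k : ℕ} (h₁ : n + m = k₁ + 1) (h₂ : k₁ + l = k + 1)
    (h₃ : n + l = k₂ + 1) (h₄ : k₂ + m = k + 1) (i a : Fin n) (ha : a ≠ i) (ha' : i ≠ a)
    (σ : s.perms n) (τ : s.perms m) (ρ : s.perms l) :
    s.block h₂ (leafL h₁ i a ha) (s.block h₁ i σ τ) ρ =
      s.block h₄ (leafL h₃ a i ha') (s.block h₃ a σ ρ) τ := by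
  refine s.perm_ext fun c => ?_
  have e1 := s.block_leafL h₁ i σ τ a ha
  have e2 := s.block_leafL h₃ a σ ρ i ha'
  rcases leaf_cases h₂ (leafL h₁ i a ha) c with ⟨d, hd, rfl⟩ | ⟨t, rfl⟩
  · rcases leaf_cases h₁ i d with ⟨d, hd', rfl⟩ | ⟨b, rfl⟩
    · have hda : d ≠ a := by
        rintro rfl
        exact hd rfl
      have hσ : σ.1 d ≠ σ.1 i := σ.1.injective.ne hd'
      have hσ' : σ.1 d ≠ σ.1 a := σ.1.injective.ne hda
      refine (s.block_leafL_eq h₂ ρ _ e1 (s.block_leafL h₁ i σ τ d hd')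
        (leafL_ne_leafL _ _ _ _ hσ')).trans ?_
      refine (leafL_leafL_leafL h₁ h₂ h₃ h₄ _ _ _ _ (σ.1.injective.ne ha') hσ hσ' _
        (leafL_ne_leafL _ _ _ _ hσ)).trans ?_
      refine Eq.trans ?_ (congrArg _ (leafL_leafL_leafL h₁ h₂ h₃ h₄ i a d ha ha' hd' hda hd
        (leafL_ne_leafL _ _ _ _ hd')).symm)
      exact (s.block_leafL_eq h₄ τ _ e2 (s.block_leafL h₃ a σ ρ d hda) _).symm
    · refine (s.block_leafL_eq h₂ ρ _ e1 (s.block_leafR h₁ i σ τ b)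
        (leafL_ne_leafR _ _ _ _).symm).trans ?_
      refine (leafR_leafL h₃ h₄ h₁ h₂ _ _ (σ.1.injective.ne ha') _ _ _).symm.trans ?_
      refine Eq.trans ?_ (congrArg _ (leafR_leafL h₃ h₄ h₁ h₂ a i ha' ha b hd))
      exact (s.block_leafR_eq h₄ e2 rfl).symm
  · refine (s.block_leafR_eq h₂ e1 rfl).trans ?_
    refine (leafR_leafL h₁ h₂ h₃ h₄ _ _ _ (σ.1.injective.ne ha') _
      (leafL_ne_leafR _ _ _ _).symm).trans ?_
    refine Eq.trans ?_ (congrArg _ (leafR_leafL h₁ h₂ h₃ h₄ i a ha ha' t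
      (leafL_ne_leafR _ _ _ _).symm).symm)
    exact (s.block_leafL_eq h₄ τ _ e2 (s.block_leafR h₃ a σ ρ t) _).symm

theorem block_unit_right {n : ℕ} (hk : n + 1 = n + 1) (i : Fin n) (σ : s.perms n)
    (τ : s.perms 1) : s.block hk i σ τ = σ := by
  refine s.perm_ext fun c => ?_
  rcases leaf_cases hk i c with ⟨a, ha, rfl⟩ | ⟨b, rfl⟩
  · rw [block_leafL, leafL_one, leafL_one]
    rfl
  · rw [block_leafR, leafR_zero, leafR_zero]
    rfl

theorem block_unit_left {n : ℕ} (hk : 1 + n = n + 1) (i : Fin 1) (σ : s.perms 1)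
    (τ : s.perms n) : s.block hk i σ τ = τ := by
  refine s.perm_ext fun c => ?_
  rcases leaf_cases hk i c with ⟨a, ha, rfl⟩ | ⟨b, rfl⟩
  · exact absurd (Subsingleton.elim _ _) ha
  · rw [block_leafR, leafR_one, leafR_one]
    rfl

/-- Off `i` the permutation `σ` is read from the leaves `leafL`, and `τ` is read from the leaves
`leafR`. The value at `i` has to be given: for `n = 2` and `m = 0` the block permutation acts on one
leaf and forgets `σ`. This is what makes gluing of decorated cuts unique. -/
theorem block_injective {n m k : ℕ} (hk : n + m = k + 1) (i : Fin n) {σ σ' : s.perms n}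
    {τ τ' : s.perms m} (hi : σ.1 i = σ'.1 i) (h : s.block hk i σ τ = s.block hk i σ' τ') :
    σ = σ' ∧ τ = τ' := by
  constructor
  · refine s.perm_ext fun a => ?_
    by_cases ha : a = i
    · rw [ha, hi]
    · have h1 := block_leafL s hk i σ τ a ha
      rw [h, block_leafL] at h1
      exact (leafL_injective hk (σ'.1 i) (h1.trans (leafL_congr hi rfl))).symm
  · refine s.perm_ext fun b => ?_
    have h1 := block_leafR s hk i σ τ b
    rw [h, block_leafR, hi] at h1
    exact (leafR_injective hk _ h1).symm

end OperadKind

namespace Operad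

variable {s : OperadKind} {P : Operad.{u} s}

namespace Tw

/-! ## The relations between steps, as equations in the twisted arrow category -/

section Relations

variable {n m l k₁ k₂ k : ℕ}

/-- Here and below the positions are variables with an equation, so that a relation applies also
when the position arises in another form. -/
theorem Step.assoc₁ {h₁ : n + m = k₁ + 1} {h₂ : k₁ + l = k + 1} {h₃ : m + l = k₂ + 1}
    {h₄ : n + k₂ = k + 1} {p : P.Op n} {i : Fin n} {q : P.Op m} {j : Fin m} {r : P.Op l}
    {e₁ : P.out q = P.inp p i} {pq : P.Op k₁} {hpq : P.comp h₁ p i q e₁ = pq}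
    {e₃ : P.out r = P.inp q j} {qr : P.Op k₂} (hqr : P.comp h₃ q j r e₃ = qr)
    {t : Fin k₁} (ht : t = leafR h₁ i j)
    {e₂ : P.out r = P.inp pq t} {e₄ : P.out qr = P.inp p i}
    {z : P.Op k} {hz : P.comp h₂ pq t r e₂ = z} {hz' : P.comp h₄ p i qr e₄ = z} :
    (Step.above h₁ p i q e₁ pq hpq).hom ≫ (Step.above h₂ pq t r e₂ z hz).hom =
      (Step.above h₄ p i qr e₄ z hz').hom := by
  subst ht
  exact Quot.sound (.assoc₁ h₁ h₂ h₃ h₄ p i q j r e₁ pq hpq e₃ qr hqr e₂ e₄ z hz hz' .var)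

theorem Step.assoc₂ {h₁ : n + m = k₁ + 1} {h₂ : k₁ + l = k + 1} {h₃ : m + l = k₂ + 1}
    {h₄ : n + k₂ = k + 1} {p : P.Op n} {i : Fin n} {q : P.Op m} {j : Fin m} {r : P.Op l}
    {e₁ : P.out q = P.inp p i} {pq : P.Op k₁} {hpq : P.comp h₁ p i q e₁ = pq}
    {e₃ : P.out r = P.inp q j} {qr : P.Op k₂} {hqr : P.comp h₃ q j r e₃ = qr}
    {t : Fin k₁} (ht : t = leafR h₁ i j)
    {e₂ : P.out r = P.inp pq t} {e₄ : P.out qr = P.inp p i}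
    {z : P.Op k} {hz : P.comp h₂ pq t r e₂ = z} {hz' : P.comp h₄ p i qr e₄ = z} :
    (Step.below h₁ p i q e₁ pq hpq).hom ≫ (Step.above h₂ pq t r e₂ z hz).hom =
      (Step.above h₃ q j r e₃ qr hqr).hom ≫ (Step.below h₄ p i qr e₄ z hz').hom := by
  subst ht
  exact Quot.sound (.assoc₂ h₁ h₂ h₃ h₄ p i q j r e₁ pq hpq e₃ qr hqr e₂ e₄ z hz hz' .var)

theorem Step.assoc₃ {h₁ : n + m = k₁ + 1} {h₂ : k₁ + l = k + 1} {h₃ : m + l = k₂ + 1}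
    {h₄ : n + k₂ = k + 1} {p : P.Op n} {i : Fin n} {q : P.Op m} {j : Fin m} {r : P.Op l}
    {e₁ : P.out q = P.inp p i} {pq : P.Op k₁} (hpq : P.comp h₁ p i q e₁ = pq)
    {e₃ : P.out r = P.inp q j} {qr : P.Op k₂} {hqr : P.comp h₃ q j r e₃ = qr}
    {t : Fin k₁} (ht : t = leafR h₁ i j)
    {e₂ : P.out r = P.inp pq t} {e₄ : P.out qr = P.inp p i}
    {z : P.Op k} {hz : P.comp h₂ pq t r e₂ = z} {hz' : P.comp h₄ p i qr e₄ = z} :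
    (Step.below h₂ pq t r e₂ z hz).hom =
      (Step.below h₃ q j r e₃ qr hqr).hom ≫ (Step.below h₄ p i qr e₄ z hz').hom := by
  subst ht
  exact Quot.sound (.assoc₃ h₁ h₂ h₃ h₄ p i q j r e₁ pq hpq e₃ qr hqr e₂ e₄ z hz hz' .var)

theorem Step.parallel₁ {h₁ : n + m = k₁ + 1} {h₂ : k₁ + l = k + 1} {h₃ : n + l = k₂ + 1}
    {h₄ : k₂ + m = k + 1} {p : P.Op n} {i a : Fin n} (ha : a ≠ i) {q : P.Op m} {r : P.Op l}
    {e₁ : P.out q = P.inp p i} {pq : P.Op k₁} {hpq : P.comp h₁ p i q e₁ = pq}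
    {e₃ : P.out r = P.inp p a} {pr : P.Op k₂} {hpr : P.comp h₃ p a r e₃ = pr}
    {t : Fin k₁} (ht : t = leafL h₁ i a ha) {t' : Fin k₂} (ht' : t' = leafL h₃ a i ha.symm)
    {e₂ : P.out r = P.inp pq t} {e₄ : P.out q = P.inp pr t'}
    {z : P.Op k} {hz : P.comp h₂ pq t r e₂ = z} {hz' : P.comp h₄ pr t' q e₄ = z} :
    (Step.above h₁ p i q e₁ pq hpq).hom ≫ (Step.above h₂ pq t r e₂ z hz).hom =
      (Step.above h₃ p a r e₃ pr hpr).hom ≫ (Step.above h₄ pr t' q e₄ z hz').hom := by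
  subst ht ht'
  exact Quot.sound (.parallel₁ h₁ h₂ h₃ h₄ p i a ha q r e₁ pq hpq e₃ pr hpr e₂ e₄ z hz hz' .var)

theorem Step.parallel₂ {h₁ : n + m = k₁ + 1} {h₂ : k₁ + l = k + 1} {h₃ : n + l = k₂ + 1}
    {h₄ : k₂ + m = k + 1} {p : P.Op n} {i a : Fin n} (ha : a ≠ i) {q : P.Op m} {r : P.Op l}
    {e₁ : P.out q = P.inp p i} {pq : P.Op k₁} {hpq : P.comp h₁ p i q e₁ = pq}
    {e₃ : P.out r = P.inp p a} {pr : P.Op k₂} (hpr : P.comp h₃ p a r e₃ = pr)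
    {t : Fin k₁} (ht : t = leafL h₁ i a ha) {t' : Fin k₂} (ht' : t' = leafL h₃ a i ha.symm)
    {e₂ : P.out r = P.inp pq t} {e₄ : P.out q = P.inp pr t'}
    {z : P.Op k} {hz : P.comp h₂ pq t r e₂ = z} {hz' : P.comp h₄ pr t' q e₄ = z} :
    (Step.below h₁ p i q e₁ pq hpq).hom ≫ (Step.above h₂ pq t r e₂ z hz).hom =
      (Step.below h₄ pr t' q e₄ z hz').hom := by
  subst ht ht'
  exact Quot.sound (.parallel₂ h₁ h₂ h₃ h₄ p i a ha q r e₁ pq hpq e₃ pr hpr e₂ e₄ z hz hz' .var)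

theorem Step.comp_one {hk : n + 1 = n + 1} {p : P.Op n} {i : Fin n} {c : P.Colour}
    {e : P.out (P.one c) = P.inp p i} {hz : P.comp hk p i (P.one c) e = p} :
    (Step.above hk p i (P.one c) e p hz).hom = 𝟙 _ :=
  Quot.sound (.comp_one hk p i c e hz .var)

theorem Step.one_comp {hk : 1 + n = n + 1} {p : P.Op n} {i : Fin 1} {c : P.Colour}
    {e : P.out p = P.inp (P.one c) i} {hz : P.comp hk (P.one c) i p e = p} :
    (Step.below hk (P.one c) i p e p hz).hom = 𝟙 _ :=
  Quot.sound (.one_comp hk c i p e hz .var)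

theorem Step.act_one {p : P.Op n} {hz : P.act p 1 = p} : (Step.perm p 1 p hz).hom = 𝟙 _ :=
  Quot.sound (.act_one p hz .var)

theorem Step.act_mul {p : P.Op n} {σ τ ρ : s.perms n} (hρ : ρ = σ * τ) {pσ z : P.Op n}
    {hpσ : P.act p σ = pσ} {hz : P.act p ρ = z} {hz' : P.act pσ τ = z} :
    (Step.perm p σ pσ hpσ).hom ≫ (Step.perm pσ τ z hz').hom = (Step.perm p ρ z hz).hom := by
  subst hρ
  exact (Quot.sound (.act_mul p σ τ pσ z hpσ hz hz' .var)).symm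

theorem Step.act_comp₁ {hk : n + m = k + 1} {p : P.Op n} {i : Fin n} {q : P.Op m}
    {σ : s.perms n} {τ : s.perms m} {pσ : P.Op n} {hpσ : P.act p σ = pσ}
    {qτ : P.Op m} (hqτ : P.act q τ = qτ) {i' : Fin n} (hi' : i' = σ.1 i)
    {e : P.out qτ = P.inp pσ i} {e' : P.out q = P.inp p i'}
    {pq : P.Op k} {hpq : P.comp hk p i' q e' = pq} {ρ : s.perms k} (hρ : ρ = s.block hk i σ τ)
    {z : P.Op k} {hz : P.comp hk pσ i qτ e = z} {hz' : P.act pq ρ = z} :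
    (Step.perm p σ pσ hpσ).hom ≫ (Step.above hk pσ i qτ e z hz).hom =
      (Step.above hk p i' q e' pq hpq).hom ≫ (Step.perm pq ρ z hz').hom := by
  subst hi' hρ
  exact Quot.sound (.act_comp₁ hk p i q σ τ pσ hpσ qτ hqτ e e' pq hpq z hz hz' .var)

theorem Step.act_comp₂ {hk : n + m = k + 1} {p : P.Op n} {i : Fin n} {q : P.Op m}
    {σ : s.perms n} {τ : s.perms m} {pσ : P.Op n} (hpσ : P.act p σ = pσ)
    {qτ : P.Op m} {hqτ : P.act q τ = qτ} {i' : Fin n} (hi' : i' = σ.1 i)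
    {e : P.out qτ = P.inp pσ i} {e' : P.out q = P.inp p i'}
    {pq : P.Op k} {hpq : P.comp hk p i' q e' = pq} {ρ : s.perms k} (hρ : ρ = s.block hk i σ τ)
    {z : P.Op k} {hz : P.comp hk pσ i qτ e = z} {hz' : P.act pq ρ = z} :
    (Step.perm q τ qτ hqτ).hom ≫ (Step.below hk pσ i qτ e z hz).hom =
      (Step.below hk p i' q e' pq hpq).hom ≫ (Step.perm pq ρ z hz').hom := by
  subst hi' hρ
  exact Quot.sound (.act_comp₂ hk p i q σ τ pσ hpσ qτ hqτ e e' pq hpq z hz hz' .var)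

end Relations

/-- A property of morphisms with given source that holds for the identity and is stable under
composition with a step holds for all morphisms. -/
theorem hom_induction {a : Tw P} {C : ∀ {b : Tw P}, (a ⟶ b) → Prop} (id : C (𝟙 a))
    (step : ∀ {b c : Tw P} (f : a ⟶ b) (g : Step P b c), C f → C (f ≫ g.hom)) {b : Tw P}
    (f : a ⟶ b) : C f := by
  refine Quot.ind (fun E => ?_) f
  clear f
  induction E with
  | var => exact id
  | step E g ih => exact step (Quot.mk _ E) g ih

end Tw

end Operad

namespace Operad

variable {s : OperadKind} {P : Operad.{u} s}

namespace Tw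

/-! ## Decorated cuts of operations

A cut of an operation `r` is a presentation of `r` as `(A ∘ⱼ b)^σ`, up to permutations of the inputs
of `A` and `b`.  The operation `A`, with its distinguished input `j`, is decorated by an element of
a pointed module, and `b` by an element of an upper module. -/

variable (P) in
/-- A family of sets indexed by operations with a distinguished input, on which the steps that keep
that input act compatibly with the operad axioms. -/
structure PointedModule where
  obj : ∀ {n : ℕ}, P.Op n → Fin n → Type u
  -- The new position `t'` of the distinguished input is a variable constrained by an equation. The
  -- two sides of an operad axiom give that position in different forms, and in this way both sides
  -- have the same type.
  above : ∀ {n m k : ℕ} (hk : n + m = k + 1) (p : P.Op n) (i : Fin n) (q : P.Op m)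
    (e : P.out q = P.inp p i) (z : P.Op k) (_ : P.comp hk p i q e = z) (t : Fin n) (ht : t ≠ i)
    (t' : Fin k) (_ : t' = leafL hk i t ht), obj p t → obj z t'
  below : ∀ {n m k : ℕ} (hk : n + m = k + 1) (p : P.Op n) (i : Fin n) (q : P.Op m)
    (e : P.out q = P.inp p i) (z : P.Op k) (_ : P.comp hk p i q e = z) (t : Fin m)
    (t' : Fin k) (_ : t' = leafR hk i t), obj q t → obj z t'
  perm : ∀ {n : ℕ} (p : P.Op n) (σ : s.perms n) (z : P.Op n) (_ : P.act p σ = z) (t t' : Fin n)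
    (_ : t = σ.1 t'), obj p t → obj z t'
  assoc₁ : ∀ {n m l k₁ k₂ k : ℕ} (h₁ : n + m = k₁ + 1) (h₂ : k₁ + l = k + 1) (h₃ : m + l = k₂ + 1)
    (h₄ : n + k₂ = k + 1) (p : P.Op n) (i : Fin n) (q : P.Op m) (j : Fin m) (r : P.Op l)
    (e₁ : P.out q = P.inp p i) (pq : P.Op k₁) (hpq : P.comp h₁ p i q e₁ = pq)
    (e₃ : P.out r = P.inp q j) (qr : P.Op k₂) (_hqr : P.comp h₃ q j r e₃ = qr)
    (e₂ : P.out r = P.inp pq (leafR h₁ i j)) (e₄ : P.out qr = P.inp p i)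
    (z : P.Op k) (hz : P.comp h₂ pq (leafR h₁ i j) r e₂ = z) (hz' : P.comp h₄ p i qr e₄ = z)
    (t : Fin n) (ht : t ≠ i) (t₁ : Fin k₁) (ht₁ : t₁ = leafL h₁ i t ht)
    (ht₁' : t₁ ≠ leafR h₁ i j) (t₂ : Fin k) (ht₂ : t₂ = leafL h₂ (leafR h₁ i j) t₁ ht₁')
    (ht₂' : t₂ = leafL h₄ i t ht) (x : obj p t),
    above h₂ pq (leafR h₁ i j) r e₂ z hz t₁ ht₁' t₂ ht₂ (above h₁ p i q e₁ pq hpq t ht t₁ ht₁ x) =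
      above h₄ p i qr e₄ z hz' t ht t₂ ht₂' x
  assoc₂ : ∀ {n m l k₁ k₂ k : ℕ} (h₁ : n + m = k₁ + 1) (h₂ : k₁ + l = k + 1) (h₃ : m + l = k₂ + 1)
    (h₄ : n + k₂ = k + 1) (p : P.Op n) (i : Fin n) (q : P.Op m) (j : Fin m) (r : P.Op l)
    (e₁ : P.out q = P.inp p i) (pq : P.Op k₁) (hpq : P.comp h₁ p i q e₁ = pq)
    (e₃ : P.out r = P.inp q j) (qr : P.Op k₂) (hqr : P.comp h₃ q j r e₃ = qr)
    (e₂ : P.out r = P.inp pq (leafR h₁ i j)) (e₄ : P.out qr = P.inp p i)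
    (z : P.Op k) (hz : P.comp h₂ pq (leafR h₁ i j) r e₂ = z) (hz' : P.comp h₄ p i qr e₄ = z)
    (t : Fin m) (ht : t ≠ j) (t₁ : Fin k₁) (ht₁ : t₁ = leafR h₁ i t)
    (ht₁' : t₁ ≠ leafR h₁ i j) (t₂ : Fin k₂) (ht₂ : t₂ = leafL h₃ j t ht) (t₃ : Fin k)
    (ht₃ : t₃ = leafL h₂ (leafR h₁ i j) t₁ ht₁') (ht₃' : t₃ = leafR h₄ i t₂) (x : obj q t),
    above h₂ pq (leafR h₁ i j) r e₂ z hz t₁ ht₁' t₃ ht₃ (below h₁ p i q e₁ pq hpq t t₁ ht₁ x) =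
      below h₄ p i qr e₄ z hz' t₂ t₃ ht₃' (above h₃ q j r e₃ qr hqr t ht t₂ ht₂ x)
  assoc₃ : ∀ {n m l k₁ k₂ k : ℕ} (h₁ : n + m = k₁ + 1) (h₂ : k₁ + l = k + 1) (h₃ : m + l = k₂ + 1)
    (h₄ : n + k₂ = k + 1) (p : P.Op n) (i : Fin n) (q : P.Op m) (j : Fin m) (r : P.Op l)
    (e₁ : P.out q = P.inp p i) (pq : P.Op k₁) (_hpq : P.comp h₁ p i q e₁ = pq)
    (e₃ : P.out r = P.inp q j) (qr : P.Op k₂) (hqr : P.comp h₃ q j r e₃ = qr)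
    (e₂ : P.out r = P.inp pq (leafR h₁ i j)) (e₄ : P.out qr = P.inp p i)
    (z : P.Op k) (hz : P.comp h₂ pq (leafR h₁ i j) r e₂ = z) (hz' : P.comp h₄ p i qr e₄ = z)
    (t : Fin l) (t₁ : Fin k₂) (ht₁ : t₁ = leafR h₃ j t) (t₂ : Fin k)
    (ht₂ : t₂ = leafR h₂ (leafR h₁ i j) t) (ht₂' : t₂ = leafR h₄ i t₁) (x : obj r t),
    below h₂ pq (leafR h₁ i j) r e₂ z hz t t₂ ht₂ x =
      below h₄ p i qr e₄ z hz' t₁ t₂ ht₂' (below h₃ q j r e₃ qr hqr t t₁ ht₁ x)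
  parallel₁ : ∀ {n m l k₁ k₂ k : ℕ} (h₁ : n + m = k₁ + 1) (h₂ : k₁ + l = k + 1)
    (h₃ : n + l = k₂ + 1) (h₄ : k₂ + m = k + 1) (p : P.Op n) (i a : Fin n) (ha : a ≠ i)
    (q : P.Op m) (r : P.Op l)
    (e₁ : P.out q = P.inp p i) (pq : P.Op k₁) (hpq : P.comp h₁ p i q e₁ = pq)
    (e₃ : P.out r = P.inp p a) (pr : P.Op k₂) (hpr : P.comp h₃ p a r e₃ = pr)
    (e₂ : P.out r = P.inp pq (leafL h₁ i a ha)) (e₄ : P.out q = P.inp pr (leafL h₃ a i ha.symm))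
    (z : P.Op k) (hz : P.comp h₂ pq (leafL h₁ i a ha) r e₂ = z)
    (hz' : P.comp h₄ pr (leafL h₃ a i ha.symm) q e₄ = z)
    (t : Fin n) (ht : t ≠ i) (ht' : t ≠ a) (t₁ : Fin k₁) (ht₁ : t₁ = leafL h₁ i t ht)
    (ht₁' : t₁ ≠ leafL h₁ i a ha) (t₂ : Fin k₂) (ht₂ : t₂ = leafL h₃ a t ht')
    (ht₂' : t₂ ≠ leafL h₃ a i ha.symm) (t₃ : Fin k) (ht₃ : t₃ = leafL h₂ _ t₁ ht₁')
    (ht₃' : t₃ = leafL h₄ _ t₂ ht₂') (x : obj p t),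
    above h₂ pq (leafL h₁ i a ha) r e₂ z hz t₁ ht₁' t₃ ht₃ (above h₁ p i q e₁ pq hpq t ht t₁ ht₁ x)
      = above h₄ pr (leafL h₃ a i ha.symm) q e₄ z hz' t₂ ht₂' t₃ ht₃'
          (above h₃ p a r e₃ pr hpr t ht' t₂ ht₂ x)
  parallel₂ : ∀ {n m l k₁ k₂ k : ℕ} (h₁ : n + m = k₁ + 1) (h₂ : k₁ + l = k + 1)
    (h₃ : n + l = k₂ + 1) (h₄ : k₂ + m = k + 1) (p : P.Op n) (i a : Fin n) (ha : a ≠ i)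
    (q : P.Op m) (r : P.Op l)
    (e₁ : P.out q = P.inp p i) (pq : P.Op k₁) (hpq : P.comp h₁ p i q e₁ = pq)
    (e₃ : P.out r = P.inp p a) (pr : P.Op k₂) (_hpr : P.comp h₃ p a r e₃ = pr)
    (e₂ : P.out r = P.inp pq (leafL h₁ i a ha)) (e₄ : P.out q = P.inp pr (leafL h₃ a i ha.symm))
    (z : P.Op k) (hz : P.comp h₂ pq (leafL h₁ i a ha) r e₂ = z)
    (hz' : P.comp h₄ pr (leafL h₃ a i ha.symm) q e₄ = z)
    (t : Fin m) (t₁ : Fin k₁) (ht₁ : t₁ = leafR h₁ i t) (ht₁' : t₁ ≠ leafL h₁ i a ha)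
    (t₂ : Fin k) (ht₂ : t₂ = leafL h₂ _ t₁ ht₁') (ht₂' : t₂ = leafR h₄ _ t) (x : obj q t),
    above h₂ pq (leafL h₁ i a ha) r e₂ z hz t₁ ht₁' t₂ ht₂ (below h₁ p i q e₁ pq hpq t t₁ ht₁ x)
      = below h₄ pr (leafL h₃ a i ha.symm) q e₄ z hz' t t₂ ht₂' x
  comp_one : ∀ {n : ℕ} (hk : n + 1 = n + 1) (p : P.Op n) (i : Fin n) (c : P.Colour)
    (e : P.out (P.one c) = P.inp p i) (hz : P.comp hk p i (P.one c) e = p)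
    (t : Fin n) (ht : t ≠ i) (ht' : t = leafL hk i t ht) (x : obj p t),
    above hk p i (P.one c) e p hz t ht t ht' x = x
  one_comp : ∀ {n : ℕ} (hk : 1 + n = n + 1) (c : P.Colour) (i : Fin 1) (p : P.Op n)
    (e : P.out p = P.inp (P.one c) i) (hz : P.comp hk (P.one c) i p e = p)
    (t : Fin n) (ht : t = leafR hk i t) (x : obj p t),
    below hk (P.one c) i p e p hz t t ht x = x
  act_one : ∀ {n : ℕ} (p : P.Op n) (hz : P.act p 1 = p) (t : Fin n)
    (ht : t = (1 : s.perms n).1 t) (x : obj p t), perm p 1 p hz t t ht x = x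
  act_mul : ∀ {n : ℕ} (p : P.Op n) (σ τ : s.perms n) (pσ z : P.Op n) (hpσ : P.act p σ = pσ)
    (hz : P.act p (σ * τ) = z) (hz' : P.act pσ τ = z) (t t' t'' : Fin n) (ht : t = σ.1 t')
    (ht' : t' = τ.1 t'') (ht'' : t = (σ * τ).1 t'') (x : obj p t),
    perm p (σ * τ) z hz t t'' ht'' x = perm pσ τ z hz' t' t'' ht' (perm p σ pσ hpσ t t' ht x)
  act_comp₁ : ∀ {n m k : ℕ} (hk : n + m = k + 1) (p : P.Op n) (i : Fin n) (q : P.Op m)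
    (σ : s.perms n) (τ : s.perms m) (pσ : P.Op n) (hpσ : P.act p σ = pσ)
    (qτ : P.Op m) (_hqτ : P.act q τ = qτ)
    (e : P.out qτ = P.inp pσ i) (e' : P.out q = P.inp p (σ.1 i))
    (pq : P.Op k) (hpq : P.comp hk p (σ.1 i) q e' = pq)
    (z : P.Op k) (hz : P.comp hk pσ i qτ e = z) (hz' : P.act pq (s.block hk i σ τ) = z)
    (t t₁ : Fin n) (t₂ t₃ : Fin k) (ht : t ≠ σ.1 i) (ht₁ : t = σ.1 t₁) (ht₁' : t₁ ≠ i)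
    (ht₂ : t₂ = leafL hk (σ.1 i) t ht) (ht₃ : t₃ = leafL hk i t₁ ht₁')
    (ht₃' : t₂ = (s.block hk i σ τ).1 t₃) (x : obj p t),
    above hk pσ i qτ e z hz t₁ ht₁' t₃ ht₃ (perm p σ pσ hpσ t t₁ ht₁ x) =
      perm pq (s.block hk i σ τ) z hz' t₂ t₃ ht₃' (above hk p (σ.1 i) q e' pq hpq t ht t₂ ht₂ x)
  act_comp₂ : ∀ {n m k : ℕ} (hk : n + m = k + 1) (p : P.Op n) (i : Fin n) (q : P.Op m)
    (σ : s.perms n) (τ : s.perms m) (pσ : P.Op n) (_hpσ : P.act p σ = pσ)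
    (qτ : P.Op m) (hqτ : P.act q τ = qτ)
    (e : P.out qτ = P.inp pσ i) (e' : P.out q = P.inp p (σ.1 i))
    (pq : P.Op k) (hpq : P.comp hk p (σ.1 i) q e' = pq)
    (z : P.Op k) (hz : P.comp hk pσ i qτ e = z) (hz' : P.act pq (s.block hk i σ τ) = z)
    (t t₁ : Fin m) (t₂ t₃ : Fin k) (ht₁ : t = τ.1 t₁)
    (ht₂ : t₂ = leafR hk (σ.1 i) t) (ht₃ : t₃ = leafR hk i t₁)
    (ht₃' : t₂ = (s.block hk i σ τ).1 t₃) (x : obj q t),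
    below hk pσ i qτ e z hz t₁ t₃ ht₃ (perm q τ qτ hqτ t t₁ ht₁ x) =
      perm pq (s.block hk i σ τ) z hz' t₂ t₃ ht₃' (below hk p (σ.1 i) q e' pq hpq t t₂ ht₂ x)

variable (P) in
/-- A family of sets indexed by operations, on which the steps `E ↦ E ∘ᵢ q` and `E ↦ E^σ` act
compatibly with the operad axioms. -/
structure UpperModule where
  obj : ∀ {n : ℕ}, P.Op n → Type u
  above : ∀ {n m k : ℕ} (hk : n + m = k + 1) (p : P.Op n) (i : Fin n) (q : P.Op m)
    (e : P.out q = P.inp p i) (z : P.Op k) (_ : P.comp hk p i q e = z), obj p → obj z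
  perm : ∀ {n : ℕ} (p : P.Op n) (σ : s.perms n) (z : P.Op n) (_ : P.act p σ = z), obj p → obj z
  assoc₁ : ∀ {n m l k₁ k₂ k : ℕ} (h₁ : n + m = k₁ + 1) (h₂ : k₁ + l = k + 1) (h₃ : m + l = k₂ + 1)
    (h₄ : n + k₂ = k + 1) (p : P.Op n) (i : Fin n) (q : P.Op m) (j : Fin m) (r : P.Op l)
    (e₁ : P.out q = P.inp p i) (pq : P.Op k₁) (hpq : P.comp h₁ p i q e₁ = pq)
    (e₃ : P.out r = P.inp q j) (qr : P.Op k₂) (_hqr : P.comp h₃ q j r e₃ = qr)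
    (e₂ : P.out r = P.inp pq (leafR h₁ i j)) (e₄ : P.out qr = P.inp p i)
    (z : P.Op k) (hz : P.comp h₂ pq (leafR h₁ i j) r e₂ = z) (hz' : P.comp h₄ p i qr e₄ = z)
    (x : obj p),
    above h₂ pq (leafR h₁ i j) r e₂ z hz (above h₁ p i q e₁ pq hpq x) = above h₄ p i qr e₄ z hz' x
  parallel₁ : ∀ {n m l k₁ k₂ k : ℕ} (h₁ : n + m = k₁ + 1) (h₂ : k₁ + l = k + 1)
    (h₃ : n + l = k₂ + 1) (h₄ : k₂ + m = k + 1) (p : P.Op n) (i a : Fin n) (ha : a ≠ i)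
    (q : P.Op m) (r : P.Op l)
    (e₁ : P.out q = P.inp p i) (pq : P.Op k₁) (hpq : P.comp h₁ p i q e₁ = pq)
    (e₃ : P.out r = P.inp p a) (pr : P.Op k₂) (hpr : P.comp h₃ p a r e₃ = pr)
    (e₂ : P.out r = P.inp pq (leafL h₁ i a ha)) (e₄ : P.out q = P.inp pr (leafL h₃ a i ha.symm))
    (z : P.Op k) (hz : P.comp h₂ pq (leafL h₁ i a ha) r e₂ = z)
    (hz' : P.comp h₄ pr (leafL h₃ a i ha.symm) q e₄ = z) (x : obj p),
    above h₂ pq (leafL h₁ i a ha) r e₂ z hz (above h₁ p i q e₁ pq hpq x) =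
      above h₄ pr (leafL h₃ a i ha.symm) q e₄ z hz' (above h₃ p a r e₃ pr hpr x)
  comp_one : ∀ {n : ℕ} (hk : n + 1 = n + 1) (p : P.Op n) (i : Fin n) (c : P.Colour)
    (e : P.out (P.one c) = P.inp p i) (hz : P.comp hk p i (P.one c) e = p) (x : obj p),
    above hk p i (P.one c) e p hz x = x
  act_one : ∀ {n : ℕ} (p : P.Op n) (hz : P.act p 1 = p) (x : obj p), perm p 1 p hz x = x
  act_mul : ∀ {n : ℕ} (p : P.Op n) (σ τ : s.perms n) (pσ z : P.Op n) (hpσ : P.act p σ = pσ)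
    (hz : P.act p (σ * τ) = z) (hz' : P.act pσ τ = z) (x : obj p),
    perm p (σ * τ) z hz x = perm pσ τ z hz' (perm p σ pσ hpσ x)
  act_comp₁ : ∀ {n m k : ℕ} (hk : n + m = k + 1) (p : P.Op n) (i : Fin n) (q : P.Op m)
    (σ : s.perms n) (τ : s.perms m) (pσ : P.Op n) (hpσ : P.act p σ = pσ)
    (qτ : P.Op m) (_hqτ : P.act q τ = qτ)
    (e : P.out qτ = P.inp pσ i) (e' : P.out q = P.inp p (σ.1 i))
    (pq : P.Op k) (hpq : P.comp hk p (σ.1 i) q e' = pq)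
    (z : P.Op k) (hz : P.comp hk pσ i qτ e = z) (hz' : P.act pq (s.block hk i σ τ) = z)
    (x : obj p),
    above hk pσ i qτ e z hz (perm p σ pσ hpσ x) =
      perm pq (s.block hk i σ τ) z hz' (above hk p (σ.1 i) q e' pq hpq x)

theorem PointedModule.perm_eq_self (X : PointedModule P) {n : ℕ} {p : P.Op n} {σ : s.perms n}
    (hσ : σ = 1) (hz : P.act p σ = p) (t : Fin n) (ht : t = σ.1 t) (x : X.obj p t) :
    X.perm p σ p hz t t ht x = x := by
  subst hσ
  exact X.act_one ..

theorem UpperModule.perm_eq_self (Y : UpperModule P) {n : ℕ} {p : P.Op n} {σ : s.perms n}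
    (hσ : σ = 1) (hz : P.act p σ = p) (x : Y.obj p) : Y.perm p σ p hz x = x := by
  subst hσ
  exact Y.act_one ..

variable (X : PointedModule P) (Y : UpperModule P)

/-- A presentation of `r` as `(A ∘ⱼ b)^σ`, with decorations of `A` and `b`. -/
structure CutData {k : ℕ} (r : P.Op k) : Type u where
  n : ℕ
  m : ℕ
  hk : n + m = k + 1
  A : P.Op n
  j : Fin n
  b : P.Op m
  e : P.out b = P.inp A j
  σ : s.perms k
  h : P.act (P.comp hk A j b e) σ = r
  ξ : X.obj A j
  η : Y.obj b

/-- Two presentations are related if they differ by permutations of the inputs of `A` and `b`. -/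
inductive CutRel {k : ℕ} {r : P.Op k} : CutData X Y r → CutData X Y r → Prop
  | mk {n m : ℕ} (hk : n + m = k + 1) (A : P.Op n) (j : Fin n) (b : P.Op m)
      (e : P.out b = P.inp A j) (σ : s.perms k) (h : P.act (P.comp hk A j b e) σ = r)
      (ξ : X.obj A j) (η : Y.obj b) (τ : s.perms n) (ρ : s.perms m) (A' : P.Op n)
      (hA : P.act A τ = A') (j' : Fin n) (hj : j = τ.1 j') (b' : P.Op m) (hb : P.act b ρ = b')
      (e' : P.out b' = P.inp A' j') (σ' : s.perms k) (hσ : σ = s.block hk j' τ ρ * σ')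
      (h' : P.act (P.comp hk A' j' b' e') σ' = r) (ξ' : X.obj A' j')
      (hξ : ξ' = X.perm A τ A' hA j j' hj ξ) (η' : Y.obj b') (hη : η' = Y.perm b ρ b' hb η) :
      CutRel ⟨n, m, hk, A, j, b, e, σ, h, ξ, η⟩ ⟨n, m, hk, A', j', b', e', σ', h', ξ', η'⟩

/-- The decorated cuts of `r`. -/
def Cut {k : ℕ} (r : P.Op k) : Type u := Quot (CutRel X Y (r := r))

variable {X Y}

/-- The pairs of permutations form groups compatible with `block`, so the relation is already an
equivalence. Equality of cuts therefore yields a single pair of permutations, not a chain of them.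
-/
theorem CutRel.refl {k : ℕ} {r : P.Op k} (d : CutData X Y r) : CutRel X Y d d := by
  obtain ⟨n, m, hk, A, j, b, e, σ, h, ξ, η⟩ := d
  exact .mk hk A j b e σ h ξ η 1 1 A (P.act_one A) j rfl b (P.act_one b) e σ
    (by rw [s.block_one, one_mul]) h ξ (X.act_one ..).symm η (Y.act_one ..).symm

theorem CutRel.symm {k : ℕ} {r : P.Op k} {d d' : CutData X Y r} (h : CutRel X Y d d') :
    CutRel X Y d' d := by
  obtain ⟨hk, A, j, b, e, σ, h, ξ, η, τ, ρ, A', hA, j', hj, b', hb, e', σ', hσ, h', ξ', hξ, η', hη⟩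
    := h
  subst hA hj hb hσ hξ hη
  refine .mk hk _ _ _ _ _ _ _ _ τ⁻¹ ρ⁻¹ A ?_ _ ?_ b ?_ _ _ ?_ _ _ ?_ _ ?_
  · rw [← P.act_mul, mul_inv_cancel, P.act_one]
  · exact (τ.1.symm_apply_apply _).symm
  · rw [← P.act_mul, mul_inv_cancel, P.act_one]
  · rw [← mul_assoc, ← s.block_mul, inv_mul_cancel, inv_mul_cancel, s.block_one, one_mul]
  · rw [← X.act_mul A τ τ⁻¹ _ A rfl (by rw [mul_inv_cancel, P.act_one]) _ _ _ _ rfl _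
      (by rw [mul_inv_cancel]; rfl)]
    exact (X.perm_eq_self (mul_inv_cancel τ) ..).symm
  · rw [← Y.act_mul b ρ ρ⁻¹ _ b rfl (by rw [mul_inv_cancel, P.act_one])]
    exact (Y.perm_eq_self (mul_inv_cancel ρ) ..).symm

theorem CutRel.trans {k : ℕ} {r : P.Op k} {d d' d'' : CutData X Y r} (h : CutRel X Y d d')
    (h' : CutRel X Y d' d'') : CutRel X Y d d'' := by
  obtain ⟨hk, A, j, b, e, σ, h, ξ, η, τ, ρ, A', hA, j', hj, b', hb, e', σ', hσ, h₁, ξ', hξ, η', hη⟩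
    := h
  obtain ⟨_, _, _, _, _, _, _, _, _, τ', ρ', A'', hA', j'', hj', b'', hb', e'', σ'', hσ', h₂, ξ'',
    hξ', η'', hη'⟩ := h'
  have hA'' : P.act A (τ * τ') = A'' := by rw [P.act_mul, hA, hA']
  have hb'' : P.act b (ρ * ρ') = b'' := by rw [P.act_mul, hb, hb']
  have hj'' : j = (τ * τ').1 j'' := by
    rw [hj, hj']
    rfl
  refine .mk hk A j b e σ h ξ η (τ * τ') (ρ * ρ') A'' hA'' j'' hj'' b'' hb'' e'' σ'' ?_ h₂ ξ'' ?_
    η'' ?_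
  · rw [s.block_mul, hσ, hσ', hj', mul_assoc]
  · rw [hξ', hξ]
    exact (X.act_mul ..).symm
  · rw [hη', hη]
    exact (Y.act_mul ..).symm

end Tw

end Operad

namespace Operad

variable {s : OperadKind} {P : Operad.{u} s}

theorem comp_congr {n m k : ℕ} {hk : n + m = k + 1} {p p' : P.Op n} (hp : p = p') {i i' : Fin n}
    (hi : i = i') {q q' : P.Op m} (hq : q = q') {e : P.out q = P.inp p i}
    {e' : P.out q' = P.inp p' i'} : P.comp hk p i q e = P.comp hk p' i' q' e' := by
  subst hp hi hq
  rfl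

theorem comp_act_left {n m k : ℕ} (hk : n + m = k + 1) (p : P.Op n) (i : Fin n) (q : P.Op m)
    (σ : s.perms n) (e : P.out q = P.inp (P.act p σ) i) (e' : P.out q = P.inp p (σ.1 i)) :
    P.comp hk (P.act p σ) i q e = P.act (P.comp hk p (σ.1 i) q e') (s.block hk i σ 1) := by
  rw [← P.act_comp hk p i q σ 1 (by rw [P.act_one, e]) e']
  exact comp_congr rfl rfl (P.act_one q).symm

theorem comp_act_right {n m k : ℕ} (hk : n + m = k + 1) (p : P.Op n) (i : Fin n) (q : P.Op m)
    (τ : s.perms m) (e : P.out (P.act q τ) = P.inp p i) (e' : P.out q = P.inp p i) :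
    P.comp hk p i (P.act q τ) e = P.act (P.comp hk p i q e') (s.block hk i 1 τ) := by
  exact (comp_congr (P.act_one p).symm rfl rfl).trans
    (P.act_comp hk p i q 1 τ (by rw [P.act_one, e]) e')

theorem _root_.OperadKind.block_mul_left (s : OperadKind) {n m k : ℕ} (hk : n + m = k + 1)
    (i : Fin n) (σ τ : s.perms n) {i' : Fin n} (hi : τ.1 i = i') :
    s.block hk i (σ * τ) (1 : s.perms m) = s.block hk i' σ 1 * s.block hk i τ 1 := by
  subst hi
  rw [← s.block_mul, one_mul]

theorem _root_.OperadKind.block_mul_right (s : OperadKind) {n m k : ℕ} (hk : n + m = k + 1)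
    (i : Fin n) (σ τ : s.perms m) :
    s.block hk i (1 : s.perms n) (σ * τ) = s.block hk i 1 σ * s.block hk i 1 τ := by
  have h := s.block_mul hk i 1 1 σ τ
  rwa [one_mul] at h

namespace Tw

variable {X : PointedModule P} {Y : UpperModule P}

/-! ## The action of steps on decorated cuts -/

section Values

variable {n m k : ℕ} {hk : n + m = k + 1} {A : P.Op n} {j : Fin n} {b : P.Op m}
  {e : P.out b = P.inp A j} {σ : s.perms k} {p : P.Op k}

theorem inp_cut_left (h : P.act (P.comp hk A j b e) σ = p)
    {i : Fin k} {a : Fin n} {ha : a ≠ j} (hi : σ.1 i = leafL hk j a ha) :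
    P.inp p i = P.inp A a := by
  rw [← h, P.inp_act, hi, P.inp_comp_left]

theorem inp_cut_right (h : P.act (P.comp hk A j b e) σ = p)
    {i : Fin k} {l : Fin m} (hi : σ.1 i = leafR hk j l) :
    P.inp p i = P.inp b l := by
  rw [← h, P.inp_act, hi, P.inp_comp_right]

theorem out_cut (h : P.act (P.comp hk A j b e) σ = p) : P.out p = P.out A := by
  rw [← h, P.out_act, P.out_comp]

variable {mq k' n₁ : ℕ} {hk' : k + mq = k' + 1} {i : Fin k} {q : P.Op mq} {e' : P.out q = P.inp p i}
  {z : P.Op k'}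

/-- Equivariance moves the graft from the input `i` of `(A ∘ⱼ b)^σ` to the leaf `σ i` of `A ∘ⱼ b`.
If that leaf comes from `A`, the parallel axiom exchanges the grafts of `q` and `b`; if it comes
from `b`, sequential associativity is used instead. -/
theorem cut_above_left (h : P.act (P.comp hk A j b e) σ = p)
    (hz : P.comp hk' p i q e' = z) {a : Fin n} {ha : a ≠ j} (hi : σ.1 i = leafL hk j a ha)
    (hn : n + mq = n₁ + 1) {A₁ : P.Op n₁} {ea : P.out q = P.inp A a}
    (hA : P.comp hn A a q ea = A₁) (hk₁ : n₁ + m = k' + 1)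
    (e₁ : P.out b = P.inp A₁ (leafL hn a j ha.symm)) :
    P.act (P.comp hk₁ A₁ (leafL hn a j ha.symm) b e₁) (s.block hk' i σ 1) = z := by
  subst h hz hA
  have h1 : P.out q = P.inp (P.comp hk A j b e) (σ.1 i) := by rw [e', P.inp_act]
  rw [comp_act_left hk' _ i q σ e' h1]
  congr 1
  refine (P.parallel hk hk' hn hk₁ A j a ha b q e ?_ ea e₁).symm.trans ?_
  · rw [← hi, h1]
  · exact comp_congr rfl hi.symm rfl

theorem cut_above_right (h : P.act (P.comp hk A j b e) σ = p)
    (hz : P.comp hk' p i q e' = z) {l : Fin m} (hi : σ.1 i = leafR hk j l) {m₁ : ℕ}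
    (hm : m + mq = m₁ + 1) {b₁ : P.Op m₁} {el : P.out q = P.inp b l}
    (hb : P.comp hm b l q el = b₁) (hk₁ : n + m₁ = k' + 1) (e₁ : P.out b₁ = P.inp A j) :
    P.act (P.comp hk₁ A j b₁ e₁) (s.block hk' i σ 1) = z := by
  subst h hz hb
  have h1 : P.out q = P.inp (P.comp hk A j b e) (σ.1 i) := by rw [e', P.inp_act]
  rw [comp_act_left hk' _ i q σ e' h1]
  congr 1
  refine (P.assoc hk hk' hm hk₁ A j b l q e ?_ el e₁).symm.trans ?_
  · rw [← hi, h1]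
  · exact comp_congr rfl hi.symm rfl

end Values

section Values

variable {n m k : ℕ} {hk : n + m = k + 1} {A : P.Op n} {j : Fin n} {b : P.Op m}
  {e : P.out b = P.inp A j} {σ : s.perms k} {p : P.Op k}

theorem cut_below (h : P.act (P.comp hk A j b e) σ = p)
    {nq k' n₁ : ℕ} {hk' : nq + k = k' + 1} {q : P.Op nq} {i : Fin nq}
    {e' : P.out p = P.inp q i} {z : P.Op k'} (hz : P.comp hk' q i p e' = z)
    (hn : nq + n = n₁ + 1) {A₁ : P.Op n₁} {ea : P.out A = P.inp q i}
    (hA : P.comp hn q i A ea = A₁) (hk₁ : n₁ + m = k' + 1)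
    (e₁ : P.out b = P.inp A₁ (leafR hn i j)) :
    P.act (P.comp hk₁ A₁ (leafR hn i j) b e₁) (s.block hk' i 1 σ) = z := by
  subst h hz hA
  have h1 : P.out (P.comp hk A j b e) = P.inp q i := by rw [P.out_comp, ea]
  rw [comp_act_right hk' q i _ σ e' h1]
  congr 1
  exact P.assoc hn hk₁ hk hk' q i A j b ea e₁ e h1

theorem cut_perm (h : P.act (P.comp hk A j b e) σ = p)
    {τ : s.perms k} {z : P.Op k} (hz : P.act p τ = z) :
    P.act (P.comp hk A j b e) (σ * τ) = z := by
  rw [P.act_mul, h, hz]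

end Values

/-- The decorated cut given by a presentation. -/
def Cut.mk {n m k : ℕ} {r : P.Op k} (hk : n + m = k + 1) (A : P.Op n) (j : Fin n) (b : P.Op m)
    (e : P.out b = P.inp A j) (σ : s.perms k) (h : P.act (P.comp hk A j b e) σ = r)
    (ξ : X.obj A j) (η : Y.obj b) : Cut X Y r :=
  Quot.mk _ ⟨n, m, hk, A, j, b, e, σ, h, ξ, η⟩

theorem Cut.ind {k : ℕ} {r : P.Op k} {C : Cut X Y r → Prop}
    (h : ∀ {n m : ℕ} (hk : n + m = k + 1) (A : P.Op n) (j : Fin n) (b : P.Op m)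
      (e : P.out b = P.inp A j) (σ : s.perms k) (h : P.act (P.comp hk A j b e) σ = r)
      (ξ : X.obj A j) (η : Y.obj b), C (Cut.mk hk A j b e σ h ξ η)) (d : Cut X Y r) : C d :=
  Quot.ind (fun d => h d.hk d.A d.j d.b d.e d.σ d.h d.ξ d.η) d

theorem Cut.sound {n m k : ℕ} {r : P.Op k} {hk : n + m = k + 1} {A : P.Op n} {j : Fin n}
    {b : P.Op m} {e : P.out b = P.inp A j} {σ : s.perms k} {h : P.act (P.comp hk A j b e) σ = r}
    {ξ : X.obj A j} {η : Y.obj b} (τ : s.perms n) (ρ : s.perms m) {A' : P.Op n}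
    (hA : P.act A τ = A') {j' : Fin n} (hj : j = τ.1 j') {b' : P.Op m} (hb : P.act b ρ = b')
    {e' : P.out b' = P.inp A' j'} {σ' : s.perms k} (hσ : σ = s.block hk j' τ ρ * σ')
    {h' : P.act (P.comp hk A' j' b' e') σ' = r} {ξ' : X.obj A' j'}
    (hξ : ξ' = X.perm A τ A' hA j j' hj ξ) {η' : Y.obj b'} (hη : η' = Y.perm b ρ b' hb η) :
    Cut.mk hk A j b e σ h ξ η = Cut.mk hk A' j' b' e' σ' h' ξ' η' :=
  Quot.sound (.mk hk A j b e σ h ξ η τ ρ A' hA j' hj b' hb e' σ' hσ h' ξ' hξ η' hη)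

theorem Cut.mk_congr {n m k : ℕ} {r : P.Op k} {hk : n + m = k + 1} {A : P.Op n} {j : Fin n}
    {b : P.Op m} {e : P.out b = P.inp A j} {σ σ' : s.perms k}
    {h : P.act (P.comp hk A j b e) σ = r} {h' : P.act (P.comp hk A j b e) σ' = r}
    {ξ ξ' : X.obj A j} {η η' : Y.obj b} (hσ : σ = σ') (hξ : ξ = ξ') (hη : η = η') :
    Cut.mk hk A j b e σ h ξ η = Cut.mk hk A j b e σ' h' ξ' η' := by
  subst hσ hξ hη
  rfl

section Above

variable {k m k' : ℕ} (hk' : k + m = k' + 1) (p : P.Op k) (i : Fin k) (q : P.Op m)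
  (eq : P.out q = P.inp p i) (z : P.Op k') (hz : P.comp hk' p i q eq = z)

/-- Grafting `q` onto an input of `A`. -/
noncomputable def CutData.aboveLeft (d : CutData X Y p) (a : Fin d.n) (ha : a ≠ d.j)
    (hi : d.σ.1 i = leafL d.hk d.j a ha) : Cut X Y z :=
  have hn : d.n + m = (d.n + m - 1) + 1 := by
    have := a.isLt
    omega
  have hk₁ : (d.n + m - 1) + d.m = k' + 1 := by
    have := d.hk
    omega
  have ea : P.out q = P.inp d.A a := eq.trans (inp_cut_left d.h hi)
  have e₁ : P.out d.b = P.inp (P.comp hn d.A a q ea) (leafL hn a d.j ha.symm) := by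
    rw [P.inp_comp_left, d.e]
  .mk hk₁ (P.comp hn d.A a q ea) (leafL hn a d.j ha.symm) d.b e₁ (s.block hk' i d.σ 1)
    (cut_above_left d.h hz hi hn rfl hk₁ e₁) (X.above hn d.A a q ea _ rfl d.j ha.symm _ rfl d.ξ) d.η

/-- Grafting `q` onto an input of `b`. -/
noncomputable def CutData.aboveRight (d : CutData X Y p) (l : Fin d.m) (hi : d.σ.1 i = leafR d.hk d.j l) :
    Cut X Y z :=
  have hm : d.m + m = (d.m + m - 1) + 1 := by
    have := l.isLt
    omega
  have hk₁ : d.n + (d.m + m - 1) = k' + 1 := by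
    have := d.hk
    omega
  have el : P.out q = P.inp d.b l := eq.trans (inp_cut_right d.h hi)
  have e₁ : P.out (P.comp hm d.b l q el) = P.inp d.A d.j := by rw [P.out_comp, d.e]
  .mk hk₁ d.A d.j (P.comp hm d.b l q el) e₁ (s.block hk' i d.σ 1)
    (cut_above_right d.h hz hi hm rfl hk₁ e₁) d.ξ (Y.above hm d.b l q el _ rfl d.η)

open Classical in
/-- Grafting `q` onto the input `i` of a cut operation. -/
noncomputable def CutData.above (d : CutData X Y p) : Cut X Y z :=
  if h : ∃ (a : Fin d.n) (ha : a ≠ d.j), d.σ.1 i = leafL d.hk d.j a ha then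
    d.aboveLeft hk' p i q eq z hz h.choose h.choose_spec.choose h.choose_spec.choose_spec
  else
    have h' := (leaf_cases d.hk d.j (d.σ.1 i)).resolve_left h
    d.aboveRight hk' p i q eq z hz h'.choose h'.choose_spec

/-- The choices in `CutData.above` are immaterial: a leaf of `A ∘ⱼ b` comes from exactly one input
of exactly one of the two parts. Arities, composites and positions are left free so that any
presentation of the result can be used. -/
theorem CutData.above_left {n m₀ : ℕ} {hk : n + m₀ = k + 1} {A : P.Op n} {j : Fin n} {b : P.Op m₀}
    {e : P.out b = P.inp A j} {σ : s.perms k} {h : P.act (P.comp hk A j b e) σ = p}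
    {ξ : X.obj A j} {η : Y.obj b} {a : Fin n} (ha : a ≠ j) (hi : σ.1 i = leafL hk j a ha)
    {n₁ : ℕ} (hn : n + m = n₁ + 1) (ea : P.out q = P.inp A a) {A₁ : P.Op n₁}
    (hA : P.comp hn A a q ea = A₁) (hk₁ : n₁ + m₀ = k' + 1) (j₁ : Fin n₁)
    (hj₁ : j₁ = leafL hn a j ha.symm)
    (e₁ : P.out b = P.inp A₁ j₁) (σ₁ : s.perms k') (hσ₁ : σ₁ = s.block hk' i σ 1)
    (h₁ : P.act (P.comp hk₁ A₁ j₁ b e₁) σ₁ = z) :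
    CutData.above hk' p i q eq z hz ⟨n, m₀, hk, A, j, b, e, σ, h, ξ, η⟩ =
      .mk hk₁ A₁ j₁ b e₁ σ₁ h₁ (X.above hn A a q ea A₁ hA j ha.symm j₁ hj₁ ξ) η := by
  have H : ∃ (a : Fin n) (ha : a ≠ j), σ.1 i = leafL hk j a ha := ⟨a, ha, hi⟩
  have h1 : CutData.above hk' p i q eq z hz ⟨n, m₀, hk, A, j, b, e, σ, h, ξ, η⟩ =
    CutData.aboveLeft hk' p i q eq z hz ⟨n, m₀, hk, A, j, b, e, σ, h, ξ, η⟩ H.choose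
      H.choose_spec.choose H.choose_spec.choose_spec := dif_pos H
  refine h1.trans ?_
  obtain rfl : H.choose = a := leafL_injective hk j (H.choose_spec.choose_spec.symm.trans hi)
  obtain rfl : n₁ = n + m - 1 := by omega
  subst hA hj₁ hσ₁
  rfl

theorem CutData.above_right {n m₀ : ℕ} {hk : n + m₀ = k + 1} {A : P.Op n} {j : Fin n} {b : P.Op m₀}
    {e : P.out b = P.inp A j} {σ : s.perms k} {h : P.act (P.comp hk A j b e) σ = p}
    {ξ : X.obj A j} {η : Y.obj b} {l : Fin m₀} (hi : σ.1 i = leafR hk j l)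
    {m₁ : ℕ} (hm : m₀ + m = m₁ + 1) (el : P.out q = P.inp b l) {b₁ : P.Op m₁}
    (hb : P.comp hm b l q el = b₁) (hk₁ : n + m₁ = k' + 1)
    (e₁ : P.out b₁ = P.inp A j) (σ₁ : s.perms k') (hσ₁ : σ₁ = s.block hk' i σ 1)
    (h₁ : P.act (P.comp hk₁ A j b₁ e₁) σ₁ = z) :
    CutData.above hk' p i q eq z hz ⟨n, m₀, hk, A, j, b, e, σ, h, ξ, η⟩ =
      .mk hk₁ A j b₁ e₁ σ₁ h₁ ξ (Y.above hm b l q el b₁ hb η) := by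
  have H : ¬ ∃ (a : Fin n) (ha : a ≠ j), σ.1 i = leafL hk j a ha := by
    rintro ⟨a, ha, h'⟩
    exact leafL_ne_leafR hk j ha l (h'.symm.trans hi)
  have H' := (leaf_cases hk j (σ.1 i)).resolve_left H
  have h1 : CutData.above hk' p i q eq z hz ⟨n, m₀, hk, A, j, b, e, σ, h, ξ, η⟩ =
    CutData.aboveRight hk' p i q eq z hz ⟨n, m₀, hk, A, j, b, e, σ, h, ξ, η⟩ H'.choose
      H'.choose_spec := dif_neg H
  refine h1.trans ?_
  obtain rfl : H'.choose = l := leafR_injective hk j (H'.choose_spec.symm.trans hi)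
  obtain rfl : m₁ = m₀ + m - 1 := by omega
  subst hb hσ₁
  rfl

/-- If the presentations differ by `(τ, ρ)`, the grafted ones differ by `(τ ∘ₐ 1, ρ)` or by `(τ, ρ
∘ₗ 1)`, according to the part that receives `q`. The permutations outside match by `block_parallel`
and `block_assoc` respectively. -/
theorem CutData.above_rel {d d' : CutData X Y p} (hd : CutRel X Y d d') :
    d.above hk' p i q eq z hz = d'.above hk' p i q eq z hz := by
  obtain @⟨n, m₀, hk, A, j, b, e, σ, h, ξ, η, τ, ρ, A', hA, j', hj, b', hb, e', σ', hσ, h', ξ', hξ,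
    η', hη⟩ := hd
  subst hA hj hb hσ hξ hη
  rcases leaf_cases hk j' (σ'.1 i) with ⟨a, ha, hi⟩ | ⟨l, hi⟩
  · have hi' : (s.block hk j' τ ρ * σ').1 i = leafL hk (τ.1 j') (τ.1 a) (τ.1.injective.ne ha) := by
      rw [s.perm_mul_apply, hi, s.block_leafL]
    have hn : n + m = (n + m - 1) + 1 := by
      have := a.isLt
      omega
    have hk₁ : (n + m - 1) + m₀ = k' + 1 := by omega
    have ea' : P.out q = P.inp (P.act A τ) a := eq.trans (inp_cut_left h' hi)
    have ea : P.out q = P.inp A (τ.1 a) := by rw [ea', P.inp_act]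
    refine (CutData.above_left hk' p i q eq z hz (τ.1.injective.ne ha) hi' hn ea rfl hk₁ _ rfl
      (by rw [P.inp_comp_left, e]) _ rfl (cut_above_left h hz hi' hn rfl hk₁ _)).trans
      (Eq.trans ?_ (CutData.above_left hk' p i q eq z hz ha hi hn ea' rfl hk₁ _ rfl
      (by rw [P.inp_comp_left, e']) _ rfl (cut_above_left h' hz hi hn rfl hk₁ _)).symm)
    refine Cut.sound (s.block hn a τ 1) ρ ?_ ?_ rfl ?_ ?_ rfl
    · exact (comp_act_left ..).symm
    · exact (s.block_leafL ..).symm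
    · rw [s.block_mul_left hk' i _ _ hi, s.block_parallel hk hk' hn hk₁]
    · exact X.act_comp₁ hn A a q τ 1 _ rfl q (P.act_one q) ..
  · have hi' : (s.block hk j' τ ρ * σ').1 i = leafR hk (τ.1 j') (ρ.1 l) := by
      rw [s.perm_mul_apply, hi, s.block_leafR]
    have hm : m₀ + m = (m₀ + m - 1) + 1 := by
      have := l.isLt
      omega
    have hk₁ : n + (m₀ + m - 1) = k' + 1 := by omega
    have el' : P.out q = P.inp (P.act b ρ) l := eq.trans (inp_cut_right h' hi)
    have el : P.out q = P.inp b (ρ.1 l) := by rw [el', P.inp_act]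
    refine (CutData.above_right hk' p i q eq z hz hi' hm el rfl hk₁
      (by rw [P.out_comp, e]) _ rfl (cut_above_right h hz hi' hm rfl hk₁ _)).trans
      (Eq.trans ?_ (CutData.above_right hk' p i q eq z hz hi hm el' rfl hk₁
      (by rw [P.out_comp, e']) _ rfl (cut_above_right h' hz hi hm rfl hk₁ _)).symm)
    refine Cut.sound τ (s.block hm l ρ 1) rfl rfl ?_ ?_ rfl ?_
    · exact (comp_act_left ..).symm
    · rw [s.block_mul_left hk' i _ _ hi, s.block_assoc hk hk' hm hk₁]
    · exact Y.act_comp₁ hm b l q ρ 1 _ rfl q (P.act_one q) ..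

/-- The action of the step `E ↦ E ∘ᵢ q` on decorated cuts. -/
noncomputable def Cut.above : Cut X Y p → Cut X Y z :=
  Quot.lift (CutData.above hk' p i q eq z hz) (fun _ _ hd => CutData.above_rel hk' p i q eq z hz hd)

theorem Cut.above_left {n m₀ : ℕ} {hk : n + m₀ = k + 1} {A : P.Op n} {j : Fin n} {b : P.Op m₀}
    {e : P.out b = P.inp A j} {σ : s.perms k} {h : P.act (P.comp hk A j b e) σ = p}
    {ξ : X.obj A j} {η : Y.obj b} {a : Fin n} (ha : a ≠ j) (hi : σ.1 i = leafL hk j a ha)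
    {n₁ : ℕ} (hn : n + m = n₁ + 1) {A₁ : P.Op n₁}
    (hA : P.comp hn A a q (eq.trans (inp_cut_left h hi)) = A₁) {j₁ : Fin n₁}
    (hj₁ : j₁ = leafL hn a j ha.symm) {σ₁ : s.perms k'} (hσ₁ : σ₁ = s.block hk' i σ 1) :
    Cut.above hk' p i q eq z hz (.mk hk A j b e σ h ξ η) =
      .mk (by omega) A₁ j₁ b (by rw [← hA, hj₁, P.inp_comp_left, e]) σ₁
        (by subst hj₁ hσ₁; exact cut_above_left h hz hi hn hA _ _)
        (X.above hn A a q (eq.trans (inp_cut_left h hi)) A₁ hA j ha.symm j₁ hj₁ ξ) η :=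
  CutData.above_left hk' p i q eq z hz ha hi hn _ hA _ _ hj₁ _ _ hσ₁ _

theorem Cut.above_right {n m₀ : ℕ} {hk : n + m₀ = k + 1} {A : P.Op n} {j : Fin n} {b : P.Op m₀}
    {e : P.out b = P.inp A j} {σ : s.perms k} {h : P.act (P.comp hk A j b e) σ = p}
    {ξ : X.obj A j} {η : Y.obj b} {l : Fin m₀} (hi : σ.1 i = leafR hk j l)
    {m₁ : ℕ} (hm : m₀ + m = m₁ + 1) {b₁ : P.Op m₁}
    (hb : P.comp hm b l q (eq.trans (inp_cut_right h hi)) = b₁)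
    {σ₁ : s.perms k'} (hσ₁ : σ₁ = s.block hk' i σ 1) :
    Cut.above hk' p i q eq z hz (.mk hk A j b e σ h ξ η) =
      .mk (by omega) A j b₁ (by rw [← hb, P.out_comp, e]) σ₁
        (by subst hσ₁; exact cut_above_right h hz hi hm hb _ _) ξ
        (Y.above hm b l q (eq.trans (inp_cut_right h hi)) b₁ hb η) :=
  CutData.above_right hk' p i q eq z hz hi hm _ hb _ _ _ hσ₁ _

end Above

section Below

variable {m k k' : ℕ} (hk' : m + k = k' + 1) (q : P.Op m) (i : Fin m) (p : P.Op k)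
  (eq : P.out p = P.inp q i) (z : P.Op k') (hz : P.comp hk' q i p eq = z)

/-- The action of the step `E ↦ q ∘ᵢ E` on presentations. -/
noncomputable def CutData.below (d : CutData X Y p) : Cut X Y z :=
  have hn : m + d.n = (m + d.n - 1) + 1 := by
    have := i.isLt
    omega
  have hk₁ : (m + d.n - 1) + d.m = k' + 1 := by
    have := d.hk
    omega
  have ea : P.out d.A = P.inp q i := (out_cut d.h).symm.trans eq
  have e₁ : P.out d.b = P.inp (P.comp hn q i d.A ea) (leafR hn i d.j) := by
    rw [P.inp_comp_right, d.e]
  .mk hk₁ (P.comp hn q i d.A ea) (leafR hn i d.j) d.b e₁ (s.block hk' i 1 d.σ)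
    (cut_below d.h hz hn rfl hk₁ e₁) (X.below hn q i d.A ea _ rfl d.j _ rfl d.ξ) d.η

theorem CutData.below_eq {n m₀ : ℕ} {hk : n + m₀ = k + 1} {A : P.Op n} {j : Fin n} {b : P.Op m₀}
    {e : P.out b = P.inp A j} {σ : s.perms k} {h : P.act (P.comp hk A j b e) σ = p}
    {ξ : X.obj A j} {η : Y.obj b}
    {n₁ : ℕ} (hn : m + n = n₁ + 1) (ea : P.out A = P.inp q i) {A₁ : P.Op n₁}
    (hA : P.comp hn q i A ea = A₁) (hk₁ : n₁ + m₀ = k' + 1)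
    (e₁ : P.out b = P.inp A₁ (leafR hn i j)) :
    CutData.below hk' q i p eq z hz ⟨n, m₀, hk, A, j, b, e, σ, h, ξ, η⟩ =
      .mk hk₁ A₁ (leafR hn i j) b e₁ (s.block hk' i 1 σ)
        (cut_below h hz hn hA hk₁ e₁) (X.below hn q i A ea A₁ hA j _ rfl ξ) η := by
  obtain rfl : n₁ = m + n - 1 := by omega
  subst hA
  rfl

/-- The operation `q` is always absorbed by the lower part, so the pair `(τ, ρ)` becomes `(1 ∘ᵢ τ,
ρ)`. -/
theorem CutData.below_rel {d d' : CutData X Y p} (hd : CutRel X Y d d') :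
    d.below hk' q i p eq z hz = d'.below hk' q i p eq z hz := by
  obtain @⟨n, m₀, hk, A, j, b, e, σ, h, ξ, η, τ, ρ, A', hA, j', hj, b', hb, e', σ', hσ, h', ξ', hξ,
    η', hη⟩ := hd
  subst hA hj hb hσ hξ hη
  have hn : m + n = (m + n - 1) + 1 := by
    have := i.isLt
    omega
  have hk₁ : (m + n - 1) + m₀ = k' + 1 := by omega
  have ea : P.out A = P.inp q i := (out_cut h).symm.trans eq
  have ea' : P.out (P.act A τ) = P.inp q i := (out_cut h').symm.trans eq
  refine (CutData.below_eq hk' q i p eq z hz hn ea rfl hk₁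
      (by rw [P.inp_comp_right, e])).trans
      (Eq.trans ?_ (CutData.below_eq hk' q i p eq z hz hn ea' rfl hk₁
      (by rw [P.inp_comp_right, e'])).symm)
  refine Cut.sound (s.block hn i 1 τ) ρ ?_ ?_ rfl ?_ ?_ rfl
  · exact (comp_act_right ..).symm
  · exact (s.block_leafR_eq hn (i' := i) rfl rfl).symm
  · rw [s.block_assoc hn hk₁ hk hk', ← s.block_mul_right]
  · exact X.act_comp₂ hn q i A 1 τ q (P.act_one q) ..

/-- The action of the step `E ↦ q ∘ᵢ E` on decorated cuts. -/
noncomputable def Cut.below : Cut X Y p → Cut X Y z :=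
  Quot.lift (CutData.below hk' q i p eq z hz) (fun _ _ hd => CutData.below_rel hk' q i p eq z hz hd)

theorem Cut.below_mk {n m₀ : ℕ} {hk : n + m₀ = k + 1} {A : P.Op n} {j : Fin n} {b : P.Op m₀}
    {e : P.out b = P.inp A j} {σ : s.perms k} {h : P.act (P.comp hk A j b e) σ = p}
    {ξ : X.obj A j} {η : Y.obj b} {n₁ : ℕ} (hn : m + n = n₁ + 1) {A₁ : P.Op n₁}
    (hA : P.comp hn q i A ((out_cut h).symm.trans eq) = A₁) {j₁ : Fin n₁}
    (hj₁ : j₁ = leafR hn i j) {σ₁ : s.perms k'} (hσ₁ : σ₁ = s.block hk' i 1 σ) :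
    Cut.below hk' q i p eq z hz (.mk hk A j b e σ h ξ η) =
      .mk (by omega) A₁ j₁ b (by rw [← hA, hj₁, P.inp_comp_right, e]) σ₁
        (by subst hj₁ hσ₁; exact cut_below h hz hn hA _ _)
        (X.below hn q i A ((out_cut h).symm.trans eq) A₁ hA j j₁ hj₁ ξ) η := by
  subst hj₁ hσ₁
  exact CutData.below_eq hk' q i p eq z hz hn _ hA _ _

end Below

section Perm

variable {k : ℕ} (p : P.Op k) (τ : s.perms k) (z : P.Op k) (hz : P.act p τ = z)

/-- The action of the step `E ↦ E^τ` on decorated cuts. -/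
def Cut.perm : Cut X Y p → Cut X Y z :=
  Quot.map (fun d => ⟨d.n, d.m, d.hk, d.A, d.j, d.b, d.e, d.σ * τ, cut_perm d.h hz, d.ξ, d.η⟩) (by
    rintro _ _ ⟨hk, A, j, b, e, σ, h, ξ, η, τ', ρ, A', hA, j', hj, b', hb, e', σ', hσ, h', ξ', hξ,
      η', hη⟩
    exact .mk hk A j b e _ _ ξ η τ' ρ A' hA j' hj b' hb e' _
      ((congrArg (· * τ) hσ).trans (mul_assoc _ _ _)) _ ξ' hξ η' hη)

theorem Cut.perm_mk {n m₀ : ℕ} {hk : n + m₀ = k + 1} {A : P.Op n} {j : Fin n} {b : P.Op m₀}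
    {e : P.out b = P.inp A j} {σ : s.perms k} {h : P.act (P.comp hk A j b e) σ = p}
    {ξ : X.obj A j} {η : Y.obj b} :
    Cut.perm p τ z hz (.mk hk A j b e σ h ξ η) = .mk hk A j b e (σ * τ) (cut_perm h hz) ξ η :=
  rfl

end Perm

end Tw

end Operad

namespace Operad

variable {s : OperadKind} {P : Operad.{u} s}

namespace Tw

variable {X : PointedModule P} {Y : UpperModule P}

/-! ## The operad axioms for the action of steps on decorated cuts -/

theorem exists_arity {n : ℕ} (a : Fin n) (m : ℕ) : ∃ k, n + m = k + 1 :=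
  ⟨n + m - 1, by
    have := a.isLt
    omega⟩

theorem PointedModule.above_act (X : PointedModule P) {n m k : ℕ} (hk : n + m = k + 1) (p : P.Op n)
    (i : Fin n) (q : P.Op m) (τ : s.perms m) (qτ : P.Op m) (hqτ : P.act q τ = qτ)
    (e : P.out qτ = P.inp p i) (e' : P.out q = P.inp p i)
    (pq : P.Op k) (hpq : P.comp hk p i q e' = pq)
    (z : P.Op k) (hz : P.comp hk p i qτ e = z) (hz' : P.act pq (s.block hk i 1 τ) = z)
    (t : Fin n) (ht : t ≠ i) (t₂ : Fin k) (ht₂ : t₂ = leafL hk i t ht)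
    (ht₂' : t₂ = (s.block hk i 1 τ).1 t₂) (x : X.obj p t) :
    X.above hk p i qτ e z hz t ht t₂ ht₂ x =
      X.perm pq (s.block hk i 1 τ) z hz' t₂ t₂ ht₂' (X.above hk p i q e' pq hpq t ht t₂ ht₂ x) := by
  have h := X.act_comp₁ hk p i q 1 τ p (P.act_one p) qτ hqτ e e' pq hpq z hz hz' t t t₂ t₂ ht rfl
    ht ht₂ ht₂ ht₂' x
  exact (congrArg (X.above hk p i qτ e z hz t ht t₂ ht₂) (X.act_one p _ t _ x).symm).trans h

theorem PointedModule.below_act (X : PointedModule P) {n m k : ℕ} (hk : n + m = k + 1) (p : P.Op n)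
    (i : Fin n) (q : P.Op m) (σ : s.perms n) (pσ : P.Op n) (hpσ : P.act p σ = pσ)
    (e : P.out q = P.inp pσ i) (e' : P.out q = P.inp p (σ.1 i))
    (pq : P.Op k) (hpq : P.comp hk p (σ.1 i) q e' = pq)
    (z : P.Op k) (hz : P.comp hk pσ i q e = z) (hz' : P.act pq (s.block hk i σ 1) = z)
    (t : Fin m) (t₂ t₃ : Fin k) (ht₂ : t₂ = leafR hk (σ.1 i) t) (ht₃ : t₃ = leafR hk i t)
    (ht₃' : t₂ = (s.block hk i σ 1).1 t₃) (x : X.obj q t) :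
    X.below hk pσ i q e z hz t t₃ ht₃ x =
      X.perm pq (s.block hk i σ 1) z hz' t₂ t₃ ht₃'
        (X.below hk p (σ.1 i) q e' pq hpq t t₂ ht₂ x) := by
  have h := X.act_comp₂ hk p i q σ 1 pσ hpσ q (P.act_one q) e e' pq hpq z hz hz' t t t₂ t₃ rfl ht₂
    ht₃ ht₃' x
  exact (congrArg (X.below hk pσ i q e z hz t t₃ ht₃) (X.act_one q _ t _ x).symm).trans h

theorem UpperModule.above_act (Y : UpperModule P) {n m k : ℕ} (hk : n + m = k + 1) (p : P.Op n)
    (i : Fin n) (q : P.Op m) (τ : s.perms m) (qτ : P.Op m) (hqτ : P.act q τ = qτ)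
    (e : P.out qτ = P.inp p i) (e' : P.out q = P.inp p i)
    (pq : P.Op k) (hpq : P.comp hk p i q e' = pq)
    (z : P.Op k) (hz : P.comp hk p i qτ e = z) (hz' : P.act pq (s.block hk i 1 τ) = z)
    (x : Y.obj p) :
    Y.above hk p i qτ e z hz x =
      Y.perm pq (s.block hk i 1 τ) z hz' (Y.above hk p i q e' pq hpq x) := by
  have h := Y.act_comp₁ hk p i q 1 τ p (P.act_one p) qτ hqτ e e' pq hpq z hz hz' x
  rwa [Y.act_one] at h

section Axioms

variable {n m l k₁ k₂ k : ℕ}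

/-- Both grafts fall on the same part of the cut, namely the one carrying the leaf `σ i`. So the
axiom reduces to the same axiom for the decoration of that part, and the outer permutations agree by
`block_assoc`. -/
theorem Cut.assoc₁ (h₁ : n + m = k₁ + 1) (h₂ : k₁ + l = k + 1) (h₃ : m + l = k₂ + 1)
    (h₄ : n + k₂ = k + 1) (p : P.Op n) (i : Fin n) (q : P.Op m) (j : Fin m) (r : P.Op l)
    (e₁ : P.out q = P.inp p i) (pq : P.Op k₁) (hpq : P.comp h₁ p i q e₁ = pq)
    (e₃ : P.out r = P.inp q j) (qr : P.Op k₂) (hqr : P.comp h₃ q j r e₃ = qr)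
    (e₂ : P.out r = P.inp pq (leafR h₁ i j)) (e₄ : P.out qr = P.inp p i)
    (z : P.Op k) (hz : P.comp h₂ pq (leafR h₁ i j) r e₂ = z) (hz' : P.comp h₄ p i qr e₄ = z)
    (x : Cut X Y p) :
    Cut.above h₂ pq (leafR h₁ i j) r e₂ z hz (Cut.above h₁ p i q e₁ pq hpq x) =
      Cut.above h₄ p i qr e₄ z hz' x := by
  induction x using Cut.ind with
  | @h N M hk A J b e σ h ξ η =>
  have hσ : s.block h₂ (leafR h₁ i j) (s.block h₁ i σ (1 : s.perms m)) (1 : s.perms l) =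
      s.block h₄ i σ 1 := (s.block_assoc h₁ h₂ h₃ h₄ ..).trans (by rw [s.block_one])
  rcases leaf_cases hk J (σ.1 i) with ⟨a, ha, hi⟩ | ⟨t, hi⟩
  · obtain ⟨N₁, hn₁⟩ := exists_arity a m
    obtain ⟨N₂, hn₂⟩ := exists_arity (leafR hn₁ a j) l
    have hk₁ : N₁ + M = k₁ + 1 := by omega
    have hn₃ : N + k₂ = N₂ + 1 := by omega
    have hi₂ : (s.block h₁ i σ 1).1 (leafR h₁ i j) =
        leafL hk₁ (leafL hn₁ a J ha.symm) (leafR hn₁ a j) (leafL_ne_leafR _ _ _ _).symm :=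
      (s.block_leafR_eq h₁ hi rfl).trans (leafR_leafL hk h₁ hn₁ hk₁ J a ha ha.symm j _)
    rw [Cut.above_left h₁ p i q e₁ pq hpq ha hi hn₁ rfl rfl rfl,
      Cut.above_left h₂ pq _ r e₂ z hz (leafL_ne_leafR _ _ _ _).symm hi₂ hn₂ rfl rfl rfl,
      Cut.above_left h₄ p i qr e₄ z hz' ha hi hn₃ ?_ ?_ ?_]
    · exact Cut.mk_congr rfl (X.assoc₁ (_hqr := hqr) ..) rfl
    · subst hqr
      exact (P.assoc ..).symm
    · exact leafL_leafR_leafL hn₁ hn₂ hn₃ a J j _ _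
    · exact hσ
  · obtain ⟨M₁, hm₁⟩ := exists_arity t m
    obtain ⟨M₂, hm₂⟩ := exists_arity (leafR hm₁ t j) l
    have hk₁ : N + M₁ = k₁ + 1 := by omega
    have hm₃ : M + k₂ = M₂ + 1 := by omega
    have hi₂ : (s.block h₁ i σ 1).1 (leafR h₁ i j) = leafR hk₁ J (leafR hm₁ t j) :=
      (s.block_leafR_eq h₁ hi rfl).trans (leafR_leafR hk h₁ hm₁ hk₁ J t j)
    rw [Cut.above_right h₁ p i q e₁ pq hpq hi hm₁ rfl rfl,
      Cut.above_right h₂ pq _ r e₂ z hz hi₂ hm₂ rfl rfl,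
      Cut.above_right h₄ p i qr e₄ z hz' hi hm₃ ?_ ?_]
    · exact Cut.mk_congr rfl rfl (Y.assoc₁ (_hqr := hqr) ..)
    · subst hqr
      exact (P.assoc ..).symm
    · exact hσ

/-- If the leaf `σ j` comes from `A`, this is the axiom of the pointed module. If it comes from `b`,
the two steps change different parts and only the outer permutations have to be compared. -/
theorem Cut.assoc₂ (h₁ : n + m = k₁ + 1) (h₂ : k₁ + l = k + 1) (h₃ : m + l = k₂ + 1)
    (h₄ : n + k₂ = k + 1) (p : P.Op n) (i : Fin n) (q : P.Op m) (j : Fin m) (r : P.Op l)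
    (e₁ : P.out q = P.inp p i) (pq : P.Op k₁) (hpq : P.comp h₁ p i q e₁ = pq)
    (e₃ : P.out r = P.inp q j) (qr : P.Op k₂) (hqr : P.comp h₃ q j r e₃ = qr)
    (e₂ : P.out r = P.inp pq (leafR h₁ i j)) (e₄ : P.out qr = P.inp p i)
    (z : P.Op k) (hz : P.comp h₂ pq (leafR h₁ i j) r e₂ = z) (hz' : P.comp h₄ p i qr e₄ = z)
    (x : Cut X Y q) :
    Cut.above h₂ pq (leafR h₁ i j) r e₂ z hz (Cut.below h₁ p i q e₁ pq hpq x) =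
      Cut.below h₄ p i qr e₄ z hz' (Cut.above h₃ q j r e₃ qr hqr x) := by
  induction x using Cut.ind with
  | @h N M hk A J b e σ h ξ η =>
  obtain ⟨N₁, hn₁⟩ := exists_arity i N
  have hk₁ : N₁ + M = k₁ + 1 := by omega
  have hσ : s.block h₂ (leafR h₁ i j) (s.block h₁ i 1 σ) (1 : s.perms l) =
      s.block h₄ i 1 (s.block h₃ j σ 1) := s.block_assoc h₁ h₂ h₃ h₄ ..
  rcases leaf_cases hk J (σ.1 j) with ⟨a, ha, hi⟩ | ⟨t, hi⟩
  · obtain ⟨N₂, hn₂⟩ := exists_arity (leafR hn₁ i a) l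
    obtain ⟨N₃, hn₃⟩ := exists_arity a l
    have hn₄ : n + N₃ = N₂ + 1 := by omega
    have hi₂ : (s.block h₁ i 1 σ).1 (leafR h₁ i j) =
        leafL hk₁ (leafR hn₁ i J) (leafR hn₁ i a) (leafR_ne_leafR _ _ ha) :=
      (s.block_leafR_eq h₁ rfl hi).trans (leafL_leafR_leafR hn₁ hk₁ hk h₁ i J a ha _).symm
    rw [Cut.below_mk h₁ p i q e₁ pq hpq hn₁ rfl rfl rfl,
      Cut.above_left h₂ pq _ r e₂ z hz (leafR_ne_leafR _ _ ha) hi₂ hn₂ rfl rfl rfl,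
      Cut.above_left h₃ q j r e₃ qr hqr ha hi hn₃ rfl rfl rfl,
      Cut.below_mk h₄ p i qr e₄ z hz' hn₄ ?_ ?_ ?_]
    · exact Cut.mk_congr rfl (X.assoc₂ ..) rfl
    · exact (P.assoc ..).symm
    · exact leafL_leafR_leafR hn₁ hn₂ hn₃ hn₄ i a J _ _
    · exact hσ
  · obtain ⟨M₁, hm₁⟩ := exists_arity t l
    have hi₂ : (s.block h₁ i 1 σ).1 (leafR h₁ i j) = leafR hk₁ (leafR hn₁ i J) t :=
      (s.block_leafR_eq h₁ rfl hi).trans (leafR_leafR hn₁ hk₁ hk h₁ i J t).symm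
    rw [Cut.below_mk h₁ p i q e₁ pq hpq hn₁ rfl rfl rfl,
      Cut.above_right h₂ pq _ r e₂ z hz hi₂ hm₁ rfl rfl,
      Cut.above_right h₃ q j r e₃ qr hqr hi hm₁ rfl rfl,
      Cut.below_mk h₄ p i qr e₄ z hz' hn₁ rfl rfl rfl]
    exact Cut.mk_congr hσ rfl rfl

theorem Cut.assoc₃ (h₁ : n + m = k₁ + 1) (h₂ : k₁ + l = k + 1) (h₃ : m + l = k₂ + 1)
    (h₄ : n + k₂ = k + 1) (p : P.Op n) (i : Fin n) (q : P.Op m) (j : Fin m) (r : P.Op l)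
    (e₁ : P.out q = P.inp p i) (pq : P.Op k₁) (hpq : P.comp h₁ p i q e₁ = pq)
    (e₃ : P.out r = P.inp q j) (qr : P.Op k₂) (hqr : P.comp h₃ q j r e₃ = qr)
    (e₂ : P.out r = P.inp pq (leafR h₁ i j)) (e₄ : P.out qr = P.inp p i)
    (z : P.Op k) (hz : P.comp h₂ pq (leafR h₁ i j) r e₂ = z) (hz' : P.comp h₄ p i qr e₄ = z)
    (x : Cut X Y r) :
    Cut.below h₂ pq (leafR h₁ i j) r e₂ z hz x =
      Cut.below h₄ p i qr e₄ z hz' (Cut.below h₃ q j r e₃ qr hqr x) := by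
  induction x using Cut.ind with
  | @h N M hk A J b e σ h ξ η =>
  obtain ⟨N₁, hn₁⟩ := exists_arity (leafR h₁ i j) N
  obtain ⟨N₂, hn₂⟩ := exists_arity j N
  have hn₃ : n + N₂ = N₁ + 1 := by omega
  rw [Cut.below_mk h₂ pq (leafR h₁ i j) r e₂ z hz hn₁ rfl rfl rfl,
    Cut.below_mk h₃ q j r e₃ qr hqr hn₂ rfl rfl rfl,
    Cut.below_mk h₄ p i qr e₄ z hz' hn₃ ?_ ?_ ?_]
  · exact Cut.mk_congr rfl (X.assoc₃ (_hpq := hpq) ..) rfl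
  · subst hpq
    exact (P.assoc ..).symm
  · exact leafR_leafR h₁ hn₁ hn₂ hn₃ i j J
  · rw [← s.block_assoc h₁ h₂ h₃ h₄, s.block_one]

/-- The mixed case of the parallel axiom: one graft falls on `A` and the other on `b`, so the two
actions concern different decorations and commute. The opposite mixed case follows by exchanging the
roles of the grafts. -/
theorem Cut.parallel₁_aux (h₁ : n + m = k₁ + 1) (h₂ : k₁ + l = k + 1) (h₃ : n + l = k₂ + 1)
    (h₄ : k₂ + m = k + 1) (p : P.Op n) (i a : Fin n) (ha : a ≠ i) (q : P.Op m) (r : P.Op l)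
    (e₁ : P.out q = P.inp p i) (pq : P.Op k₁) (hpq : P.comp h₁ p i q e₁ = pq)
    (e₃ : P.out r = P.inp p a) (pr : P.Op k₂) (hpr : P.comp h₃ p a r e₃ = pr)
    (e₂ : P.out r = P.inp pq (leafL h₁ i a ha)) (e₄ : P.out q = P.inp pr (leafL h₃ a i ha.symm))
    (z : P.Op k) (hz : P.comp h₂ pq (leafL h₁ i a ha) r e₂ = z)
    (hz' : P.comp h₄ pr (leafL h₃ a i ha.symm) q e₄ = z)
    {N M : ℕ} {hk : N + M = n + 1} {A : P.Op N} {J : Fin N} {b : P.Op M}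
    {e : P.out b = P.inp A J} {σ : s.perms n} {h : P.act (P.comp hk A J b e) σ = p}
    {ξ : X.obj A J} {η : Y.obj b} {c : Fin N} (hc : c ≠ J) (hi : σ.1 i = leafL hk J c hc)
    {t : Fin M} (hi' : σ.1 a = leafR hk J t) :
    Cut.above h₂ pq (leafL h₁ i a ha) r e₂ z hz
        (Cut.above h₁ p i q e₁ pq hpq (.mk hk A J b e σ h ξ η)) =
      Cut.above h₄ pr (leafL h₃ a i ha.symm) q e₄ z hz'
        (Cut.above h₃ p a r e₃ pr hpr (.mk hk A J b e σ h ξ η)) := by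
  obtain ⟨N₁, hn₁⟩ := exists_arity c m
  obtain ⟨M₁, hm₁⟩ := exists_arity t l
  have hk₁ : N₁ + M = k₁ + 1 := by omega
  have hk₂ : N + M₁ = k₂ + 1 := by omega
  have h5 : (s.block h₁ i σ 1).1 (leafL h₁ i a ha) = leafR hk₁ (leafL hn₁ c J hc.symm) t :=
    (s.block_leafL_eq h₁ 1 ha hi hi' (leafL_ne_leafR _ _ _ _).symm).trans
      (leafR_leafL hn₁ hk₁ hk h₁ c J hc.symm hc t _).symm
  have h6 : (s.block h₃ a σ 1).1 (leafL h₃ a i ha.symm) = leafL hk₂ J c hc :=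
    (s.block_leafL_eq h₃ 1 ha.symm hi' hi (leafL_ne_leafR _ _ _ _)).trans
      (leafL_leafR_leafL hk h₃ hk₂ J c t hc _)
  rw [Cut.above_left h₁ p i q e₁ pq hpq hc hi hn₁ rfl rfl rfl,
    Cut.above_right h₂ pq _ r e₂ z hz h5 hm₁ rfl rfl,
    Cut.above_right h₃ p a r e₃ pr hpr hi' hm₁ rfl rfl,
    Cut.above_left h₄ pr _ q e₄ z hz' hc h6 hn₁ rfl rfl rfl]
  exact Cut.mk_congr (s.block_parallel h₁ h₂ h₃ h₄ ..) rfl rfl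

theorem Cut.parallel₁ (h₁ : n + m = k₁ + 1) (h₂ : k₁ + l = k + 1) (h₃ : n + l = k₂ + 1)
    (h₄ : k₂ + m = k + 1) (p : P.Op n) (i a : Fin n) (ha : a ≠ i) (q : P.Op m) (r : P.Op l)
    (e₁ : P.out q = P.inp p i) (pq : P.Op k₁) (hpq : P.comp h₁ p i q e₁ = pq)
    (e₃ : P.out r = P.inp p a) (pr : P.Op k₂) (hpr : P.comp h₃ p a r e₃ = pr)
    (e₂ : P.out r = P.inp pq (leafL h₁ i a ha)) (e₄ : P.out q = P.inp pr (leafL h₃ a i ha.symm))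
    (z : P.Op k) (hz : P.comp h₂ pq (leafL h₁ i a ha) r e₂ = z)
    (hz' : P.comp h₄ pr (leafL h₃ a i ha.symm) q e₄ = z) (x : Cut X Y p) :
    Cut.above h₂ pq (leafL h₁ i a ha) r e₂ z hz (Cut.above h₁ p i q e₁ pq hpq x) =
      Cut.above h₄ pr (leafL h₃ a i ha.symm) q e₄ z hz' (Cut.above h₃ p a r e₃ pr hpr x) := by
  induction x using Cut.ind with
  | @h N M hk A J b e σ h ξ η =>
  have hne : σ.1 a ≠ σ.1 i := σ.1.injective.ne ha
  have hσ := s.block_parallel h₁ h₂ h₃ h₄ i a ha ha.symm σ 1 1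
  rcases leaf_cases hk J (σ.1 i) with ⟨c, hc, hi⟩ | ⟨t, hi⟩ <;>
    rcases leaf_cases hk J (σ.1 a) with ⟨d, hd, hi'⟩ | ⟨u, hi'⟩
  · have hdc : d ≠ c := by
      rintro rfl
      exact hne (hi'.trans hi.symm)
    obtain ⟨N₁, hn₁⟩ := exists_arity c m
    obtain ⟨N₂, hn₂⟩ := exists_arity (leafL hn₁ c d hdc) l
    obtain ⟨N₃, hn₃⟩ := exists_arity d l
    have hn₄ : N₃ + m = N₂ + 1 := by omega
    have hk₁ : N₁ + M = k₁ + 1 := by omega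
    have hk₂ : N₃ + M = k₂ + 1 := by omega
    have h5 : (s.block h₁ i σ 1).1 (leafL h₁ i a ha) = leafL hk₁ (leafL hn₁ c J hc.symm)
        (leafL hn₁ c d hdc) (leafL_ne_leafL _ _ _ _ hd) :=
      (s.block_leafL_eq h₁ 1 ha hi hi' (leafL_ne_leafL _ _ _ _ hdc)).trans
        (leafL_leafL_leafL hk h₁ hn₁ hk₁ J c d hc hc.symm hd hdc _ _)
    have h6 : (s.block h₃ a σ 1).1 (leafL h₃ a i ha.symm) = leafL hk₂ (leafL hn₃ d J hd.symm)
        (leafL hn₃ d c hdc.symm) (leafL_ne_leafL _ _ _ _ hc) :=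
      (s.block_leafL_eq h₃ 1 ha.symm hi' hi (leafL_ne_leafL _ _ _ _ hdc.symm)).trans
        (leafL_leafL_leafL hk h₃ hn₃ hk₂ J d c hd hd.symm hc hdc.symm _ _)
    rw [Cut.above_left h₁ p i q e₁ pq hpq hc hi hn₁ rfl rfl rfl,
      Cut.above_left h₂ pq _ r e₂ z hz (leafL_ne_leafL _ _ _ _ hd) h5 hn₂ rfl rfl rfl,
      Cut.above_left h₃ p a r e₃ pr hpr hd hi' hn₃ rfl rfl rfl,
      Cut.above_left h₄ pr _ q e₄ z hz' (leafL_ne_leafL _ _ _ _ hc) h6 hn₄ ?_ ?_ ?_]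
    · exact Cut.mk_congr rfl (X.parallel₁ (ha := hdc) ..) rfl
    · exact (P.parallel (ha := hdc) ..).symm
    · exact leafL_leafL_leafL hn₁ hn₂ hn₃ hn₄ c d J hdc hdc.symm hc.symm hd.symm _ _
    · exact hσ
  · exact Cut.parallel₁_aux h₁ h₂ h₃ h₄ p i a ha q r e₁ pq hpq e₃ pr hpr e₂ e₄ z hz hz' hc hi hi'
  · exact (Cut.parallel₁_aux h₃ h₄ h₁ h₂ p a i ha.symm r q e₃ pr hpr e₁ pq hpq e₄ e₂ z hz' hz hd
      hi' hi).symm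
  · have hut : u ≠ t := by
      rintro rfl
      exact hne (hi'.trans hi.symm)
    obtain ⟨M₁, hm₁⟩ := exists_arity t m
    obtain ⟨M₂, hm₂⟩ := exists_arity (leafL hm₁ t u hut) l
    obtain ⟨M₃, hm₃⟩ := exists_arity u l
    have hm₄ : M₃ + m = M₂ + 1 := by omega
    have hk₁ : N + M₁ = k₁ + 1 := by omega
    have hk₂ : N + M₃ = k₂ + 1 := by omega
    have h5 : (s.block h₁ i σ 1).1 (leafL h₁ i a ha) = leafR hk₁ J (leafL hm₁ t u hut) :=
      (s.block_leafL_eq h₁ 1 ha hi hi' (leafR_ne_leafR _ _ hut)).trans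
        (leafL_leafR_leafR hk h₁ hm₁ hk₁ J t u hut _)
    have h6 : (s.block h₃ a σ 1).1 (leafL h₃ a i ha.symm) = leafR hk₂ J (leafL hm₃ u t hut.symm) :=
      (s.block_leafL_eq h₃ 1 ha.symm hi' hi (leafR_ne_leafR _ _ hut.symm)).trans
        (leafL_leafR_leafR hk h₃ hm₃ hk₂ J u t hut.symm _)
    rw [Cut.above_right h₁ p i q e₁ pq hpq hi hm₁ rfl rfl,
      Cut.above_right h₂ pq _ r e₂ z hz h5 hm₂ rfl rfl,
      Cut.above_right h₃ p a r e₃ pr hpr hi' hm₃ rfl rfl,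
      Cut.above_right h₄ pr _ q e₄ z hz' h6 hm₄ ?_ ?_]
    · exact Cut.mk_congr rfl rfl (Y.parallel₁ (ha := hut) ..)
    · exact (P.parallel (ha := hut) ..).symm
    · exact hσ

/-- After `p` is placed below, its input `a` is an input of the lower part, so `r` always falls
there and no case distinction arises. -/
theorem Cut.parallel₂ (h₁ : n + m = k₁ + 1) (h₂ : k₁ + l = k + 1) (h₃ : n + l = k₂ + 1)
    (h₄ : k₂ + m = k + 1) (p : P.Op n) (i a : Fin n) (ha : a ≠ i) (q : P.Op m) (r : P.Op l)
    (e₁ : P.out q = P.inp p i) (pq : P.Op k₁) (hpq : P.comp h₁ p i q e₁ = pq)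
    (e₃ : P.out r = P.inp p a) (pr : P.Op k₂) (hpr : P.comp h₃ p a r e₃ = pr)
    (e₂ : P.out r = P.inp pq (leafL h₁ i a ha)) (e₄ : P.out q = P.inp pr (leafL h₃ a i ha.symm))
    (z : P.Op k) (hz : P.comp h₂ pq (leafL h₁ i a ha) r e₂ = z)
    (hz' : P.comp h₄ pr (leafL h₃ a i ha.symm) q e₄ = z) (x : Cut X Y q) :
    Cut.above h₂ pq (leafL h₁ i a ha) r e₂ z hz (Cut.below h₁ p i q e₁ pq hpq x) =
      Cut.below h₄ pr (leafL h₃ a i ha.symm) q e₄ z hz' x := by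
  induction x using Cut.ind with
  | @h N M hk A J b e σ h ξ η =>
  obtain ⟨N₁, hn₁⟩ := exists_arity i N
  obtain ⟨N₂, hn₂⟩ := exists_arity (leafL hn₁ i a ha) l
  have hn₃ : k₂ + N = N₂ + 1 := by omega
  have hk₁ : N₁ + M = k₁ + 1 := by omega
  have h5 : (s.block h₁ i 1 σ).1 (leafL h₁ i a ha) = leafL hk₁ (leafR hn₁ i J)
      (leafL hn₁ i a ha) (leafL_ne_leafR _ _ _ _) :=
    (s.block_leafL_eq h₁ σ ha rfl rfl ha).trans (leafL_leafR_leafL hn₁ hk₁ h₁ i a J ha _).symm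
  rw [Cut.below_mk h₁ p i q e₁ pq hpq hn₁ rfl rfl rfl,
    Cut.above_left h₂ pq _ r e₂ z hz (leafL_ne_leafR _ _ _ _) h5 hn₂ rfl rfl rfl,
    Cut.below_mk h₄ pr _ q e₄ z hz' hn₃ ?_ ?_ ?_]
  · exact Cut.mk_congr rfl (X.parallel₂ (_hpr := hpr) ..) rfl
  · subst hpr
    exact (P.parallel (ha := ha) ..).symm
  · exact (leafR_leafL h₃ hn₃ hn₁ hn₂ a i ha.symm ha J _).symm
  · rw [s.block_parallel h₁ h₂ h₃ h₄ i a ha ha.symm, s.block_one]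

theorem Cut.comp_one (hk' : n + 1 = n + 1) (p : P.Op n) (i : Fin n) (c : P.Colour)
    (e₁ : P.out (P.one c) = P.inp p i) (hz : P.comp hk' p i (P.one c) e₁ = p) (x : Cut X Y p) :
    Cut.above hk' p i (P.one c) e₁ p hz x = x := by
  induction x using Cut.ind with
  | @h N M hk A J b e σ h ξ η =>
  have hσ : σ = s.block hk' i σ (1 : s.perms 1) := (s.block_unit_right ..).symm
  rcases leaf_cases hk J (σ.1 i) with ⟨a, ha, hi⟩ | ⟨t, hi⟩
  · rw [Cut.above_left hk' p i _ e₁ p hz ha hi (n₁ := N) rfl (P.comp_one _ _ _ _ _)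
      (j₁ := J) (leafL_one ..).symm hσ]
    exact Cut.mk_congr rfl (X.comp_one ..) rfl
  · rw [Cut.above_right hk' p i _ e₁ p hz hi (m₁ := M) rfl (P.comp_one _ _ _ _ _) hσ]
    exact Cut.mk_congr rfl rfl (Y.comp_one ..)

theorem Cut.one_comp (hk' : 1 + n = n + 1) (c : P.Colour) (i : Fin 1) (p : P.Op n)
    (e₁ : P.out p = P.inp (P.one c) i) (hz : P.comp hk' (P.one c) i p e₁ = p) (x : Cut X Y p) :
    Cut.below hk' (P.one c) i p e₁ p hz x = x := by
  induction x using Cut.ind with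
  | @h N M hk A J b e σ h ξ η =>
  rw [Cut.below_mk hk' _ i p e₁ p hz (n₁ := N) (by omega) (P.one_comp _ _ _ _ _) (j₁ := J)
    (leafR_one ..).symm (s.block_unit_left ..).symm]
  exact Cut.mk_congr rfl (X.one_comp ..) rfl

theorem Cut.act_one (p : P.Op n) (hz : P.act p 1 = p) (x : Cut X Y p) :
    Cut.perm p 1 p hz x = x := by
  induction x using Cut.ind with
  | h => exact Cut.mk_congr (mul_one _) rfl rfl

theorem Cut.act_mul (p : P.Op n) (σ τ : s.perms n) (pσ z : P.Op n) (hpσ : P.act p σ = pσ)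
    (hz : P.act p (σ * τ) = z) (hz' : P.act pσ τ = z) (x : Cut X Y p) :
    Cut.perm p (σ * τ) z hz x = Cut.perm pσ τ z hz' (Cut.perm p σ pσ hpσ x) := by
  induction x using Cut.ind with
  | h => exact Cut.mk_congr (mul_assoc _ _ _).symm rfl rfl

/-- The two sides have different representatives: one grafts `q^τ` and the other grafts `q`. They
differ by `1 ∘ τ` on the inputs of the part that receives the graft, and this is a change of
presentation. -/
theorem Cut.act_comp₁ (hk' : n + m = k + 1) (p : P.Op n) (i : Fin n) (q : P.Op m)
    (σ' : s.perms n) (τ : s.perms m) (pσ : P.Op n) (hpσ : P.act p σ' = pσ)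
    (qτ : P.Op m) (hqτ : P.act q τ = qτ)
    (e₁ : P.out qτ = P.inp pσ i) (e₂ : P.out q = P.inp p (σ'.1 i))
    (pq : P.Op k) (hpq : P.comp hk' p (σ'.1 i) q e₂ = pq)
    (z : P.Op k) (hz : P.comp hk' pσ i qτ e₁ = z) (hz' : P.act pq (s.block hk' i σ' τ) = z)
    (x : Cut X Y p) :
    Cut.above hk' pσ i qτ e₁ z hz (Cut.perm p σ' pσ hpσ x) =
      Cut.perm pq (s.block hk' i σ' τ) z hz' (Cut.above hk' p (σ'.1 i) q e₂ pq hpq x) := by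
  induction x using Cut.ind with
  | @h N M hk A J b e σ h ξ η =>
  -- Both products equal `block i (σ * σ') τ`. The right-hand factorization isolates `τ`, which is
  -- then absorbed into a permutation of the inputs of one part of the cut.
  have hσ : s.block hk' (σ'.1 i) σ (1 : s.perms m) * s.block hk' i σ' τ =
      s.block hk' (σ.1 (σ'.1 i)) 1 τ * s.block hk' i (σ * σ') 1 := by
    have h5 := s.block_mul hk' i 1 (σ * σ') τ 1
    rw [one_mul, mul_one] at h5
    rw [← s.block_mul, one_mul, h5]
    rfl
  rcases leaf_cases hk J (σ.1 (σ'.1 i)) with ⟨a, ha, hi⟩ | ⟨t, hi⟩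
  · obtain ⟨N₁, hn₁⟩ := exists_arity a m
    have hk₁ : N₁ + M = k + 1 := by omega
    rw [Cut.perm_mk, Cut.above_left hk' pσ i qτ e₁ z hz ha hi hn₁ rfl rfl rfl,
      Cut.above_left hk' p _ q e₂ pq hpq ha hi hn₁ rfl rfl rfl, Cut.perm_mk]
    symm
    refine Cut.sound (s.block hn₁ a 1 τ) 1 ?_ ?_ (P.act_one b) ?_ ?_ (Y.act_one ..).symm
    · subst hqτ
      exact (comp_act_right ..).symm
    · exact (s.block_leafL_eq hn₁ (σ := 1) τ ha.symm rfl rfl ha.symm).symm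
    · rw [hσ, hi, ← s.block_parallel hk hk' hn₁ hk₁ J a ha, s.block_one]
    · exact X.above_act (hqτ := hqτ) ..
  · obtain ⟨M₁, hm₁⟩ := exists_arity t m
    have hk₁ : N + M₁ = k + 1 := by omega
    rw [Cut.perm_mk, Cut.above_right hk' pσ i qτ e₁ z hz hi hm₁ rfl rfl,
      Cut.above_right hk' p _ q e₂ pq hpq hi hm₁ rfl rfl, Cut.perm_mk]
    symm
    refine Cut.sound 1 (s.block hm₁ t 1 τ) (P.act_one A) rfl ?_ ?_ (X.act_one ..).symm ?_
    · subst hqτ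
      exact (comp_act_right ..).symm
    · rw [hσ, hi, ← s.block_assoc hk hk' hm₁ hk₁, s.block_one]
    · exact Y.above_act (hqτ := hqτ) ..

theorem Cut.act_comp₂ (hk' : n + m = k + 1) (p : P.Op n) (i : Fin n) (q : P.Op m)
    (σ' : s.perms n) (τ : s.perms m) (pσ : P.Op n) (hpσ : P.act p σ' = pσ)
    (qτ : P.Op m) (hqτ : P.act q τ = qτ)
    (e₁ : P.out qτ = P.inp pσ i) (e₂ : P.out q = P.inp p (σ'.1 i))
    (pq : P.Op k) (hpq : P.comp hk' p (σ'.1 i) q e₂ = pq)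
    (z : P.Op k) (hz : P.comp hk' pσ i qτ e₁ = z) (hz' : P.act pq (s.block hk' i σ' τ) = z)
    (x : Cut X Y q) :
    Cut.below hk' pσ i qτ e₁ z hz (Cut.perm q τ qτ hqτ x) =
      Cut.perm pq (s.block hk' i σ' τ) z hz' (Cut.below hk' p (σ'.1 i) q e₂ pq hpq x) := by
  induction x using Cut.ind with
  | @h N M hk A J b e σ h ξ η =>
  obtain ⟨N₁, hn₁⟩ := exists_arity i N
  have hk₁ : N₁ + M = k + 1 := by omega
  rw [Cut.perm_mk, Cut.below_mk hk' pσ i qτ e₁ z hz hn₁ rfl rfl rfl,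
    Cut.below_mk hk' p _ q e₂ pq hpq hn₁ rfl rfl rfl, Cut.perm_mk]
  symm
  refine Cut.sound (s.block hn₁ i σ' 1) 1 ?_ ?_ (P.act_one b) ?_ ?_ (Y.act_one ..).symm
  · subst hpσ
    exact (comp_act_left ..).symm
  · exact (s.block_leafR_eq hn₁ (σ := σ') (τ := 1) (b := J) rfl rfl).symm
  · rw [s.block_assoc hn₁ hk₁ hk hk', s.block_one, ← s.block_mul, one_mul]
    have h5 := s.block_mul hk' i σ' 1 1 (σ * τ)
    rw [one_mul, mul_one] at h5
    exact h5
  · exact X.below_act (hpσ := hpσ) ..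

end Axioms

end Tw

end Operad

namespace Operad

variable {s : OperadKind} {P : Operad.{u} s}

namespace Tw

/-! ## Decorated cuts as a functor on the twisted arrow category -/

section Map

variable {X : PointedModule P} {Y : UpperModule P}

/-- The action of a step on decorated cuts. -/
noncomputable def Cut.step : {a b : Tw P} → Step P a b → Cut X Y a.op → Cut X Y b.op
  | _, _, .above hk p i q e z hz => Cut.above hk p i q e z hz
  | _, _, .below hk p i q e z hz => Cut.below hk p i q e z hz
  | _, _, .perm p σ z hz => Cut.perm p σ z hz

/-- The action of an expression on decorated cuts. -/
noncomputable def Cut.expr {a : Tw P} : {b : Tw P} → Expr P a b → Cut X Y a.op → Cut X Y b.op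
  | _, .var, x => x
  | _, .step E g, x => Cut.step g (Cut.expr E x)

/-- Each relation between expressions has been checked on cuts separately, so the action is defined
on morphisms of `Tw P`. -/
theorem Cut.expr_rel {a b : Tw P} {E E' : Expr P a b} (h : ExprRel P E E') (x : Cut X Y a.op) :
    Cut.expr E x = Cut.expr E' x := by
  induction h with
  | step g _ ih => exact congrArg (Cut.step g) ih
  | assoc₁ => exact Cut.assoc₁ (hqr := by assumption) ..
  | assoc₂ => exact Cut.assoc₂ ..
  | assoc₃ => exact Cut.assoc₃ (hpq := by assumption) ..
  | parallel₁ => exact Cut.parallel₁ ..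
  | parallel₂ => exact Cut.parallel₂ (hpr := by assumption) ..
  | comp_one => exact Cut.comp_one ..
  | one_comp => exact Cut.one_comp ..
  | act_one => exact Cut.act_one (hz := by assumption) ..
  | act_mul => exact Cut.act_mul (hpσ := by assumption) (hz := by assumption) (hz' := by assumption) ..
  | act_comp₁ => exact Cut.act_comp₁ (hpσ := by assumption) (hqτ := by assumption) (hz' := by assumption) ..
  | act_comp₂ => exact Cut.act_comp₂ (hpσ := by assumption) (hqτ := by assumption) (hz' := by assumption) ..

/-- The action of a morphism of the twisted arrow category on decorated cuts. -/
noncomputable def Cut.map {a b : Tw P} (f : a ⟶ b) (x : Cut X Y a.op) : Cut X Y b.op :=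
  Quot.lift (fun E : Expr P a b => Cut.expr E x) (fun _ _ h => Cut.expr_rel h x) f

theorem Cut.map_id {a : Tw P} (x : Cut X Y a.op) : Cut.map (𝟙 a) x = x := rfl

theorem Cut.map_comp_step {a b c : Tw P} (f : a ⟶ b) (g : Step P b c) (x : Cut X Y a.op) :
    Cut.map (f ≫ g.hom) x = Cut.step g (Cut.map f x) := by
  induction f using Quot.ind
  rfl

theorem Cut.map_comp {a b c : Tw P} (f : a ⟶ b) (g : b ⟶ c) (x : Cut X Y a.op) :
    Cut.map (f ≫ g) x = Cut.map g (Cut.map f x) := by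
  induction g using hom_induction with
  | id => rw [Category.comp_id, Cut.map_id]
  | step g t ih => rw [← Category.assoc, Cut.map_comp_step, ih, Cut.map_comp_step]

end Map

/-! ## Changing the decorations -/

/-- Morphisms of pointed modules. -/
structure PointedModule.Hom (X X' : PointedModule P) where
  app : ∀ {n : ℕ} {A : P.Op n} {j : Fin n}, X.obj A j → X'.obj A j
  above : ∀ {n m k : ℕ} (hk : n + m = k + 1) (p : P.Op n) (i : Fin n) (q : P.Op m)
    (e : P.out q = P.inp p i) (z : P.Op k) (hz : P.comp hk p i q e = z) (t : Fin n) (ht : t ≠ i)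
    (t' : Fin k) (ht' : t' = leafL hk i t ht) (x : X.obj p t),
    app (X.above hk p i q e z hz t ht t' ht' x) = X'.above hk p i q e z hz t ht t' ht' (app x)
  below : ∀ {n m k : ℕ} (hk : n + m = k + 1) (p : P.Op n) (i : Fin n) (q : P.Op m)
    (e : P.out q = P.inp p i) (z : P.Op k) (hz : P.comp hk p i q e = z) (t : Fin m)
    (t' : Fin k) (ht' : t' = leafR hk i t) (x : X.obj q t),
    app (X.below hk p i q e z hz t t' ht' x) = X'.below hk p i q e z hz t t' ht' (app x)
  perm : ∀ {n : ℕ} (p : P.Op n) (σ : s.perms n) (z : P.Op n) (hz : P.act p σ = z) (t t' : Fin n)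
    (ht : t = σ.1 t') (x : X.obj p t),
    app (X.perm p σ z hz t t' ht x) = X'.perm p σ z hz t t' ht (app x)

/-- Morphisms of upper modules. -/
structure UpperModule.Hom (Y Y' : UpperModule P) where
  app : ∀ {n : ℕ} {b : P.Op n}, Y.obj b → Y'.obj b
  above : ∀ {n m k : ℕ} (hk : n + m = k + 1) (p : P.Op n) (i : Fin n) (q : P.Op m)
    (e : P.out q = P.inp p i) (z : P.Op k) (hz : P.comp hk p i q e = z) (x : Y.obj p),
    app (Y.above hk p i q e z hz x) = Y'.above hk p i q e z hz (app x)
  perm : ∀ {n : ℕ} (p : P.Op n) (σ : s.perms n) (z : P.Op n) (hz : P.act p σ = z) (x : Y.obj p),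
    app (Y.perm p σ z hz x) = Y'.perm p σ z hz (app x)

variable (P) in
/-- The pointed module without decorations. -/
def PointedModule.trivial : PointedModule P where
  obj _ _ := PUnit
  above _ _ _ _ _ _ _ _ _ _ _ x := x
  below _ _ _ _ _ _ _ _ _ _ x := x
  perm _ _ _ _ _ _ _ x := x
  assoc₁ := by intros; rfl
  assoc₂ := by intros; rfl
  assoc₃ := by intros; rfl
  parallel₁ := by intros; rfl
  parallel₂ := by intros; rfl
  comp_one := by intros; rfl
  one_comp := by intros; rfl
  act_one := by intros; rfl
  act_mul := by intros; rfl
  act_comp₁ := by intros; rfl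
  act_comp₂ := by intros; rfl

variable (P) in
/-- The upper module without decorations. -/
def UpperModule.trivial : UpperModule P where
  obj _ := PUnit
  above _ _ _ _ _ _ _ x := x
  perm _ _ _ _ x := x
  assoc₁ := by intros; rfl
  parallel₁ := by intros; rfl
  comp_one := by intros; rfl
  act_one := by intros; rfl
  act_mul := by intros; rfl
  act_comp₁ := by intros; rfl

/-- The identity of a pointed module. -/
def PointedModule.Hom.id (X : PointedModule P) : PointedModule.Hom X X where
  app x := x
  above := by intros; rfl
  below := by intros; rfl
  perm := by intros; rfl

/-- Forgetting the decorations. -/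
def PointedModule.Hom.toTrivial (X : PointedModule P) :
    PointedModule.Hom X (PointedModule.trivial P) where
  app _ := PUnit.unit
  above := by intros; rfl
  below := by intros; rfl
  perm := by intros; rfl

/-- The identity of an upper module. -/
def UpperModule.Hom.id (Y : UpperModule P) : UpperModule.Hom Y Y where
  app x := x
  above := by intros; rfl
  perm := by intros; rfl

/-- Forgetting the decorations. -/
def UpperModule.Hom.toTrivial (Y : UpperModule P) : UpperModule.Hom Y (UpperModule.trivial P) where
  app _ := PUnit.unit
  above := by intros; rfl
  perm := by intros; rfl

section Decorations

variable {X X' : PointedModule P} {Y Y' : UpperModule P}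

/-- Changing the decorations of cuts. -/
def Cut.decorate (f : PointedModule.Hom X X') (g : UpperModule.Hom Y Y') {k : ℕ} {r : P.Op k} :
    Cut X Y r → Cut X' Y' r :=
  Quot.map (fun d => ⟨d.n, d.m, d.hk, d.A, d.j, d.b, d.e, d.σ, d.h, f.app d.ξ, g.app d.η⟩) (by
    rintro _ _ ⟨hk, A, j, b, e, σ, h, ξ, η, τ', ρ, A', hA, j', hj, b', hb, e', σ', hσ, h', ξ', hξ,
      η', hη⟩
    exact .mk hk A j b e σ h _ _ τ' ρ A' hA j' hj b' hb e' σ' hσ h' _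
      ((congrArg f.app hξ).trans (f.perm ..)) _ ((congrArg g.app hη).trans (g.perm ..)))

theorem Cut.decorate_mk (f : PointedModule.Hom X X') (g : UpperModule.Hom Y Y') {n m k : ℕ}
    {r : P.Op k} (hk : n + m = k + 1) (A : P.Op n) (j : Fin n) (b : P.Op m)
    (e : P.out b = P.inp A j) (σ : s.perms k) (h : P.act (P.comp hk A j b e) σ = r)
    (ξ : X.obj A j) (η : Y.obj b) :
    (Cut.mk hk A j b e σ h ξ η).decorate f g = Cut.mk hk A j b e σ h (f.app ξ) (g.app η) := rfl

theorem Cut.decorate_step (f : PointedModule.Hom X X') (g : UpperModule.Hom Y Y') {a b : Tw P}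
    (t : Step P a b) (x : Cut X Y a.op) :
    (Cut.step t x).decorate f g = Cut.step t (x.decorate f g) := by
  cases t with
  | @above k m k' hk' p i q e' z hz =>
    induction x using Cut.ind with
    | @h N M hk A J b e σ h ξ η =>
    dsimp only [Cut.step]
    rcases leaf_cases hk J (σ.1 i) with ⟨a, ha, hi⟩ | ⟨t, hi⟩
    · obtain ⟨N₁, hn₁⟩ := exists_arity a m
      rw [Cut.above_left hk' p i q e' z hz ha hi hn₁ rfl rfl rfl, Cut.decorate_mk, Cut.decorate_mk]
      refine Eq.trans ?_ (Cut.above_left hk' p i q e' z hz ha hi hn₁ rfl rfl rfl).symm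
      exact Cut.mk_congr rfl (f.above ..) rfl
    · obtain ⟨M₁, hm₁⟩ := exists_arity t m
      rw [Cut.above_right hk' p i q e' z hz hi hm₁ rfl rfl, Cut.decorate_mk, Cut.decorate_mk]
      refine Eq.trans ?_ (Cut.above_right hk' p i q e' z hz hi hm₁ rfl rfl).symm
      exact Cut.mk_congr rfl rfl (g.above ..)
  | @below m k k' hk' q i p e' z hz =>
    induction x using Cut.ind with
    | @h N M hk A J b e σ h ξ η =>
    dsimp only [Cut.step]
    obtain ⟨N₁, hn₁⟩ := exists_arity i N
    rw [Cut.below_mk hk' q i p e' z hz hn₁ rfl rfl rfl, Cut.decorate_mk, Cut.decorate_mk]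
    refine Eq.trans ?_ (Cut.below_mk hk' q i p e' z hz hn₁ rfl rfl rfl).symm
    exact Cut.mk_congr rfl (f.below ..) rfl
  | perm p σ z hz =>
    induction x using Cut.ind
    rfl

theorem Cut.decorate_map (f : PointedModule.Hom X X') (g : UpperModule.Hom Y Y') {a b : Tw P}
    (h : a ⟶ b) (x : Cut X Y a.op) :
    (Cut.map h x).decorate f g = Cut.map h (x.decorate f g) := by
  induction h using hom_induction with
  | id => rfl
  | step h t ih => rw [Cut.map_comp_step, Cut.decorate_step, ih, Cut.map_comp_step]

theorem CutRel.equivalence {k : ℕ} (r : P.Op k) : Equivalence (CutRel X Y (r := r)) :=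
  ⟨CutRel.refl, CutRel.symm, CutRel.trans⟩

/-- The relation equals the equivalence it generates, so equality in the quotient gives explicit
permutations of the two parts. -/
theorem Cut.exact {k : ℕ} {r : P.Op k} {d d' : CutData X Y r}
    (h : (Quot.mk _ d : Cut X Y r) = Quot.mk _ d') : CutRel X Y d d' :=
  (CutRel.equivalence r).eqvGen_iff.1 (Quot.eqvGen_exact h)

/-- Forgetting the decoration of the upper part. -/
abbrev Cut.fst {k : ℕ} {r : P.Op k} (x : Cut X Y r) : Cut X (UpperModule.trivial P) r :=
  x.decorate (.id X) (.toTrivial Y)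

/-- Forgetting the decoration of the lower part. -/
abbrev Cut.snd {k : ℕ} {r : P.Op k} (x : Cut X Y r) : Cut (PointedModule.trivial P) Y r :=
  x.decorate (.toTrivial X) (.id Y)

/-- Equality of the undecorated cuts provides permutations taking the presentation of `x` to that of
`y`. The decoration of the lower part is transported along them to the presentation of `y`. -/
theorem Cut.exists_glue {k : ℕ} {r : P.Op k} (x : Cut X (UpperModule.trivial P) r)
    (y : Cut (PointedModule.trivial P) Y r) (h : x.snd = y.fst) :
    ∃ w : Cut X Y r, w.fst = x ∧ w.snd = y := by
  induction x using Quot.ind with | mk x =>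
  induction y using Quot.ind with | mk y =>
  obtain ⟨n, m, hk, A, j, b, e, σ, h₁, ξ, η⟩ := x
  obtain ⟨n', m', hk', A', j', b', e', σ', h₁', ξ', η'⟩ := y
  obtain @⟨_, _, _, _, _, _, _, _, _, _, _, τ, ρ, _, hA, _, hj, _, hb, _, _, hσ, _, _, _, _, _⟩ :=
    Cut.exact h
  refine ⟨.mk hk A' j' b' e' σ' h₁' (X.perm A τ A' hA j j' hj ξ) η', ?_, rfl⟩
  exact (Cut.sound τ ρ hA hj hb hσ rfl rfl).symm

/-- The hypotheses give two comparisons of the same presentations, one respecting the lower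
decorations and one the upper decorations. A comparison respecting both is needed, so the two must
be shown to coincide. -/
theorem Cut.glue_ext {k : ℕ} {r : P.Op k} {w w' : Cut X Y r} (h : w.fst = w'.fst)
    (h' : w.snd = w'.snd) : w = w' := by
  induction w using Quot.ind with | mk w =>
  induction w' using Quot.ind with | mk w' =>
  obtain ⟨n, m, hk, A, j, b, e, σ, h₁, ξ, η⟩ := w
  obtain ⟨n', m', hk', A', j', b', e', σ', h₁', ξ', η'⟩ := w'
  have H := Cut.exact h
  have H' := Cut.exact h'
  obtain @⟨_, _, _, _, _, _, _, _, _, _, _, τ, ρ, _, hA, _, hj, _, hb, _, _, hσ, _, _, hξ, _, _⟩ := H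
  obtain @⟨_, _, _, _, _, _, _, _, _, _, _, τ', ρ', _, hA', _, hj', _, hb', _, _, hσ', _, _, _, _,
    hη⟩ := H'
  -- Both `τ` and `τ'` send `j'` to `j`, and cancelling `σ'` shows that their blocks are equal. So
  -- the two pairs of permutations are equal.
  obtain ⟨rfl, rfl⟩ := s.block_injective hk j' (hj.symm.trans hj')
    (mul_right_cancel (hσ.symm.trans hσ'))
  exact Cut.sound τ ρ hA hj hb hσ hξ hη

end Decorations

/-! ## Evaluation of decorated cuts -/

section Eval

/-- A way to turn decorated cuts into morphisms with source `o`. -/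
structure CutEval (X : PointedModule P) (Y : UpperModule P) (o : Tw P) where
  -- Values are prescribed only on unpermuted cuts `A ∘ⱼ b`; the outer permutation `σ` is added
  -- afterwards by composing with the step `E ↦ E^σ`.
  val : ∀ {n m k : ℕ} (hk : n + m = k + 1) (A : P.Op n) (j : Fin n) (b : P.Op m)
    (e : P.out b = P.inp A j) (z : P.Op k) (_ : P.comp hk A j b e = z),
    X.obj A j → Y.obj b → (o ⟶ ⟨k, z⟩)
  above_left : ∀ {n m k l n₁ k₁ : ℕ} (hk : n + m = k + 1) (A : P.Op n) (j : Fin n) (b : P.Op m)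
    (e : P.out b = P.inp A j) (z : P.Op k) (hz : P.comp hk A j b e = z) (hl : k + l = k₁ + 1)
    (a : Fin n) (ha : a ≠ j) (c : Fin k) (_hc : c = leafL hk j a ha) (q : P.Op l)
    (eq : P.out q = P.inp z c) (z' : P.Op k₁) (hz' : P.comp hl z c q eq = z') (hn : n + l = n₁ + 1) (A₁ : P.Op n₁)
    (ea : P.out q = P.inp A a) (hA : P.comp hn A a q ea = A₁) (j₁ : Fin n₁)
    (hj : j₁ = leafL hn a j ha.symm) (hk₁ : n₁ + m = k₁ + 1) (e₁ : P.out b = P.inp A₁ j₁)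
    (hz₁ : P.comp hk₁ A₁ j₁ b e₁ = z') (ξ : X.obj A j) (η : Y.obj b),
    val hk A j b e z hz ξ η ≫ (Step.above hl z c q eq z' hz').hom =
      val hk₁ A₁ j₁ b e₁ z' hz₁ (X.above hn A a q ea A₁ hA j ha.symm j₁ hj ξ) η
  above_right : ∀ {n m k l m₁ k₁ : ℕ} (hk : n + m = k + 1) (A : P.Op n) (j : Fin n) (b : P.Op m)
    (e : P.out b = P.inp A j) (z : P.Op k) (hz : P.comp hk A j b e = z) (hl : k + l = k₁ + 1)
    (t : Fin m) (c : Fin k) (_hc : c = leafR hk j t) (q : P.Op l) (eq : P.out q = P.inp z c)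
    (z' : P.Op k₁) (hz' : P.comp hl z c q eq = z') (hm : m + l = m₁ + 1) (b₁ : P.Op m₁)
    (et : P.out q = P.inp b t) (hb : P.comp hm b t q et = b₁)
    (hk₁ : n + m₁ = k₁ + 1) (e₁ : P.out b₁ = P.inp A j)
    (hz₁ : P.comp hk₁ A j b₁ e₁ = z') (ξ : X.obj A j) (η : Y.obj b),
    val hk A j b e z hz ξ η ≫ (Step.above hl z c q eq z' hz').hom =
      val hk₁ A j b₁ e₁ z' hz₁ ξ (Y.above hm b t q et b₁ hb η)
  below : ∀ {n m k l n₁ k₁ : ℕ} (hk : n + m = k + 1) (A : P.Op n) (j : Fin n) (b : P.Op m)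
    (e : P.out b = P.inp A j) (z : P.Op k) (hz : P.comp hk A j b e = z) (hl : l + k = k₁ + 1)
    (q : P.Op l) (i : Fin l) (eq : P.out z = P.inp q i) (z' : P.Op k₁)
    (hz' : P.comp hl q i z eq = z') (hn : l + n = n₁ + 1) (A₁ : P.Op n₁)
    (ea : P.out A = P.inp q i) (hA : P.comp hn q i A ea = A₁) (j₁ : Fin n₁)
    (hj : j₁ = leafR hn i j) (hk₁ : n₁ + m = k₁ + 1) (e₁ : P.out b = P.inp A₁ j₁)
    (hz₁ : P.comp hk₁ A₁ j₁ b e₁ = z') (ξ : X.obj A j) (η : Y.obj b),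
    val hk A j b e z hz ξ η ≫ (Step.below hl q i z eq z' hz').hom =
      val hk₁ A₁ j₁ b e₁ z' hz₁ (X.below hn q i A ea A₁ hA j j₁ hj ξ) η
  perm : ∀ {n m k : ℕ} (hk : n + m = k + 1) (A : P.Op n) (j : Fin n) (b : P.Op m)
    (e : P.out b = P.inp A j) (z : P.Op k) (hz : P.comp hk A j b e = z) (τ : s.perms n)
    (ρ : s.perms m) (A' : P.Op n) (hA : P.act A τ = A') (j' : Fin n) (hj : j = τ.1 j')
    (b' : P.Op m) (hb : P.act b ρ = b') (e' : P.out b' = P.inp A' j') (z' : P.Op k)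
    (hz' : P.comp hk A' j' b' e' = z') (hzz : P.act z (s.block hk j' τ ρ) = z')
    (ξ : X.obj A j) (η : Y.obj b),
    val hk A j b e z hz ξ η ≫ (Step.perm z (s.block hk j' τ ρ) z' hzz).hom =
      val hk A' j' b' e' z' hz' (X.perm A τ A' hA j j' hj ξ) (Y.perm b ρ b' hb η)

variable {X : PointedModule P} {Y : UpperModule P} {o : Tw P} (v : CutEval X Y o)

/-- The morphism given by a decorated cut. -/
def CutEval.eval {k : ℕ} {r : P.Op k} : Cut X Y r → (o ⟶ ⟨k, r⟩) :=
  Quot.lift (fun d => v.val d.hk d.A d.j d.b d.e _ rfl d.ξ d.η ≫ (Step.perm _ d.σ r d.h).hom) (by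
    rintro _ _ ⟨hk, A, j, b, e, σ, h, ξ, η, τ, ρ, A', hA, j', hj, b', hb, e', σ', hσ, h', ξ', hξ,
      η', hη⟩
    subst hA hj hb hσ hξ hη
    dsimp only
    have h1 : P.act (P.comp hk A (τ.1 j') b e) (s.block hk j' τ ρ) =
      P.comp hk (P.act A τ) j' (P.act b ρ) e' := (P.act_comp ..).symm
    rw [← v.perm hk A _ b e _ rfl τ ρ _ rfl j' rfl _ rfl e' _ rfl h1, Category.assoc,
      Step.act_mul rfl])

theorem CutEval.eval_mk {n m k : ℕ} {r : P.Op k} {hk : n + m = k + 1} {A : P.Op n} {j : Fin n}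
    {b : P.Op m} {e : P.out b = P.inp A j} {σ : s.perms k} {h : P.act (P.comp hk A j b e) σ = r}
    {ξ : X.obj A j} {η : Y.obj b} : v.eval (.mk hk A j b e σ h ξ η) =
      v.val hk A j b e _ rfl ξ η ≫ (Step.perm _ σ r h).hom := rfl

/-- Equivariance slides the graft past the outer permutation `σ`. It then acts on the unpermuted
cut, at the leaf `σ i`, where the axioms of `CutEval` apply. -/
theorem CutEval.eval_above {k m k' : ℕ} (hk' : k + m = k' + 1) (p : P.Op k) (i : Fin k)
    (q : P.Op m) (e' : P.out q = P.inp p i) (z : P.Op k') (hz : P.comp hk' p i q e' = z)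
    (x : Cut X Y p) :
    v.eval (Cut.above hk' p i q e' z hz x) = v.eval x ≫ (Step.above hk' p i q e' z hz).hom := by
  induction x using Cut.ind with
  | @h N M hk A J b e σ h ξ η =>
  have eσ : P.out q = P.inp (P.comp hk A J b e) (σ.1 i) := by
    rw [e', ← h, P.inp_act]
  have hz₁ : P.act (P.comp hk' (P.comp hk A J b e) (σ.1 i) q eσ) (s.block hk' i σ 1) = z := by
    subst hz h
    exact (comp_act_left ..).symm
  rcases leaf_cases hk J (σ.1 i) with ⟨a, ha, hi⟩ | ⟨t, hi⟩
  · obtain ⟨N₁, hn₁⟩ := exists_arity a m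
    have ea : P.out q = P.inp A a := by rw [eσ, hi, P.inp_comp_left]
    have hk₁ : N₁ + M = k' + 1 := by omega
    have e₁ : P.out b = P.inp (P.comp hn₁ A a q ea) (leafL hn₁ a J ha.symm) := by
      rw [P.inp_comp_left, e]
    have hpq : P.comp hk' (P.comp hk A J b e) (σ.1 i) q eσ =
        P.comp hk₁ (P.comp hn₁ A a q ea) (leafL hn₁ a J ha.symm) b e₁ := by
      rw [← P.parallel hk hk' hn₁ hk₁ A J a ha b q e (by rw [← hi, eσ]) ea e₁]
      exact comp_congr rfl hi rfl
    rw [v.eval_mk, Category.assoc, Step.act_comp₁ (P.act_one q) rfl (e' := eσ) (hpq := hpq) rfl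
      (hz' := by rw [← hpq, hz₁]), Cut.above_left hk' p i q e' z hz ha hi hn₁ rfl rfl rfl,
      v.eval_mk, ← Category.assoc, v.above_left (_hc := hi) (hj := rfl) (hA := rfl) (hz₁ := rfl)]
  · obtain ⟨M₁, hm₁⟩ := exists_arity t m
    have et : P.out q = P.inp b t := by rw [eσ, hi, P.inp_comp_right]
    have hk₁ : N + M₁ = k' + 1 := by omega
    have e₁ : P.out (P.comp hm₁ b t q et) = P.inp A J := by
      rw [P.out_comp, e]
    have hpq : P.comp hk' (P.comp hk A J b e) (σ.1 i) q eσ =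
        P.comp hk₁ A J (P.comp hm₁ b t q et) e₁ := by
      rw [← P.assoc hk hk' hm₁ hk₁ A J b t q e (by rw [← hi, eσ]) et e₁]
      exact comp_congr rfl hi rfl
    rw [v.eval_mk, Category.assoc, Step.act_comp₁ (P.act_one q) rfl (e' := eσ) (hpq := hpq) rfl
      (hz' := by rw [← hpq, hz₁]), Cut.above_right hk' p i q e' z hz hi hm₁ rfl rfl,
      v.eval_mk, ← Category.assoc, v.above_right (_hc := hi) (hb := rfl) (hz₁ := rfl)]

theorem CutEval.eval_below {m k k' : ℕ} (hk' : m + k = k' + 1) (q : P.Op m) (i : Fin m)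
    (p : P.Op k) (e' : P.out p = P.inp q i) (z : P.Op k') (hz : P.comp hk' q i p e' = z)
    (x : Cut X Y p) :
    v.eval (Cut.below hk' q i p e' z hz x) = v.eval x ≫ (Step.below hk' q i p e' z hz).hom := by
  induction x using Cut.ind with
  | @h N M hk A J b e σ h ξ η =>
  obtain ⟨N₁, hn₁⟩ := exists_arity i N
  have ea : P.out A = P.inp q i := (out_cut h).symm.trans e'
  have hk₁ : N₁ + M = k' + 1 := by omega
  have e₁ : P.out b = P.inp (P.comp hn₁ q i A ea) (leafR hn₁ i J) := by
    rw [P.inp_comp_right, e]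
  have eA : P.out (P.comp hk A J b e) = P.inp q i := by rw [P.out_comp, ea]
  have hpq : P.comp hk' q i (P.comp hk A J b e) eA =
      P.comp hk₁ (P.comp hn₁ q i A ea) (leafR hn₁ i J) b e₁ :=
    (P.assoc hn₁ hk₁ hk hk' q i A J b ea e₁ e eA).symm
  have hz₁ : P.act (P.comp hk' q i (P.comp hk A J b e) eA) (s.block hk' i 1 σ) = z := by
    subst hz h
    exact (comp_act_right ..).symm
  rw [Cut.below_mk hk' q i p e' z hz hn₁ rfl rfl rfl, v.eval_mk, v.eval_mk, Category.assoc,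
    Step.act_comp₂ (P.act_one q) (s.perm_one_apply i).symm (e' := eA) (hpq := hpq) rfl
      (hz' := by rw [← hpq, hz₁]), ← Category.assoc,
    v.below (hA := rfl) (hj := rfl) (hz₁ := rfl)]

theorem CutEval.eval_step {a b : Tw P} (t : Step P a b) (x : Cut X Y a.op) :
    v.eval (Cut.step t x) = v.eval x ≫ t.hom := by
  cases t with
  | above => exact v.eval_above ..
  | below => exact v.eval_below ..
  | perm p σ z hz =>
    induction x using Cut.ind with
    | h => exact (Eq.trans (Category.assoc ..) (by rw [Step.act_mul rfl]; rfl)).symm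

/-- An argument in the style of the Yoneda lemma: when `x` evaluates to an identity, the morphism
`f` is recovered from the decorated cut to which it sends `x`. -/
theorem CutEval.eval_map {a b : Tw P} (f : a ⟶ b) (x : Cut X Y a.op) :
    v.eval (Cut.map f x) = v.eval x ≫ f := by
  induction f using hom_induction with
  | id => rw [Category.comp_id, Cut.map_id]
  | step f t ih => rw [Cut.map_comp_step, v.eval_step, ih, Category.assoc]

end Eval

end Tw

end Operad

/-! ### Partial composition as a relation, and the morphisms from the two factors into a composite.
-/

namespace Operad

variable {s : OperadKind} {P : Operad.{u} s}

/-- `p ∘ᵢ q` is defined and equal to `z`. -/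
structure IsComp {n m k : ℕ} (p : P.Op n) (i : Fin n) (q : P.Op m) (z : P.Op k) : Prop where
  -- The arity equation and the colour condition belong to the proposition, so the arity and the
  -- value of a composite remain free variables and iterated composites are compared without
  -- transport.
  hk : n + m = k + 1
  e : P.out q = P.inp p i
  eq : P.comp hk p i q e = z

namespace IsComp

variable {n m l k₁ k₂ k : ℕ}

theorem of_out {p : P.Op n} {i : Fin n} {q : P.Op m} (e : P.out q = P.inp p i) :
    ∃ (k : ℕ) (z : P.Op k), IsComp p i q z := by
  obtain ⟨k, hk⟩ := Tw.exists_arity i m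
  exact ⟨k, _, hk, e, rfl⟩

theorem of_comp (hk : n + m = k + 1) (p : P.Op n) (i : Fin n) (q : P.Op m)
    (e : P.out q = P.inp p i) : IsComp p i q (P.comp hk p i q e) := ⟨hk, e, rfl⟩

theorem out_eq {p : P.Op n} {i : Fin n} {q : P.Op m} {z : P.Op k} (h : IsComp p i q z) :
    P.out z = P.out p := by
  rw [← h.eq, P.out_comp]

theorem inp_left {p : P.Op n} {i : Fin n} {q : P.Op m} {z : P.Op k} (h : IsComp p i q z)
    {a : Fin n} (ha : a ≠ i) {t : Fin k} (ht : t = leafL h.hk i a ha) : P.inp z t = P.inp p a := by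
  subst ht
  obtain ⟨hk, e, rfl⟩ := h
  exact P.inp_comp_left ..

theorem inp_right {p : P.Op n} {i : Fin n} {q : P.Op m} {z : P.Op k} (h : IsComp p i q z)
    {b : Fin m} {t : Fin k} (ht : t = leafR h.hk i b) : P.inp z t = P.inp q b := by
  subst ht
  obtain ⟨hk, e, rfl⟩ := h
  exact P.inp_comp_right ..

theorem unique {p : P.Op n} {i : Fin n} {q : P.Op m} {z z' : P.Op k} (h : IsComp p i q z)
    (h' : IsComp p i q z') : z = z' := h.eq.symm.trans h'.eq

theorem assoc {p : P.Op n} {i : Fin n} {q : P.Op m} {j : Fin m} {r : P.Op l} {pq : P.Op k₁}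
    {qr : P.Op k₂} {t : Fin k₁} {z : P.Op k} (h₁ : IsComp p i q pq) (h₃ : IsComp q j r qr)
    (ht : t = leafR h₁.hk i j) : IsComp pq t r z ↔ IsComp p i qr z := by
  subst ht
  obtain ⟨h₁, e₁, rfl⟩ := h₁
  obtain ⟨h₃, e₃, rfl⟩ := h₃
  constructor
  · rintro ⟨h₂, e₂, rfl⟩
    exact ⟨by omega, by rw [P.out_comp, e₁], (P.assoc ..).symm⟩
  · rintro ⟨h₄, e₄, rfl⟩
    exact ⟨by omega, by rw [P.inp_comp_right, e₃], P.assoc ..⟩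

theorem parallel {p : P.Op n} {i a : Fin n} (ha : a ≠ i) {q : P.Op m} {r : P.Op l} {pq : P.Op k₁}
    {pr : P.Op k₂} {t : Fin k₁} {t' : Fin k₂} {z : P.Op k} (h₁ : IsComp p i q pq)
    (h₃ : IsComp p a r pr) (ht : t = leafL h₁.hk i a ha) (ht' : t' = leafL h₃.hk a i ha.symm)
    (h₂ : IsComp pq t r z) : IsComp pr t' q z := by
  subst ht ht'
  obtain ⟨h₁, e₁, rfl⟩ := h₁
  obtain ⟨h₃, e₃, rfl⟩ := h₃
  obtain ⟨h₂, e₂, rfl⟩ := h₂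
  exact ⟨by omega, by rw [P.inp_comp_left, e₁], (P.parallel ..).symm⟩

theorem act {p : P.Op n} {i i' : Fin n} {q : P.Op m} {z : P.Op k} {σ : s.perms n} {τ : s.perms m}
    {ρ : s.perms k} {pσ : P.Op n} {qτ : P.Op m} {zρ : P.Op k} (h : IsComp p i' q z)
    (hi : i' = σ.1 i) (hσ : P.act p σ = pσ) (hτ : P.act q τ = qτ) (hρ : ρ = s.block h.hk i σ τ)
    (hz : P.act z ρ = zρ) : IsComp pσ i qτ zρ := by
  obtain ⟨hk, e, rfl⟩ := h
  subst hi hσ hτ hρ hz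
  exact ⟨hk, by rw [P.out_act, P.inp_act, e], P.act_comp ..⟩

theorem act_eq {p : P.Op n} {i i' : Fin n} {q : P.Op m} {z : P.Op k} {σ : s.perms n}
    {τ : s.perms m} {ρ : s.perms k} {pσ : P.Op n} {qτ : P.Op m} {zρ : P.Op k}
    (h : IsComp p i' q z) (hi : i' = σ.1 i) (hσ : P.act p σ = pσ) (hτ : P.act q τ = qτ)
    (hρ : ρ = s.block h.hk i σ τ) (h' : IsComp pσ i qτ zρ) : P.act z ρ = zρ :=
  (h.act hi hσ hτ hρ rfl).unique h'

theorem one_right (p : P.Op n) (i : Fin n) {c : P.Colour} (e : c = P.inp p i) :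
    IsComp p i (P.one c) p :=
  ⟨rfl, by rw [P.out_one, e], P.comp_one ..⟩

theorem one_left (p : P.Op n) (i : Fin 1) {c : P.Colour} (e : P.out p = c) :
    IsComp (P.one c) i p p :=
  ⟨Nat.add_comm 1 n, by rw [P.inp_one, e], P.one_comp ..⟩

/-- The morphism `p ⟶ p ∘ᵢ q`. -/
def ab {p : P.Op n} {i : Fin n} {q : P.Op m} {z : P.Op k} (h : IsComp p i q z) :
    (⟨n, p⟩ : Tw P) ⟶ ⟨k, z⟩ := (Tw.Step.above h.hk p i q h.e z h.eq).hom

/-- The morphism `q ⟶ p ∘ᵢ q`. -/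
def be {p : P.Op n} {i : Fin n} {q : P.Op m} {z : P.Op k} (h : IsComp p i q z) :
    (⟨m, q⟩ : Tw P) ⟶ ⟨k, z⟩ := (Tw.Step.below h.hk p i q h.e z h.eq).hom

section Assoc

variable {p : P.Op n} {i : Fin n} {q : P.Op m} {j : Fin m} {r : P.Op l} {pq : P.Op k₁}
    {qr : P.Op k₂} {t : Fin k₁} {z : P.Op k}

theorem ab_ab_right (h₁ : IsComp p i q pq) (h₂ : IsComp pq t r z) (h₃ : IsComp q j r qr)
    (ht : t = leafR h₁.hk i j) (h₄ : IsComp p i qr z) : h₁.ab ≫ h₂.ab = h₄.ab :=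
  Tw.Step.assoc₁ h₃.eq ht

theorem be_ab_right (h₁ : IsComp p i q pq) (h₂ : IsComp pq t r z) (h₃ : IsComp q j r qr)
    (ht : t = leafR h₁.hk i j) (h₄ : IsComp p i qr z) : h₁.be ≫ h₂.ab = h₃.ab ≫ h₄.be :=
  Tw.Step.assoc₂ ht

theorem be_be (h₃ : IsComp q j r qr) (h₄ : IsComp p i qr z) (h₁ : IsComp p i q pq)
    (ht : t = leafR h₁.hk i j) (h₂ : IsComp pq t r z) : h₃.be ≫ h₄.be = h₂.be :=
  (Tw.Step.assoc₃ h₁.eq ht).symm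

end Assoc

section Parallel

variable {p : P.Op n} {i a : Fin n} {q : P.Op m} {r : P.Op l} {pq : P.Op k₁}
    {pr : P.Op k₂} {t : Fin k₁} {t' : Fin k₂} {z : P.Op k}

theorem ab_ab_left (h₁ : IsComp p i q pq) (h₂ : IsComp pq t r z) (ha : a ≠ i)
    (ht : t = leafL h₁.hk i a ha) (h₃ : IsComp p a r pr) (h₄ : IsComp pr t' q z)
    (ht' : t' = leafL h₃.hk a i ha.symm) : h₁.ab ≫ h₂.ab = h₃.ab ≫ h₄.ab :=
  Tw.Step.parallel₁ ha ht ht'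

theorem be_ab_left (h₁ : IsComp p i q pq) (h₂ : IsComp pq t r z) (ha : a ≠ i)
    (ht : t = leafL h₁.hk i a ha) (h₃ : IsComp p a r pr) (h₄ : IsComp pr t' q z)
    (ht' : t' = leafL h₃.hk a i ha.symm) : h₁.be ≫ h₂.ab = h₄.be :=
  Tw.Step.parallel₂ ha h₃.eq ht ht'

end Parallel

theorem ab_one {p : P.Op n} {i : Fin n} {c : P.Colour} (h : IsComp p i (P.one c) p) :
    h.ab = 𝟙 _ := Tw.Step.comp_one

theorem be_one {p : P.Op n} {i : Fin 1} {c : P.Colour} (h : IsComp (P.one c) i p p) :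
    h.be = 𝟙 _ := by
  have hk : 1 + n = n + 1 := h.hk
  exact Tw.Step.one_comp

end IsComp

namespace Tw

/-- The morphism `p ⟶ p^σ`. -/
def permHom {n : ℕ} {p : P.Op n} (σ : s.perms n) {z : P.Op n} (h : P.act p σ = z) :
    (⟨n, p⟩ : Tw P) ⟶ ⟨n, z⟩ := (Step.perm p σ z h).hom

section Perm

variable {n m k : ℕ} {p : P.Op n} {i i' : Fin n} {q : P.Op m} {z : P.Op k} {σ σ' : s.perms n}
  {τ : s.perms m} {ρ : s.perms k} {pσ : P.Op n} {qτ : P.Op m} {zρ : P.Op k}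

theorem permHom_permHom (h : P.act p σ = pσ) {z : P.Op n} (h' : P.act pσ σ' = z)
    {ρ : s.perms n} (hρ : ρ = σ * σ') (h'' : P.act p ρ = z) :
    permHom σ h ≫ permHom σ' h' = permHom ρ h'' := Step.act_mul hρ

theorem permHom_one (h : P.act p 1 = p) : permHom 1 h = 𝟙 _ := Step.act_one

theorem permHom_ab (hσ : P.act p σ = pσ) (hτ : P.act q τ = qτ) (hi : i' = σ.1 i)
    (h : IsComp p i' q z) (h' : IsComp pσ i qτ zρ) (hρ : ρ = s.block h.hk i σ τ)
    (hz : P.act z ρ = zρ) : permHom σ hσ ≫ h'.ab = h.ab ≫ permHom ρ hz :=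
  Step.act_comp₁ hτ hi hρ

theorem permHom_be (hσ : P.act p σ = pσ) (hτ : P.act q τ = qτ) (hi : i' = σ.1 i)
    (h : IsComp p i' q z) (h' : IsComp pσ i qτ zρ) (hρ : ρ = s.block h.hk i σ τ)
    (hz : P.act z ρ = zρ) : permHom τ hτ ≫ h'.be = h.be ≫ permHom ρ hz :=
  Step.act_comp₂ hσ hi hρ

end Perm

/-! ## The pointed module of morphisms -/

/-- A morphism from `p₀` to `A` that keeps the input `i₀` of `p₀`, turning it into the input `j` of
`A`: it can be extended to the operations obtained from `p₀` and `A` by grafting the same operation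
onto these inputs. -/
structure PointedHom {n₀ : ℕ} (p₀ : P.Op n₀) (i₀ : Fin n₀) {n : ℕ} (A : P.Op n) (j : Fin n) :
    Type u where
  col : P.inp A j = P.inp p₀ i₀
  low : (⟨n₀, p₀⟩ : Tw P) ⟶ ⟨n, A⟩
  -- The extensions to `p₀ ∘ b ⟶ A ∘ⱼ b` are recorded as data and carried along each step. By the
  -- pushout property they are determined by `low`, but that property is what this construction
  -- serves to prove.
  app : ∀ {m k k' : ℕ} (b : P.Op m) {z : P.Op k} {z' : P.Op k'} (_ : IsComp p₀ i₀ b z)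
    (_ : IsComp A j b z'), (⟨k, z⟩ : Tw P) ⟶ ⟨k', z'⟩
  ab_app : ∀ {m k k' : ℕ} {b : P.Op m} {z : P.Op k} {z' : P.Op k'} (h : IsComp p₀ i₀ b z)
    (h' : IsComp A j b z'), h.ab ≫ app b h h' = low ≫ h'.ab
  be_app : ∀ {m k k' : ℕ} {b : P.Op m} {z : P.Op k} {z' : P.Op k'} (h : IsComp p₀ i₀ b z)
    (h' : IsComp A j b z'), h.be ≫ app b h h' = h'.be
  -- This condition and the next express naturality of the extension in `b`. They are used when a
  -- glued morphism is followed by a graft onto `b` or a permutation of its inputs.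
  app_ab : ∀ {m l m' k k' k₁ k₁' : ℕ} {b : P.Op m} {t : Fin m} {r : P.Op l} {b' : P.Op m'}
    {z : P.Op k} {z' : P.Op k'} {w : P.Op k₁} {w' : P.Op k₁'} (_ : IsComp b t r b')
    (h : IsComp p₀ i₀ b z) (h' : IsComp A j b z') (hw : IsComp p₀ i₀ b' w) (hw' : IsComp A j b' w')
    {c : Fin k} {c' : Fin k'} (_ : c = leafR h.hk i₀ t) (_ : c' = leafR h'.hk j t)
    (g : IsComp z c r w) (g' : IsComp z' c' r w'), app b h h' ≫ g'.ab = g.ab ≫ app b' hw hw'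
  app_perm : ∀ {m k k' : ℕ} {b : P.Op m} {ρ : s.perms m} {b' : P.Op m} {z w : P.Op k}
    {z' w' : P.Op k'} (_ : P.act b ρ = b') (h : IsComp p₀ i₀ b z) (h' : IsComp A j b z')
    (hw : IsComp p₀ i₀ b' w) (hw' : IsComp A j b' w') (g : P.act z (s.block h.hk i₀ 1 ρ) = w)
    (g' : P.act z' (s.block h'.hk j 1 ρ) = w'),
    app b h h' ≫ permHom _ g' = permHom _ g ≫ app b' hw hw'

namespace PointedHom

variable {n₀ : ℕ} {p₀ : P.Op n₀} {i₀ : Fin n₀}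

theorem hext {n : ℕ} {A : P.Op n} {j : Fin n} {x y : PointedHom p₀ i₀ A j} (h : x.low = y.low)
    (H : ∀ {m k k' : ℕ} (b : P.Op m) {z : P.Op k} {z' : P.Op k'} (h : IsComp p₀ i₀ b z)
      (h' : IsComp A j b z'), x.app b h h' = y.app b h h') : x = y := by
  cases x
  cases y
  congr
  funext m k k' b z z' h h'
  apply H

section Above

variable {n m k : ℕ} {p : P.Op n} {i : Fin n} {q : P.Op m} {z : P.Op k} (h : IsComp p i q z)
  {t : Fin n} (ht : t ≠ i) {t' : Fin k} (ht' : t' = leafL h.hk i t ht)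

/-- The extensions of a composite with a step `E ↦ E ∘ᵢ q`. -/
def aboveApp (x : PointedHom p₀ i₀ p t) {m' k₀ k' : ℕ} (b : P.Op m') {zb : P.Op k₀}
    {zb' : P.Op k'} (hb : IsComp p₀ i₀ b zb) (hb' : IsComp z t' b zb') :
    (⟨k₀, zb⟩ : Tw P) ⟶ ⟨k', zb'⟩ :=
  have hw : IsComp p t b (P.comp (k := n + m' - 1) (by have := t.isLt; omega) p t b
    (hb'.e.trans (h.inp_left ht ht'))) := .of_comp ..
  x.app b hb hw ≫ (h.parallel ht hw ht' rfl hb').ab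

theorem aboveApp_eq (x : PointedHom p₀ i₀ p t) {m' k₀ k' k₁ : ℕ} {b : P.Op m'} {zb : P.Op k₀}
    {zb' : P.Op k'} {w : P.Op k₁} (hb : IsComp p₀ i₀ b zb) (hw : IsComp p t b w)
    (hb' : IsComp z t' b zb') {c : Fin k₁} (hc : c = leafL hw.hk t i ht.symm)
    (g : IsComp w c q zb') : aboveApp h ht ht' x b hb hb' = x.app b hb hw ≫ g.ab := by
  subst hc
  obtain ⟨hk, e, rfl⟩ := hw
  obtain rfl : k₁ = n + m' - 1 := by omega
  rfl

/-- Since `b` sits on an input of `p` other than `i`, the parallel axiom rewrites `(p ∘ᵢ q) ∘ b` as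
`(p ∘ₜ b) ∘ q`. Hence the extension of a graft is again a graft. -/
theorem exists_above (h : IsComp p i q z) (ht : t ≠ i) (ht' : t' = leafL h.hk i t ht)
    {m' k' : ℕ} {b : P.Op m'} {zb' : P.Op k'} (hb' : IsComp z t' b zb') :
    ∃ (k₁ : ℕ) (w : P.Op k₁) (hw : IsComp p t b w),
      IsComp w (leafL hw.hk t i ht.symm) q zb' := by
  obtain ⟨k₁, w, hw⟩ := IsComp.of_out (hb'.e.trans (h.inp_left ht ht'))
  exact ⟨k₁, w, hw, h.parallel ht hw ht' rfl hb'⟩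

/-- The composite with a step `E ↦ E ∘ᵢ q`. -/
def above (x : PointedHom p₀ i₀ p t) : PointedHom p₀ i₀ z t' where
  col := (h.inp_left ht ht').trans x.col
  low := x.low ≫ h.ab
  app b _ _ hb hb' := aboveApp h ht ht' x b hb hb'
  ab_app {_ _ _ b _ _} hb hb' := by
    obtain ⟨_, w, hw, g⟩ := exists_above h ht ht' hb'
    rw [aboveApp_eq h ht ht' x hb hw hb' rfl g, ← Category.assoc, x.ab_app, Category.assoc,
      Category.assoc, hw.ab_ab_left g ht.symm rfl h hb' ht']
  be_app {_ _ _ b _ _} hb hb' := by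
    obtain ⟨_, w, hw, g⟩ := exists_above h ht ht' hb'
    rw [aboveApp_eq h ht ht' x hb hw hb' rfl g, ← Category.assoc, x.be_app,
      hw.be_ab_left g ht.symm rfl h hb' ht']
  app_ab {_ _ _ _ _ _ _ b tt r b' z₁ z₁' v v'} hbr hb hb' hv hv' c c' hc hc' g g' := by
    obtain ⟨_, w, hw, gw⟩ := exists_above h ht ht' hb'
    obtain ⟨_, w', hw', gw'⟩ := exists_above h ht ht' hv'
    have hu := (hw.assoc hbr rfl).2 hw'
    rw [aboveApp_eq h ht ht' x hb hw hb' rfl gw, aboveApp_eq h ht ht' x hv hw' hv' rfl gw',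
      Category.assoc, ← Category.assoc g.ab, ← x.app_ab hbr hb hw hv hw' hc rfl g hu,
      Category.assoc, gw.ab_ab_left g' (leafL_ne_leafR hw.hk t ht.symm tt).symm ?_ hu gw' ?_]
    · subst hc' ht'
      exact leafR_leafL ..
    · exact (leafL_leafR_leafL ..).symm
  app_perm {_ _ _ b ρ b' z₁ w₁ z₁' w₁'} hρ hb hb' hv hv' g g' := by
    obtain ⟨_, w, hw, gw⟩ := exists_above h ht ht' hb'
    obtain ⟨_, w', hw', gw'⟩ := exists_above h ht ht' hv'
    obtain rfl := Nat.succ.inj (hw.hk.symm.trans hw'.hk)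
    have hww := hw.act_eq rfl (P.act_one p) hρ rfl hw'
    rw [aboveApp_eq h ht ht' x hb hw hb' rfl gw, aboveApp_eq h ht ht' x hv hw' hv' rfl gw',
      Category.assoc, ← permHom_ab hww (P.act_one q) ?_ gw gw' ?_ g', ← Category.assoc,
      x.app_perm hρ hb hw hv hw' g hww, Category.assoc]
    · exact (s.block_leafL_eq hw.hk (σ := 1) ρ ht.symm rfl rfl ht.symm).symm
    · subst ht'
      rw [s.block_parallel hw.hk gw.hk h.hk hb'.hk t i ht.symm ht 1 ρ 1, s.block_one]

end Above

section Below

variable {n m k : ℕ} {q : P.Op n} {i : Fin n} {p : P.Op m} {z : P.Op k} (h : IsComp q i p z)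
  {t : Fin m} {t' : Fin k} (ht' : t' = leafR h.hk i t)

/-- The extensions of a composite with a step `E ↦ q ∘ᵢ E`. -/
def belowApp (x : PointedHom p₀ i₀ p t) {m' k₀ k' : ℕ} (b : P.Op m') {zb : P.Op k₀}
    {zb' : P.Op k'} (hb : IsComp p₀ i₀ b zb) (hb' : IsComp z t' b zb') :
    (⟨k₀, zb⟩ : Tw P) ⟶ ⟨k', zb'⟩ :=
  have hw : IsComp p t b (P.comp (k := m + m' - 1) (by have := t.isLt; omega) p t b
    (hb'.e.trans (h.inp_right ht'))) := .of_comp ..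
  x.app b hb hw ≫ ((h.assoc hw ht').1 hb').be

theorem belowApp_eq (x : PointedHom p₀ i₀ p t) {m' k₀ k' k₁ : ℕ} {b : P.Op m'} {zb : P.Op k₀}
    {zb' : P.Op k'} {w : P.Op k₁} (hb : IsComp p₀ i₀ b zb) (hw : IsComp p t b w)
    (hb' : IsComp z t' b zb') (g : IsComp q i w zb') :
    belowApp h ht' x b hb hb' = x.app b hb hw ≫ g.be := by
  obtain ⟨hk, e, rfl⟩ := hw
  obtain rfl : k₁ = m + m' - 1 := by omega
  rfl

theorem exists_below (h : IsComp q i p z) (ht' : t' = leafR h.hk i t)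
    {m' k' : ℕ} {b : P.Op m'} {zb' : P.Op k'} (hb' : IsComp z t' b zb') :
    ∃ (k₁ : ℕ) (w : P.Op k₁) (_ : IsComp p t b w), IsComp q i w zb' := by
  obtain ⟨k₁, w, hw⟩ := IsComp.of_out (hb'.e.trans (h.inp_right ht'))
  exact ⟨k₁, w, hw, (h.assoc hw ht').1 hb'⟩

/-- The composite with a step `E ↦ q ∘ᵢ E`. -/
def below (x : PointedHom p₀ i₀ p t) : PointedHom p₀ i₀ z t' where
  col := (h.inp_right ht').trans x.col
  low := x.low ≫ h.be
  app b _ _ hb hb' := belowApp h ht' x b hb hb'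
  ab_app {_ _ _ b _ _} hb hb' := by
    obtain ⟨_, w, hw, g⟩ := exists_below h ht' hb'
    rw [belowApp_eq h ht' x hb hw hb' g, ← Category.assoc, x.ab_app, Category.assoc,
      Category.assoc, h.be_ab_right hb' hw ht' g]
  be_app {_ _ _ b _ _} hb hb' := by
    obtain ⟨_, w, hw, g⟩ := exists_below h ht' hb'
    rw [belowApp_eq h ht' x hb hw hb' g, ← Category.assoc, x.be_app, hw.be_be g h ht' hb']
  app_ab {_ _ _ _ _ _ _ b tt r b' z₁ z₁' v v'} hbr hb hb' hv hv' c c' hc hc' g g' := by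
    obtain ⟨_, w, hw, gw⟩ := exists_below h ht' hb'
    obtain ⟨_, w', hw', gw'⟩ := exists_below h ht' hv'
    have hu := (hw.assoc hbr rfl).2 hw'
    rw [belowApp_eq h ht' x hb hw hb' gw, belowApp_eq h ht' x hv hw' hv' gw',
      Category.assoc, ← Category.assoc g.ab, ← x.app_ab hbr hb hw hv hw' hc rfl g hu,
      Category.assoc, gw.be_ab_right g' hu ?_ gw']
    subst hc' ht'
    exact leafR_leafR ..
  app_perm {_ _ _ b ρ b' z₁ w₁ z₁' w₁'} hρ hb hb' hv hv' g g' := by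
    obtain ⟨_, w, hw, gw⟩ := exists_below h ht' hb'
    obtain ⟨_, w', hw', gw'⟩ := exists_below h ht' hv'
    obtain rfl := Nat.succ.inj (hw.hk.symm.trans hw'.hk)
    have hww := hw.act_eq rfl (P.act_one p) hρ rfl hw'
    rw [belowApp_eq h ht' x hb hw hb' gw, belowApp_eq h ht' x hv hw' hv' gw',
      Category.assoc, ← permHom_be (i' := i) (P.act_one q) hww rfl gw gw' ?_ g', ← Category.assoc,
      x.app_perm hρ hb hw hv hw' g hww, Category.assoc]
    subst ht'
    rw [← s.block_assoc h.hk hb'.hk hw.hk gw.hk i t 1 1 ρ, s.block_one]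

end Below

section Perm

variable {n : ℕ} {p : P.Op n} {σ : s.perms n} {z : P.Op n} (hz : P.act p σ = z) {t t' : Fin n}
  (ht : t = σ.1 t')

/-- The extensions of a composite with a step `E ↦ E^σ`. -/
noncomputable def permApp (x : PointedHom p₀ i₀ p t) {m' k₀ k' : ℕ} (b : P.Op m') {zb : P.Op k₀}
    {zb' : P.Op k'} (hb : IsComp p₀ i₀ b zb) (hb' : IsComp z t' b zb') :
    (⟨k₀, zb⟩ : Tw P) ⟶ ⟨k', zb'⟩ :=
  have hw : IsComp p t b (P.comp hb'.hk p t b (hb'.e.trans (by rw [← hz, P.inp_act, ht]))) :=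
    .of_comp ..
  x.app b hb hw ≫ permHom _ (hw.act_eq ht hz (P.act_one b) rfl hb')

theorem permApp_eq (x : PointedHom p₀ i₀ p t) {m' k₀ k' : ℕ} {b : P.Op m'} {zb : P.Op k₀}
    {zb' : P.Op k'} {w : P.Op k'} (hb : IsComp p₀ i₀ b zb) (hw : IsComp p t b w)
    (hb' : IsComp z t' b zb') {ρ : s.perms k'} (hρ : ρ = s.block hw.hk t' σ 1)
    (g : P.act w ρ = zb') :
    permApp hz ht x b hb hb' = x.app b hb hw ≫ permHom ρ g := by
  subst hρ
  obtain ⟨hk, e, rfl⟩ := hw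
  rfl

theorem exists_perm (hz : P.act p σ = z) (ht : t = σ.1 t') {m' k' : ℕ} {b : P.Op m'}
    {zb' : P.Op k'} (hb' : IsComp z t' b zb') :
    ∃ (w : P.Op k') (hw : IsComp p t b w), P.act w (s.block hw.hk t' σ 1) = zb' := by
  have hw := IsComp.of_comp hb'.hk p t b (hb'.e.trans (by rw [← hz, P.inp_act, ht]))
  exact ⟨_, hw, hw.act_eq ht hz (P.act_one b) rfl hb'⟩

/-- The composite with a step `E ↦ E^σ`. -/
noncomputable def perm (x : PointedHom p₀ i₀ p t) : PointedHom p₀ i₀ z t' where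
  col := by rw [← hz, P.inp_act, ← ht, x.col]
  low := x.low ≫ permHom σ hz
  app b _ _ hb hb' := permApp hz ht x b hb hb'
  ab_app {_ _ _ b _ _} hb hb' := by
    obtain ⟨w, hw, g⟩ := exists_perm hz ht hb'
    rw [permApp_eq hz ht x hb hw hb' rfl g, ← Category.assoc, x.ab_app, Category.assoc,
      Category.assoc, permHom_ab hz (P.act_one b) ht hw hb' rfl g]
  be_app {_ _ _ b _ _} hb hb' := by
    obtain ⟨w, hw, g⟩ := exists_perm hz ht hb'
    rw [permApp_eq hz ht x hb hw hb' rfl g, ← Category.assoc, x.be_app,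
      ← permHom_be hz (P.act_one b) ht hw hb' rfl g, permHom_one, Category.id_comp]
  app_ab {_ _ _ _ _ _ _ b tt r b' z₁ z₁' v v'} hbr hb hb' hv hv' c c' hc hc' g g' := by
    obtain ⟨w, hw, gw⟩ := exists_perm hz ht hb'
    obtain ⟨w', hw', gw'⟩ := exists_perm hz ht hv'
    have hu := (hw.assoc hbr rfl).2 hw'
    have hcc : leafR hw.hk t tt = (s.block hw.hk t' σ 1).1 c' := by
      subst hc'
      exact (s.block_leafR_eq hw.hk (τ := 1) (b' := tt) ht.symm rfl).symm
    have hρ : s.block hw'.hk t' σ 1 = s.block hu.hk c' (s.block hw.hk t' σ 1) 1 := by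
      subst hc'
      rw [s.block_assoc hw.hk hu.hk hbr.hk hw'.hk, s.block_one]
    rw [permApp_eq hz ht x hb hw hb' rfl gw, permApp_eq hz ht x hv hw' hv' rfl gw',
      Category.assoc, ← Category.assoc g.ab, ← x.app_ab hbr hb hw hv hw' hc rfl g hu,
      Category.assoc, permHom_ab gw (P.act_one r) hcc hu g' hρ gw']
  app_perm {_ _ _ b ρ b' z₁ w₁ z₁' w₁'} hρ hb hb' hv hv' g g' := by
    obtain ⟨w, hw, gw⟩ := exists_perm hz ht hb'
    obtain ⟨w', hw', gw'⟩ := exists_perm hz ht hv'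
    have hww := hw.act_eq rfl (P.act_one p) hρ rfl hw'
    have e1 : s.block hw.hk t' σ ρ = s.block hw.hk t' σ 1 * s.block hw.hk t' 1 ρ := by
      have := s.block_mul hw.hk t' σ 1 1 ρ
      rwa [mul_one, one_mul] at this
    have e2 : s.block hw.hk t' σ ρ = s.block hw.hk t 1 ρ * s.block hw.hk t' σ 1 := by
      subst ht
      rw [← s.block_mul, one_mul, mul_one]
    have e3 : P.act w (s.block hw.hk t' σ ρ) = w₁' := by rw [e1, P.act_mul, gw, g']
    rw [permApp_eq hz ht x hb hw hb' rfl gw, permApp_eq hz ht x hv hw' hv' rfl gw',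
      Category.assoc, permHom_permHom gw g' e1 e3, ← Category.assoc,
      ← x.app_perm hρ hb hw hv hw' g hww, Category.assoc, permHom_permHom hww gw' e2 e3]

end Perm

end PointedHom

end Tw

end Operad

namespace Operad

variable {s : OperadKind} {P : Operad.{u} s}

namespace Tw

namespace PointedHom

variable {n₀ : ℕ} {p₀ : P.Op n₀} {i₀ : Fin n₀}

section Apply

variable {n m k : ℕ}

theorem above_app {p : P.Op n} {i : Fin n} {q : P.Op m} {z : P.Op k} (h : IsComp p i q z)
    {t : Fin n} (ht : t ≠ i) {t' : Fin k} (ht' : t' = leafL h.hk i t ht)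
    (x : PointedHom p₀ i₀ p t) {m' k₀ k' k₁ : ℕ} {b : P.Op m'} {zb : P.Op k₀}
    {zb' : P.Op k'} {w : P.Op k₁} (hb : IsComp p₀ i₀ b zb) (hw : IsComp p t b w)
    (hb' : IsComp z t' b zb') {c : Fin k₁} (hc : c = leafL hw.hk t i ht.symm)
    (g : IsComp w c q zb') : (x.above h ht ht').app b hb hb' = x.app b hb hw ≫ g.ab :=
  aboveApp_eq h ht ht' x hb hw hb' hc g

theorem below_app {q : P.Op n} {i : Fin n} {p : P.Op m} {z : P.Op k} (h : IsComp q i p z)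
    {t : Fin m} {t' : Fin k} (ht' : t' = leafR h.hk i t)
    (x : PointedHom p₀ i₀ p t) {m' k₀ k' k₁ : ℕ} {b : P.Op m'} {zb : P.Op k₀}
    {zb' : P.Op k'} {w : P.Op k₁} (hb : IsComp p₀ i₀ b zb) (hw : IsComp p t b w)
    (hb' : IsComp z t' b zb') (g : IsComp q i w zb') :
    (x.below h ht').app b hb hb' = x.app b hb hw ≫ g.be :=
  belowApp_eq h ht' x hb hw hb' g

theorem perm_app {p : P.Op n} {σ : s.perms n} {z : P.Op n} (hz : P.act p σ = z) {t t' : Fin n}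
    (ht : t = σ.1 t') (x : PointedHom p₀ i₀ p t) {m' k₀ k' : ℕ} {b : P.Op m'} {zb : P.Op k₀}
    {zb' : P.Op k'} {w : P.Op k'} (hb : IsComp p₀ i₀ b zb) (hw : IsComp p t b w)
    (hb' : IsComp z t' b zb') {ρ : s.perms k'} (hρ : ρ = s.block hw.hk t' σ 1)
    (g : P.act w ρ = zb') :
    (x.perm hz ht).app b hb hb' = x.app b hb hw ≫ permHom ρ g :=
  permApp_eq hz ht x hb hw hb' hρ g

end Apply

section Assoc

variable {n m l k₁ k₂ k : ℕ} {p : P.Op n} {i : Fin n} {q : P.Op m} {j : Fin m} {r : P.Op l}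
  {pq : P.Op k₁} {qr : P.Op k₂} {c : Fin k₁} {z : P.Op k}
  (h₁ : IsComp p i q pq) (h₂ : IsComp pq c r z) (h₃ : IsComp q j r qr) (h₄ : IsComp p i qr z)

/-- The module axioms for `PointedHom` are proved twice over by the same relation of `Tw P`: once
for `low`, and once for the extensions, where each operation carrying the distinguished input has
`b` grafted onto it. -/
theorem above_above_right (hc : c = leafR h₁.hk i j) (h₃ : IsComp q j r qr) {t : Fin n}
    (ht : t ≠ i) {t₁ : Fin k₁} (ht₁ : t₁ = leafL h₁.hk i t ht) (ht₁' : t₁ ≠ c) {t₂ : Fin k}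
    (ht₂ : t₂ = leafL h₂.hk c t₁ ht₁') (ht₂' : t₂ = leafL h₄.hk i t ht)
    (x : PointedHom p₀ i₀ p t) : (x.above h₁ ht ht₁).above h₂ ht₁' ht₂ = x.above h₄ ht ht₂' := by
  refine hext ?_ (fun b z z' hb hb' => ?_)
  · exact (Category.assoc ..).trans (congrArg (x.low ≫ ·) (h₁.ab_ab_right h₂ h₃ hc h₄))
  · obtain ⟨_, w, hw, g⟩ := exists_above h₂ ht₁' ht₂ hb'
    obtain ⟨_, w', hw', g'⟩ := exists_above h₁ ht ht₁ hw
    have pos : leafL hw.hk t₁ c ht₁'.symm = leafR g'.hk (leafL hw'.hk t i ht.symm) j := by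
      subst ht₁ hc
      exact (leafR_leafL ..).symm
    have g4 := (g'.assoc h₃ pos).1 g
    rw [above_app h₂ ht₁' ht₂ _ hb hw hb' rfl g, above_app h₁ ht ht₁ _ hb hw' hw rfl g',
      above_app h₄ ht ht₂' _ hb hw' hb' rfl g4, Category.assoc, g'.ab_ab_right g h₃ pos g4]

theorem below_above_right (hc : c = leafR h₁.hk i j) {t : Fin m} (ht : t ≠ j)
    {t₁ : Fin k₁} (ht₁ : t₁ = leafR h₁.hk i t) (ht₁' : t₁ ≠ c) {t₂ : Fin k₂}
    (ht₂ : t₂ = leafL h₃.hk j t ht) {t₃ : Fin k} (ht₃ : t₃ = leafL h₂.hk c t₁ ht₁')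
    (ht₃' : t₃ = leafR h₄.hk i t₂) (x : PointedHom p₀ i₀ q t) :
    (x.below h₁ ht₁).above h₂ ht₁' ht₃ = (x.above h₃ ht ht₂).below h₄ ht₃' := by
  refine hext ?_ (fun b z z' hb hb' => ?_)
  · exact (Category.assoc ..).trans ((congrArg (x.low ≫ ·) (h₁.be_ab_right h₂ h₃ hc h₄)).trans
      (Category.assoc ..).symm)
  · obtain ⟨_, w, hw, g⟩ := exists_above h₂ ht₁' ht₃ hb'
    obtain ⟨_, w', hw', g'⟩ := exists_below h₁ ht₁ hw
    obtain ⟨_, v, hv, gv⟩ := exists_below h₄ ht₃' hb'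
    have kv := h₃.parallel ht hw' ht₂ rfl hv
    rw [above_app h₂ ht₁' ht₃ _ hb hw hb' rfl g, below_app h₁ ht₁ _ hb hw' hw g',
      below_app h₄ ht₃' _ hb hv hb' gv, above_app h₃ ht ht₂ _ hb hw' hv rfl kv, Category.assoc,
      Category.assoc, g'.be_ab_right g kv ?_ gv]
    subst ht₁ hc
    exact leafL_leafR_leafR ..

theorem below_eq (hc : c = leafR h₁.hk i j) {t : Fin l} {t₁ : Fin k₂}
    (ht₁ : t₁ = leafR h₃.hk j t) {t₂ : Fin k} (ht₂ : t₂ = leafR h₂.hk c t)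
    (ht₂' : t₂ = leafR h₄.hk i t₁) (x : PointedHom p₀ i₀ r t) :
    x.below h₂ ht₂ = (x.below h₃ ht₁).below h₄ ht₂' := by
  refine hext ?_ (fun b z z' hb hb' => ?_)
  · exact (congrArg (x.low ≫ ·) (h₃.be_be h₄ h₁ hc h₂).symm).trans (Category.assoc ..).symm
  · obtain ⟨_, v, hv, gv⟩ := exists_below h₄ ht₂' hb'
    obtain ⟨_, w, hw, g⟩ := exists_below h₃ ht₁ hv
    have g2 := (h₁.assoc g hc).2 gv
    rw [below_app h₂ ht₂ _ hb hw hb' g2, below_app h₄ ht₂' _ hb hv hb' gv,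
      below_app h₃ ht₁ _ hb hw hv g, Category.assoc, g.be_be gv h₁ hc g2]

end Assoc

section Parallel

variable {n m l k₁ k₂ k : ℕ} {p : P.Op n} {i a : Fin n} {q : P.Op m} {r : P.Op l} {pq : P.Op k₁}
  {pr : P.Op k₂} {c : Fin k₁} {c' : Fin k₂} {z : P.Op k} (ha : a ≠ i) (h₁ : IsComp p i q pq)
  (hc : c = leafL h₁.hk i a ha) (h₂ : IsComp pq c r z) (h₃ : IsComp p a r pr)
  (hc' : c' = leafL h₃.hk a i ha.symm) (h₄ : IsComp pr c' q z)

theorem above_above_left (hc : c = leafL h₁.hk i a ha) (hc' : c' = leafL h₃.hk a i ha.symm)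
    {t : Fin n} (ht : t ≠ i) (ht' : t ≠ a) {t₁ : Fin k₁}
    (ht₁ : t₁ = leafL h₁.hk i t ht) (ht₁' : t₁ ≠ c) {t₂ : Fin k₂}
    (ht₂ : t₂ = leafL h₃.hk a t ht') (ht₂' : t₂ ≠ c') {t₃ : Fin k}
    (ht₃ : t₃ = leafL h₂.hk c t₁ ht₁') (ht₃' : t₃ = leafL h₄.hk c' t₂ ht₂')
    (x : PointedHom p₀ i₀ p t) :
    (x.above h₁ ht ht₁).above h₂ ht₁' ht₃ = (x.above h₃ ht' ht₂).above h₄ ht₂' ht₃' := by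
  refine hext ?_ (fun b z z' hb hb' => ?_)
  · exact (Category.assoc ..).trans ((congrArg (x.low ≫ ·) (h₁.ab_ab_left h₂ ha hc h₃ h₄ hc')).trans
      (Category.assoc ..).symm)
  · obtain ⟨_, w, hw, g⟩ := exists_above h₂ ht₁' ht₃ hb'
    obtain ⟨_, w', hw', g'⟩ := exists_above h₁ ht ht₁ hw
    obtain ⟨_, v, hv, gv⟩ := exists_above h₄ ht₂' ht₃' hb'
    have kv := h₃.parallel ht' hw' ht₂ rfl hv
    rw [above_app h₂ ht₁' ht₃ _ hb hw hb' rfl g, above_app h₁ ht ht₁ _ hb hw' hw rfl g',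
      above_app h₄ ht₂' ht₃' _ hb hv hb' rfl gv, above_app h₃ ht' ht₂ _ hb hw' hv rfl kv,
      Category.assoc, Category.assoc, g'.ab_ab_left g (leafL_ne_leafL _ _ _ _ ha) ?_ kv gv ?_]
    · subst ht₁ hc
      exact leafL_leafL_leafL ..
    · subst ht₂ hc'
      exact leafL_leafL_leafL ..

theorem below_above_left (hc : c = leafL h₁.hk i a ha) (h₃ : IsComp p a r pr)
    (hc' : c' = leafL h₃.hk a i ha.symm) {t : Fin m} {t₁ : Fin k₁}
    (ht₁ : t₁ = leafR h₁.hk i t) (ht₁' : t₁ ≠ c) {t₂ : Fin k} (ht₂ : t₂ = leafL h₂.hk c t₁ ht₁')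
    (ht₂' : t₂ = leafR h₄.hk c' t) (x : PointedHom p₀ i₀ q t) :
    (x.below h₁ ht₁).above h₂ ht₁' ht₂ = x.below h₄ ht₂' := by
  refine hext ?_ (fun b z z' hb hb' => ?_)
  · exact (Category.assoc ..).trans (congrArg (x.low ≫ ·) (h₁.be_ab_left h₂ ha hc h₃ h₄ hc'))
  · obtain ⟨_, w, hw, g⟩ := exists_above h₂ ht₁' ht₂ hb'
    obtain ⟨_, w', hw', g'⟩ := exists_below h₁ ht₁ hw
    have g4 := (h₄.assoc hw' ht₂').1 hb'
    rw [above_app h₂ ht₁' ht₂ _ hb hw hb' rfl g, below_app h₁ ht₁ _ hb hw' hw g',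
      below_app h₄ ht₂' _ hb hw' hb' g4, Category.assoc, g'.be_ab_left g ha ?_ h₃ g4 hc']
    subst ht₁ hc
    exact leafL_leafR_leafL ..

end Parallel

section Unit

variable {n : ℕ} {p : P.Op n} {c : P.Colour}

theorem above_one {i : Fin n} (h : IsComp p i (P.one c) p) {t : Fin n} (ht : t ≠ i)
    (ht' : t = leafL h.hk i t ht) (x : PointedHom p₀ i₀ p t) : x.above h ht ht' = x := by
  refine hext ?_ (fun b z z' hb hb' => ?_)
  · exact (congrArg (x.low ≫ ·) h.ab_one).trans (Category.comp_id _)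
  · have g := h.parallel ht hb' ht' rfl hb'
    rw [above_app h ht ht' _ hb hb' hb' rfl g, g.ab_one, Category.comp_id]

theorem below_one {i : Fin 1} (h : IsComp (P.one c) i p p) {t : Fin n}
    (ht : t = leafR h.hk i t) (x : PointedHom p₀ i₀ p t) : x.below h ht = x := by
  refine hext ?_ (fun b z z' hb hb' => ?_)
  · exact (congrArg (x.low ≫ ·) h.be_one).trans (Category.comp_id _)
  · have g := (h.assoc hb' ht).1 hb'
    rw [below_app h ht _ hb hb' hb' g, g.be_one, Category.comp_id]

theorem perm_one (h : P.act p 1 = p) {t : Fin n} (ht : t = (1 : s.perms n).1 t)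
    (x : PointedHom p₀ i₀ p t) : x.perm h ht = x := by
  refine hext ?_ (fun b z z' hb hb' => ?_)
  · exact (congrArg (x.low ≫ ·) (permHom_one h)).trans (Category.comp_id _)
  · rw [perm_app h ht _ hb hb' hb' (s.block_one _ _).symm (P.act_one z'), permHom_one,
      Category.comp_id]

end Unit

section Perm

theorem perm_mul {n : ℕ} {p : P.Op n} {σ τ : s.perms n} {pσ z : P.Op n} (hσ : P.act p σ = pσ)
    (hz : P.act p (σ * τ) = z) (hz' : P.act pσ τ = z) {t t' t'' : Fin n} (ht : t = σ.1 t')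
    (ht' : t' = τ.1 t'') (ht'' : t = (σ * τ).1 t'') (x : PointedHom p₀ i₀ p t) :
    x.perm hz ht'' = (x.perm hσ ht).perm hz' ht' := by
  refine hext ?_ (fun b z z' hb hb' => ?_)
  · exact (congrArg (x.low ≫ ·) (permHom_permHom hσ hz' rfl hz)).symm.trans
      (Category.assoc ..).symm
  · obtain ⟨w, hw, g⟩ := exists_perm hz' ht' hb'
    obtain ⟨w', hw', g'⟩ := exists_perm hσ ht hw
    have hρ : s.block hw'.hk t'' (σ * τ) 1 = s.block hw'.hk t' σ 1 * s.block hw.hk t'' τ 1 := by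
      subst ht'
      rw [← s.block_mul, one_mul]
    have g2 : P.act w' (s.block hw'.hk t'' (σ * τ) 1) = z' := by rw [hρ, P.act_mul, g', g]
    rw [perm_app hz' ht' _ hb hw hb' rfl g, perm_app hσ ht _ hb hw' hw rfl g',
      perm_app hz ht'' _ hb hw' hb' rfl g2, Category.assoc, permHom_permHom g' g hρ g2]

variable {n m k : ℕ} {p : P.Op n} {i i' : Fin n} {q : P.Op m} {pq : P.Op k} {σ : s.perms n}
  {τ : s.perms m} {ρ : s.perms k} {pσ : P.Op n} {qτ : P.Op m} {z : P.Op k}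
  (hσ : P.act p σ = pσ) (hτ : P.act q τ = qτ) (hi : i' = σ.1 i)
  (h : IsComp p i' q pq) (h' : IsComp pσ i qτ z) (hz : P.act pq ρ = z)

theorem perm_above (hτ : P.act q τ = qτ) (hi : i' = σ.1 i) (hρ : ρ = s.block h.hk i σ τ)
    {t t₁ : Fin n} {t₂ t₃ : Fin k} (ht : t ≠ i') (ht₁ : t = σ.1 t₁) (ht₁' : t₁ ≠ i)
    (ht₂ : t₂ = leafL h.hk i' t ht) (ht₃ : t₃ = leafL h'.hk i t₁ ht₁') (ht₃' : t₂ = ρ.1 t₃)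
    (x : PointedHom p₀ i₀ p t) :
    (x.perm hσ ht₁).above h' ht₁' ht₃ = (x.above h ht ht₂).perm hz ht₃' := by
  refine hext ?_ (fun b z z' hb hb' => ?_)
  · exact (Category.assoc ..).trans ((congrArg (x.low ≫ ·) (permHom_ab hσ hτ hi h h' hρ hz)).trans
      (Category.assoc ..).symm)
  · obtain ⟨_, w, hw, g⟩ := exists_above h' ht₁' ht₃ hb'
    obtain ⟨w', hw', g'⟩ := exists_perm hσ ht₁ hw
    obtain ⟨v, hv, gv⟩ := exists_perm hz ht₃' hb'
    have kv := h.parallel ht hw' ht₂ rfl hv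
    rw [above_app h' ht₁' ht₃ _ hb hw hb' rfl g, perm_app hσ ht₁ _ hb hw' hw rfl g',
      perm_app hz ht₃' _ hb hv hb' rfl gv, above_app h ht ht₂ _ hb hw' hv rfl kv,
      Category.assoc, Category.assoc, permHom_ab g' hτ ?_ kv g ?_ gv]
    · exact (s.block_leafL_eq hw'.hk 1 ht₁'.symm ht₁.symm hi.symm ht.symm).symm
    · subst hρ ht₃
      exact s.block_parallel ..

theorem perm_below (hσ : P.act p σ = pσ) (hi : i' = σ.1 i) (hρ : ρ = s.block h.hk i σ τ)
    {t t₁ : Fin m} {t₂ t₃ : Fin k} (ht₁ : t = τ.1 t₁)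
    (ht₂ : t₂ = leafR h.hk i' t) (ht₃ : t₃ = leafR h'.hk i t₁) (ht₃' : t₂ = ρ.1 t₃)
    (x : PointedHom p₀ i₀ q t) :
    (x.perm hτ ht₁).below h' ht₃ = (x.below h ht₂).perm hz ht₃' := by
  refine hext ?_ (fun b z z' hb hb' => ?_)
  · exact (Category.assoc ..).trans ((congrArg (x.low ≫ ·) (permHom_be hσ hτ hi h h' hρ hz)).trans
      (Category.assoc ..).symm)
  · obtain ⟨_, w, hw, g⟩ := exists_below h' ht₃ hb'
    obtain ⟨w', hw', g'⟩ := exists_perm hτ ht₁ hw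
    obtain ⟨v, hv, gv⟩ := exists_perm hz ht₃' hb'
    have kv := (h.assoc hw' ht₂).1 hv
    rw [below_app h' ht₃ _ hb hw hb' g, perm_app hτ ht₁ _ hb hw' hw rfl g',
      perm_app hz ht₃' _ hb hv hb' rfl gv, below_app h ht₂ _ hb hw' hv kv,
      Category.assoc, Category.assoc, permHom_be hσ g' hi kv g ?_ gv]
    subst hρ ht₃
    exact s.block_assoc ..

end Perm

end PointedHom

/-- The pointed module of the morphisms from `p₀` that keep the input `i₀`. -/
noncomputable def PointedModule.hom {n₀ : ℕ} (p₀ : P.Op n₀) (i₀ : Fin n₀) : PointedModule P where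
  obj A j := PointedHom p₀ i₀ A j
  above hk _ _ _ e _ hz _ ht _ ht' x := x.above ⟨hk, e, hz⟩ ht ht'
  below hk _ _ _ e _ hz _ _ ht' x := x.below ⟨hk, e, hz⟩ ht'
  perm _ _ _ hz _ _ ht x := x.perm hz ht
  assoc₁ h₁ h₂ h₃ h₄ _ _ _ _ _ e₁ _ hpq e₃ _ hqr e₂ e₄ _ hz hz' _ _ _ _ _ _ _ _ _ :=
    PointedHom.above_above_right ⟨h₁, e₁, hpq⟩ ⟨h₂, e₂, hz⟩ ⟨h₄, e₄, hz'⟩ rfl ⟨h₃, e₃, hqr⟩ ..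
  assoc₂ h₁ h₂ h₃ h₄ _ _ _ _ _ e₁ _ hpq e₃ _ hqr e₂ e₄ _ hz hz' _ _ _ _ _ _ _ _ _ _ _ :=
    PointedHom.below_above_right ⟨h₁, e₁, hpq⟩ ⟨h₂, e₂, hz⟩ ⟨h₃, e₃, hqr⟩ ⟨h₄, e₄, hz'⟩ rfl ..
  assoc₃ h₁ h₂ h₃ h₄ _ _ _ _ _ e₁ _ hpq e₃ _ hqr e₂ e₄ _ hz hz' _ _ _ _ _ _ _ :=
    PointedHom.below_eq ⟨h₁, e₁, hpq⟩ ⟨h₂, e₂, hz⟩ ⟨h₃, e₃, hqr⟩ ⟨h₄, e₄, hz'⟩ rfl ..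
  parallel₁ h₁ h₂ h₃ h₄ _ _ _ ha _ _ e₁ _ hpq e₃ _ hpr e₂ e₄ _ hz hz' _ _ _ _ _ _ _ _ _ _ _ _ _ :=
    PointedHom.above_above_left ha ⟨h₁, e₁, hpq⟩ ⟨h₂, e₂, hz⟩ ⟨h₃, e₃, hpr⟩ ⟨h₄, e₄, hz'⟩ rfl
      rfl ..
  parallel₂ h₁ h₂ h₃ h₄ _ _ _ ha _ _ e₁ _ hpq e₃ _ hpr e₂ e₄ _ hz hz' _ _ _ _ _ _ _ _ :=
    PointedHom.below_above_left ha ⟨h₁, e₁, hpq⟩ ⟨h₂, e₂, hz⟩ ⟨h₄, e₄, hz'⟩ rfl ⟨h₃, e₃, hpr⟩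
      rfl ..
  comp_one hk _ _ _ e hz _ _ _ _ := PointedHom.above_one ⟨hk, e, hz⟩ ..
  one_comp hk _ i _ e hz _ _ _ := PointedHom.below_one (i := i) ⟨hk, e, hz⟩ ..
  act_one _ _ _ _ _ := PointedHom.perm_one ..
  act_mul _ _ _ _ _ _ _ _ _ _ _ _ _ _ _ := PointedHom.perm_mul ..
  act_comp₁ hk _ _ _ _ _ _ hpσ _ hqτ e e' _ hpq _ hz hz' _ _ _ _ _ _ _ _ _ _ _ :=
    PointedHom.perm_above hpσ ⟨hk, e', hpq⟩ ⟨hk, e, hz⟩ hz' hqτ rfl rfl ..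
  act_comp₂ hk _ _ _ _ _ _ hpσ _ hqτ e e' _ hpq _ hz hz' _ _ _ _ _ _ _ _ _ :=
    PointedHom.perm_below hqτ ⟨hk, e', hpq⟩ ⟨hk, e, hz⟩ hz' hpσ rfl rfl ..

end Tw

end Operad

namespace Operad

variable {s : OperadKind} {P : Operad.{u} s}

namespace Tw

/-! ## The upper module of morphisms -/

/-- A morphism from `q₀` to `b` together with compatible extensions to `p₀ ∘ q₀`. -/
structure UpperHom {n₀ m₀ k₀ : ℕ} {p₀ : P.Op n₀} {i₀ : Fin n₀} {q₀ : P.Op m₀} {w₀ : P.Op k₀}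
    (h₀ : IsComp p₀ i₀ q₀ w₀) {m : ℕ} (b : P.Op m) : Type u where
  col : P.out b = P.inp p₀ i₀
  up : (⟨m₀, q₀⟩ : Tw P) ⟶ ⟨m, b⟩
  -- The extension of `q₀ ⟶ b` has `p₀` below both its source and its target. It thus ends at `p₀ ∘
  -- b`, where the extension `app` of a morphism from `p₀` begins.
  ext : ∀ {k : ℕ} {z : P.Op k} (_ : IsComp p₀ i₀ b z), (⟨k₀, w₀⟩ : Tw P) ⟶ ⟨k, z⟩
  ab_ext : ∀ {k : ℕ} {z : P.Op k} (h : IsComp p₀ i₀ b z), h₀.ab ≫ ext h = h.ab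
  be_ext : ∀ {k : ℕ} {z : P.Op k} (h : IsComp p₀ i₀ b z), h₀.be ≫ ext h = up ≫ h.be

namespace UpperHom

variable {n₀ m₀ k₀ : ℕ} {p₀ : P.Op n₀} {i₀ : Fin n₀} {q₀ : P.Op m₀} {w₀ : P.Op k₀}
  {h₀ : IsComp p₀ i₀ q₀ w₀}

theorem hext {m : ℕ} {b : P.Op m} {x y : UpperHom h₀ b} (h : x.up = y.up)
    (H : ∀ {k : ℕ} {z : P.Op k} (h : IsComp p₀ i₀ b z), x.ext h = y.ext h) : x = y := by
  cases x
  cases y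
  congr
  funext k z h
  apply H

section Above

variable {m l m' : ℕ} {b : P.Op m} {j : Fin m} {r : P.Op l} {b' : P.Op m'} (h : IsComp b j r b')

/-- The composite with a step `E ↦ E ∘ⱼ r`. -/
def above (x : UpperHom h₀ b) : UpperHom h₀ b' where
  col := h.out_eq.trans x.col
  up := x.up ≫ h.ab
  ext {_ _} h' :=
    have hw : IsComp p₀ i₀ b (P.comp (k := n₀ + m - 1) (by have := j.isLt; omega) p₀ i₀ b x.col) :=
      .of_comp ..
    x.ext hw ≫ ((hw.assoc h rfl).2 h').ab
  ab_ext {_ _} h' := by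
    rw [← Category.assoc, x.ab_ext, IsComp.ab_ab_right _ _ h rfl h']
  be_ext {_ _} h' := by
    rw [← Category.assoc, x.be_ext, Category.assoc, Category.assoc,
      IsComp.be_ab_right _ _ h rfl h']

theorem above_ext (x : UpperHom h₀ b) {k k' : ℕ} {w : P.Op k} {z : P.Op k'}
    (hw : IsComp p₀ i₀ b w) (hz : IsComp p₀ i₀ b' z) {c : Fin k} (hc : c = leafR hw.hk i₀ j)
    (g : IsComp w c r z) : (x.above h).ext hz = x.ext hw ≫ g.ab := by
  subst hc
  have hj := j.isLt
  obtain ⟨hk, e, rfl⟩ := hw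
  obtain rfl : k = n₀ + m - 1 := by omega
  rfl

end Above

section Perm

variable {m : ℕ} {b b' : P.Op m} {σ : s.perms m} (h : P.act b σ = b')

/-- The composite with a step `E ↦ E^σ`. -/
noncomputable def perm (x : UpperHom h₀ b) : UpperHom h₀ b' where
  col := by rw [← h, P.out_act, x.col]
  up := x.up ≫ permHom σ h
  ext {_ _} h' :=
    have hw : IsComp p₀ i₀ b (P.comp h'.hk p₀ i₀ b x.col) := .of_comp ..
    x.ext hw ≫ permHom _ (hw.act_eq rfl (P.act_one p₀) h rfl h')
  ab_ext {_ _} h' := by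
    rw [← Category.assoc, x.ab_ext, ← permHom_ab (i' := i₀) (P.act_one p₀) h rfl _ h' rfl,
      permHom_one, Category.id_comp]
  be_ext {_ _} h' := by
    rw [← Category.assoc, x.be_ext, Category.assoc, Category.assoc,
      ← permHom_be (i' := i₀) (P.act_one p₀) h rfl _ h' rfl]

theorem perm_ext (x : UpperHom h₀ b) {k : ℕ} {w : P.Op k} {z : P.Op k}
    (hw : IsComp p₀ i₀ b w) (hz : IsComp p₀ i₀ b' z) {ρ : s.perms k}
    (hρ : ρ = s.block hw.hk i₀ 1 σ) (g : P.act w ρ = z) :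
    (x.perm h).ext hz = x.ext hw ≫ permHom ρ g := by
  subst hρ
  obtain ⟨hk, e, rfl⟩ := hw
  rfl

theorem exists_perm (x : UpperHom h₀ b) {k : ℕ} {z : P.Op k} (hz : IsComp p₀ i₀ b' z)
    (h : P.act b σ = b') :
    ∃ (w : P.Op k) (hw : IsComp p₀ i₀ b w), P.act w (s.block hw.hk i₀ 1 σ) = z := by
  have hw := IsComp.of_comp hz.hk p₀ i₀ b x.col
  exact ⟨_, hw, hw.act_eq rfl (P.act_one p₀) h rfl hz⟩

end Perm

section Relations

variable {n m l k₁ k₂ k : ℕ} {p : P.Op n} {i a : Fin n} {q : P.Op m} {j : Fin m} {r : P.Op l}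
  {pq : P.Op k₁} {z : P.Op k}

theorem above_above_right {qr : P.Op k₂} {c : Fin k₁} (h₁ : IsComp p i q pq) (h₂ : IsComp pq c r z)
    (h₃ : IsComp q j r qr) (h₄ : IsComp p i qr z) (hc : c = leafR h₁.hk i j) (x : UpperHom h₀ p) :
    (x.above h₁).above h₂ = x.above h₄ := by
  refine hext ?_ (fun hz => ?_)
  · exact (Category.assoc ..).trans (congrArg (x.up ≫ ·) (h₁.ab_ab_right h₂ h₃ hc h₄))
  · obtain ⟨_, w, hw⟩ := IsComp.of_out x.col
    obtain ⟨_, w', hw'⟩ := IsComp.of_out (x.above h₁).col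
    have g' := (hw.assoc h₁ rfl).2 hw'
    have g := (hw'.assoc h₂ rfl).2 hz
    have pos : leafR hw'.hk i₀ c = leafR g'.hk (leafR hw.hk i₀ i) j := by
      subst hc
      exact (leafR_leafR ..).symm
    have g4 := (g'.assoc h₃ pos).1 g
    rw [above_ext h₂ _ hw' hz rfl g, above_ext h₁ _ hw hw' rfl g', above_ext h₄ _ hw hz rfl g4,
      Category.assoc, g'.ab_ab_right g h₃ pos g4]

theorem above_above_left {r : P.Op l} {pr : P.Op k₂} {c : Fin k₁} {c' : Fin k₂}
    (h₁ : IsComp p i q pq) (h₂ : IsComp pq c r z) (ha : a ≠ i) (hc : c = leafL h₁.hk i a ha)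
    (h₃ : IsComp p a r pr) (h₄ : IsComp pr c' q z) (hc' : c' = leafL h₃.hk a i ha.symm)
    (x : UpperHom h₀ p) : (x.above h₁).above h₂ = (x.above h₃).above h₄ := by
  refine hext ?_ (fun hz => ?_)
  · exact (Category.assoc ..).trans ((congrArg (x.up ≫ ·) (h₁.ab_ab_left h₂ ha hc h₃ h₄ hc')).trans
      (Category.assoc ..).symm)
  · obtain ⟨_, w, hw⟩ := IsComp.of_out x.col
    obtain ⟨_, w₁, hw₁⟩ := IsComp.of_out (x.above h₁).col
    obtain ⟨_, w₃, hw₃⟩ := IsComp.of_out (x.above h₃).col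
    have g₁ := (hw.assoc h₁ rfl).2 hw₁
    have g₃ := (hw.assoc h₃ rfl).2 hw₃
    have g₂ := (hw₁.assoc h₂ rfl).2 hz
    have g₄ := (hw₃.assoc h₄ rfl).2 hz
    rw [above_ext h₂ _ hw₁ hz rfl g₂, above_ext h₁ _ hw hw₁ rfl g₁, above_ext h₄ _ hw₃ hz rfl g₄,
      above_ext h₃ _ hw hw₃ rfl g₃, Category.assoc, Category.assoc,
      g₁.ab_ab_left g₂ (leafR_ne_leafR hw.hk i₀ ha) ?_ g₃ g₄ ?_]
    · subst hc
      exact (leafL_leafR_leafR ..).symm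
    · subst hc'
      exact (leafL_leafR_leafR ..).symm

theorem above_one {c : P.Colour} (h : IsComp p i (P.one c) p) (x : UpperHom h₀ p) :
    x.above h = x := by
  refine hext ?_ (fun hz => ?_)
  · exact (congrArg (x.up ≫ ·) h.ab_one).trans (Category.comp_id _)
  · have g := (hz.assoc h rfl).2 hz
    rw [above_ext h _ hz hz rfl g, g.ab_one, Category.comp_id]

theorem perm_one (h : P.act p 1 = p) (x : UpperHom h₀ p) : x.perm h = x := by
  refine hext ?_ (fun hz => ?_)
  · exact (congrArg (x.up ≫ ·) (permHom_one h)).trans (Category.comp_id _)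
  · rw [perm_ext h _ hz hz (s.block_one _ _).symm (P.act_one _), permHom_one, Category.comp_id]

theorem perm_mul {σ τ : s.perms n} {pσ z : P.Op n} (hσ : P.act p σ = pσ)
    (hz : P.act p (σ * τ) = z) (hz' : P.act pσ τ = z) (x : UpperHom h₀ p) :
    x.perm hz = (x.perm hσ).perm hz' := by
  refine hext ?_ (fun h => ?_)
  · exact (congrArg (x.up ≫ ·) (permHom_permHom hσ hz' rfl hz)).symm.trans
      (Category.assoc ..).symm
  · obtain ⟨w', hw', g'⟩ := exists_perm (x.perm hσ) h hz'
    obtain ⟨w, hw, g⟩ := exists_perm x hw' hσ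
    have hρ := s.block_mul_right hw.hk i₀ σ τ
    rw [perm_ext hz' _ hw' h rfl g', perm_ext hσ _ hw hw' rfl g,
      perm_ext hz _ hw h rfl (by rw [hρ, P.act_mul, g, g']), Category.assoc,
      permHom_permHom g g' hρ]

theorem perm_above {σ : s.perms n} {τ : s.perms m} {ρ : s.perms k} {i' : Fin n} {pσ : P.Op n}
    {qτ : P.Op m} {pq : P.Op k} (hσ : P.act p σ = pσ) (h : IsComp p i' q pq)
    (h' : IsComp pσ i qτ z) (hz : P.act pq ρ = z) (hτ : P.act q τ = qτ) (hi : i' = σ.1 i)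
    (hρ : ρ = s.block h.hk i σ τ) (x : UpperHom h₀ p) :
    (x.perm hσ).above h' = (x.above h).perm hz := by
  refine hext ?_ (fun hv => ?_)
  · exact (Category.assoc ..).trans ((congrArg (x.up ≫ ·) (permHom_ab hσ hτ hi h h' hρ hz)).trans
      (Category.assoc ..).symm)
  · obtain ⟨_, w', hw'⟩ := IsComp.of_out (x.perm hσ).col
    obtain ⟨w, hw, g⟩ := exists_perm x hw' hσ
    have g' := (hw'.assoc h' rfl).2 hv
    obtain ⟨v', hv', gv⟩ := exists_perm (x.above h) hv hz
    have kv := (hw.assoc h rfl).2 hv'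
    rw [above_ext h' _ hw' hv rfl g', perm_ext hσ _ hw hw' rfl g, perm_ext hz _ hv' hv rfl gv,
      above_ext h _ hw hv' rfl kv, Category.assoc, Category.assoc,
      permHom_ab g hτ ?_ kv g' ?_ gv]
    · subst hi
      exact (s.block_leafR_eq hw.hk (σ := 1) rfl rfl).symm
    · subst hρ
      exact (s.block_assoc ..).symm

end Relations

end UpperHom

/-- The upper module of the morphisms from `q₀` with a compatible morphism from `p₀ ∘ q₀`. -/
noncomputable def UpperModule.hom {n₀ m₀ k₀ : ℕ} {p₀ : P.Op n₀} {i₀ : Fin n₀} {q₀ : P.Op m₀}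
    {w₀ : P.Op k₀} (h₀ : IsComp p₀ i₀ q₀ w₀) : UpperModule P where
  obj b := UpperHom h₀ b
  above hk _ _ _ e _ hz x := x.above ⟨hk, e, hz⟩
  perm _ _ _ hz x := x.perm hz
  assoc₁ h₁ h₂ h₃ h₄ _ _ _ _ _ e₁ _ hpq e₃ _ hqr e₂ e₄ _ hz hz' _ :=
    UpperHom.above_above_right ⟨h₁, e₁, hpq⟩ ⟨h₂, e₂, hz⟩ ⟨h₃, e₃, hqr⟩ ⟨h₄, e₄, hz'⟩ rfl ..
  parallel₁ h₁ h₂ h₃ h₄ _ _ _ ha _ _ e₁ _ hpq e₃ _ hpr e₂ e₄ _ hz hz' _ :=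
    UpperHom.above_above_left ⟨h₁, e₁, hpq⟩ ⟨h₂, e₂, hz⟩ ha rfl ⟨h₃, e₃, hpr⟩ ⟨h₄, e₄, hz'⟩ rfl ..
  comp_one hk _ _ _ e hz _ := UpperHom.above_one ⟨hk, e, hz⟩ ..
  act_one _ _ _ := UpperHom.perm_one ..
  act_mul _ _ _ _ _ _ _ _ _ := UpperHom.perm_mul ..
  act_comp₁ hk _ _ _ _ _ _ hpσ _ hqτ e e' _ hpq _ hz hz' _ :=
    UpperHom.perm_above hpσ ⟨hk, e', hpq⟩ ⟨hk, e, hz⟩ hz' hqτ rfl rfl ..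

/-! ## Morphisms given by decorated cuts -/

section Eval

variable {n₀ m₀ k₀ : ℕ} {p₀ : P.Op n₀} {i₀ : Fin n₀} {q₀ : P.Op m₀} {w₀ : P.Op k₀}

/-- The morphism from `p₀` given by a morphism from `p₀` to the lower part of a cut. -/
noncomputable def CutEval.low (p₀ : P.Op n₀) (i₀ : Fin n₀) :
    CutEval (PointedModule.hom p₀ i₀) (UpperModule.trivial P) ⟨n₀, p₀⟩ where
  val hk _ _ _ e _ hz x _ := PointedHom.low x ≫ IsComp.ab ⟨hk, e, hz⟩
  above_left hk _ _ _ e _ hz hl _ ha _ hc _ eq _ hz' hn _ ea hA _ hj hk₁ e₁ hz₁ ξ _ :=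
    (Category.assoc ..).trans ((congrArg (PointedHom.low ξ ≫ ·)
      (IsComp.ab_ab_left ⟨hk, e, hz⟩ ⟨hl, eq, hz'⟩ ha hc ⟨hn, ea, hA⟩ ⟨hk₁, e₁, hz₁⟩ hj)).trans
      (Category.assoc ..).symm)
  above_right hk _ _ _ e _ hz hl _ _ hc _ eq _ hz' hm _ et hb hk₁ e₁ hz₁ ξ _ :=
    (Category.assoc ..).trans (congrArg (PointedHom.low ξ ≫ ·)
      (IsComp.ab_ab_right ⟨hk, e, hz⟩ ⟨hl, eq, hz'⟩ ⟨hm, et, hb⟩ hc ⟨hk₁, e₁, hz₁⟩))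
  below hk _ _ _ e _ hz hl _ _ eq _ hz' hn _ ea hA _ hj hk₁ e₁ hz₁ ξ _ :=
    (Category.assoc ..).trans ((congrArg (PointedHom.low ξ ≫ ·)
      (IsComp.be_ab_right ⟨hn, ea, hA⟩ ⟨hk₁, e₁, hz₁⟩ ⟨hk, e, hz⟩ hj ⟨hl, eq, hz'⟩).symm).trans
      (Category.assoc ..).symm)
  perm hk _ _ _ e _ hz _ _ _ hA _ hj _ hb e' _ hz' hzz ξ _ :=
    (Category.assoc ..).trans ((congrArg (PointedHom.low ξ ≫ ·)
      (permHom_ab hA hb hj ⟨hk, e, hz⟩ ⟨hk, e', hz'⟩ rfl hzz).symm).trans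
      (Category.assoc ..).symm)

/-- The morphism from `q₀` given by a morphism from `q₀` to the upper part of a cut. -/
noncomputable def CutEval.up (h₀ : IsComp p₀ i₀ q₀ w₀) :
    CutEval (PointedModule.trivial P) (UpperModule.hom h₀) ⟨m₀, q₀⟩ where
  val hk _ _ _ e _ hz _ x := UpperHom.up x ≫ IsComp.be ⟨hk, e, hz⟩
  above_left hk _ _ _ e _ hz hl _ ha _ hc _ eq _ hz' hn _ ea hA _ hj hk₁ e₁ hz₁ _ η :=
    (Category.assoc ..).trans (congrArg (UpperHom.up η ≫ ·)
      (IsComp.be_ab_left ⟨hk, e, hz⟩ ⟨hl, eq, hz'⟩ ha hc ⟨hn, ea, hA⟩ ⟨hk₁, e₁, hz₁⟩ hj))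
  above_right hk _ _ _ e _ hz hl _ _ hc _ eq _ hz' hm _ et hb hk₁ e₁ hz₁ _ η :=
    (Category.assoc ..).trans ((congrArg (UpperHom.up η ≫ ·)
      (IsComp.be_ab_right ⟨hk, e, hz⟩ ⟨hl, eq, hz'⟩ ⟨hm, et, hb⟩ hc ⟨hk₁, e₁, hz₁⟩)).trans
      (Category.assoc ..).symm)
  below hk _ _ _ e _ hz hl _ _ eq _ hz' hn _ ea hA _ hj hk₁ e₁ hz₁ _ η :=
    (Category.assoc ..).trans (congrArg (UpperHom.up η ≫ ·)
      (IsComp.be_be ⟨hk, e, hz⟩ ⟨hl, eq, hz'⟩ ⟨hn, ea, hA⟩ hj ⟨hk₁, e₁, hz₁⟩))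
  perm hk _ _ _ e _ hz _ _ _ hA _ hj _ hb e' _ hz' hzz _ η :=
    (Category.assoc ..).trans ((congrArg (UpperHom.up η ≫ ·)
      (permHom_be hA hb hj ⟨hk, e, hz⟩ ⟨hk, e', hz'⟩ rfl hzz).symm).trans
      (Category.assoc ..).symm)

/-- The morphism from `p₀ ∘ q₀` given by morphisms from `p₀` and `q₀` to the parts of `A ∘ⱼ b`. -/
def glueHom {h₀ : IsComp p₀ i₀ q₀ w₀} {n m k : ℕ} {A : P.Op n} {j : Fin n} {b : P.Op m} {z : P.Op k}
    (h : IsComp A j b z) (x : PointedHom p₀ i₀ A j) (y : UpperHom h₀ b) :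
    (⟨k₀, w₀⟩ : Tw P) ⟶ ⟨k, z⟩ :=
  have h' : IsComp p₀ i₀ b (P.comp (k := n₀ + m - 1) (by have := i₀.isLt; omega) p₀ i₀ b y.col) :=
    .of_comp ..
  -- The morphism is `p₀ ∘ q₀ ⟶ p₀ ∘ b ⟶ A ∘ⱼ b`: the upper part is changed first, the lower part
  -- afterwards.
  y.ext h' ≫ x.app b h' h

theorem glueHom_eq {h₀ : IsComp p₀ i₀ q₀ w₀} {n m k k' : ℕ} {A : P.Op n} {j : Fin n} {b : P.Op m}
    {z : P.Op k} {w : P.Op k'} (h : IsComp A j b z) (x : PointedHom p₀ i₀ A j) (y : UpperHom h₀ b)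
    (h' : IsComp p₀ i₀ b w) : glueHom h x y = y.ext h' ≫ x.app b h' h := by
  have := i₀.isLt
  obtain ⟨hk, e, rfl⟩ := h'
  obtain rfl : k' = n₀ + m - 1 := by omega
  rfl

theorem glueHom_perm {h₀ : IsComp p₀ i₀ q₀ w₀} {n m k : ℕ} {A A' : P.Op n} {j j' : Fin n}
    {b b' : P.Op m} {z z' : P.Op k} {τ : s.perms n} {ρ : s.perms m} {σ : s.perms k}
    (h : IsComp A j b z) (h' : IsComp A' j' b' z') (hA : P.act A τ = A') (hj : j = τ.1 j')
    (hb : P.act b ρ = b') (hz : P.act z σ = z') (hσ : σ = s.block h.hk j' τ ρ)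
    (x : PointedHom p₀ i₀ A j) (y : UpperHom h₀ b) :
    glueHom h x y ≫ permHom σ hz = glueHom h' (x.perm hA hj) (y.perm hb) := by
  obtain ⟨_, w', hw'⟩ := IsComp.of_out (y.perm hb).col
  obtain ⟨w, hw, g⟩ := UpperHom.exists_perm y hw' hb
  -- The operation `v` is `A ∘ⱼ b'`. The two permutations are performed one after the other: `ρ`
  -- crosses the extension of `x` by `app_perm`, and then `τ` acts on `A`.
  obtain ⟨v, hv, gv⟩ := PointedHom.exists_perm hA hj h'
  have hzv := h.act_eq rfl (P.act_one A) hb rfl hv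
  rw [glueHom_eq h x y hw, glueHom_eq h' _ _ hw', UpperHom.perm_ext hb _ hw hw' rfl g,
    PointedHom.perm_app hA hj _ hw' hv h' rfl gv, Category.assoc, Category.assoc,
    ← Category.assoc (permHom _ g), ← x.app_perm hb hw h hw' hv g hzv, Category.assoc,
    permHom_permHom hzv gv ?_ hz]
  subst hσ hj
  rw [← s.block_mul, one_mul, mul_one]

section Glue

variable {h₀ : IsComp p₀ i₀ q₀ w₀} {n m k l n₁ k₁ : ℕ} {A : P.Op n} {j : Fin n} {b : P.Op m}
  {z : P.Op k} {q : P.Op l} {A₁ : P.Op n₁} {z' : P.Op k₁} {j₁ : Fin n₁} (h : IsComp A j b z)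
  (x : PointedHom p₀ i₀ A j) (y : UpperHom h₀ b)

theorem glueHom_above_left {a : Fin n} {c : Fin k} (hq : IsComp z c q z')
    (ha : a ≠ j) (hc : c = leafL h.hk j a ha) (hA : IsComp A a q A₁) (h' : IsComp A₁ j₁ b z')
    (hj : j₁ = leafL hA.hk a j ha.symm) :
    glueHom h x y ≫ hq.ab = glueHom h' (x.above hA ha.symm hj) y := by
  obtain ⟨_, w, hw⟩ := IsComp.of_out y.col
  rw [glueHom_eq _ _ _ hw, glueHom_eq _ _ _ hw, Category.assoc, x.above_app hA _ hj hw h h' hc hq]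

/-- A graft onto `b` crosses the lower extension by `app_ab` and is then absorbed by the upper
morphism `y`. -/
theorem glueHom_above_right {b₁ : P.Op n₁} {t : Fin m} {c : Fin k} (hq : IsComp z c q z')
    (hc : c = leafR h.hk j t) (hb : IsComp b t q b₁) (h' : IsComp A j b₁ z') :
    glueHom h x y ≫ hq.ab = glueHom h' x (y.above hb) := by
  obtain ⟨_, w, hw⟩ := IsComp.of_out y.col
  obtain ⟨_, w₁, hw₁⟩ := IsComp.of_out (y.above hb).col
  have g := (hw.assoc hb rfl).2 hw₁
  rw [glueHom_eq _ _ _ hw, glueHom_eq _ _ _ hw₁, Category.assoc, y.above_ext hb hw hw₁ rfl g,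
    x.app_ab hb hw h hw₁ h' rfl hc g hq, Category.assoc]

theorem glueHom_below {i : Fin l} (hq : IsComp q i z z') (hA : IsComp q i A A₁)
    (hj : j₁ = leafR hA.hk i j) (h' : IsComp A₁ j₁ b z') :
    glueHom h x y ≫ hq.be = glueHom h' (x.below hA hj) y := by
  obtain ⟨_, w, hw⟩ := IsComp.of_out y.col
  rw [glueHom_eq _ _ _ hw, glueHom_eq _ _ _ hw, Category.assoc, x.below_app hA hj hw h h' hq]

end Glue

/-- The morphism from `p₀ ∘ q₀` given by morphisms from `p₀` and `q₀` to the parts of a cut. -/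
noncomputable def CutEval.glue (h₀ : IsComp p₀ i₀ q₀ w₀) :
    CutEval (PointedModule.hom p₀ i₀) (UpperModule.hom h₀) ⟨k₀, w₀⟩ where
  val hk _ _ _ e _ hz x y := glueHom ⟨hk, e, hz⟩ x y
  above_left hk _ _ _ e _ hz hl _ ha _ hc _ eq _ hz' hn _ ea hA _ hj hk₁ e₁ hz₁ ξ η :=
    glueHom_above_left ⟨hk, e, hz⟩ ξ η ⟨hl, eq, hz'⟩ ha hc ⟨hn, ea, hA⟩ ⟨hk₁, e₁, hz₁⟩ hj
  above_right hk _ _ _ e _ hz hl _ _ hc _ eq _ hz' hm _ et hb hk₁ e₁ hz₁ ξ η :=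
    glueHom_above_right ⟨hk, e, hz⟩ ξ η ⟨hl, eq, hz'⟩ hc ⟨hm, et, hb⟩ ⟨hk₁, e₁, hz₁⟩
  below hk _ _ _ e _ hz hl _ _ eq _ hz' hn _ ea hA _ hj hk₁ e₁ hz₁ ξ η :=
    glueHom_below ⟨hk, e, hz⟩ ξ η ⟨hl, eq, hz'⟩ ⟨hn, ea, hA⟩ hj ⟨hk₁, e₁, hz₁⟩
  perm hk _ _ _ e _ hz _ _ _ hA _ hj _ hb e' _ hz' hzz ξ η :=
    glueHom_perm ⟨hk, e, hz⟩ ⟨hk, e', hz'⟩ hA hj hb hzz rfl ξ η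

end Eval

end Tw

end Operad

namespace Operad

variable {s : OperadKind} {P : Operad.{u} s}

theorem IsComp.tw_eq {n m k k' : ℕ} {p : P.Op n} {i : Fin n} {q : P.Op m} {z : P.Op k}
    {z' : P.Op k'} (h : IsComp p i q z) (h' : IsComp p i q z') :
    (⟨k, z⟩ : Tw P) = ⟨k', z'⟩ := by
  obtain rfl := Nat.succ.inj (h.hk.symm.trans h'.hk)
  obtain rfl := h.unique h'
  rfl

namespace Tw

/-! ### Identity decorations. -/

section Identities

variable {n₀ m₀ k₀ : ℕ} {p₀ : P.Op n₀} {i₀ : Fin n₀} {q₀ : P.Op m₀} {w₀ : P.Op k₀}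

/-- The identity of `p₀`. -/
def PointedHom.id (p₀ : P.Op n₀) (i₀ : Fin n₀) : PointedHom p₀ i₀ p₀ i₀ where
  col := rfl
  low := 𝟙 _
  app _ _ _ h h' := eqToHom (h.tw_eq h')
  ab_app {_ k k' _ z z'} h h' := by
    obtain rfl := Nat.succ.inj (h.hk.symm.trans h'.hk)
    obtain rfl := h.unique h'
    rw [eqToHom_refl, Category.comp_id, Category.id_comp]
  be_app {_ k k' _ z z'} h h' := by
    obtain rfl := Nat.succ.inj (h.hk.symm.trans h'.hk)
    obtain rfl := h.unique h'
    rw [eqToHom_refl, Category.comp_id]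
  app_ab {_ _ _ _ _ _ _ _ _ _ _ _ _ _ _} _ h h' hw hw' _ _ hc hc' g g' := by
    obtain rfl := Nat.succ.inj (h.hk.symm.trans h'.hk)
    obtain rfl := h.unique h'
    obtain rfl := Nat.succ.inj (hw.hk.symm.trans hw'.hk)
    obtain rfl := hw.unique hw'
    subst hc hc'
    rw [eqToHom_refl, eqToHom_refl, Category.comp_id, Category.id_comp]
  app_perm {_ _ _ _ _ _ _ _ _ _} _ h h' hw hw' g g' := by
    obtain rfl := Nat.succ.inj (h.hk.symm.trans h'.hk)
    obtain rfl := h.unique h'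
    obtain rfl := hw.unique hw'
    rw [eqToHom_refl, eqToHom_refl, Category.comp_id, Category.id_comp]

/-- The identity of `q₀`. -/
def UpperHom.id (h₀ : IsComp p₀ i₀ q₀ w₀) : UpperHom h₀ q₀ where
  col := h₀.e
  up := 𝟙 _
  ext h := eqToHom (h₀.tw_eq h)
  ab_ext {_ _} h := by
    obtain rfl := Nat.succ.inj (h₀.hk.symm.trans h.hk)
    obtain rfl := h₀.unique h
    rw [eqToHom_refl, Category.comp_id]
  be_ext {_ _} h := by
    obtain rfl := Nat.succ.inj (h₀.hk.symm.trans h.hk)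
    obtain rfl := h₀.unique h
    rw [eqToHom_refl, Category.comp_id, Category.id_comp]

end Identities

/-! ## Partial composites as pushouts -/

section Pushout

variable {n m k : ℕ} {p : P.Op n} {i : Fin n} {q : P.Op m} {w : P.Op k} {c : P.Colour}

theorem ab_permHom_one {z p' : P.Op n} (h : IsComp p i (P.one c) z) (h' : P.act z 1 = p')
    (hp : p = p') : h.ab ≫ permHom 1 h' = eqToHom (by rw [hp]) := by
  subst hp
  obtain rfl : z = p := (P.act_one z).symm.trans h'
  rw [h.ab_one, permHom_one, Category.comp_id, eqToHom_refl]

theorem be_permHom_one {i : Fin 1} {z : P.Op n} (h : IsComp (P.one c) i p z)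
    (h' : P.act z 1 = p) : h.be ≫ permHom 1 h' = 𝟙 _ := by
  obtain rfl : z = p := (P.act_one z).symm.trans h'
  rw [h.be_one, permHom_one, Category.comp_id]

/-- The cut of `p` below its input `i`. -/
def Cut.lowUnit (X : PointedModule P) (x : X.obj p i) (h : IsComp p i (P.one c) p) :
    Cut X (UpperModule.trivial P) p :=
  .mk h.hk p i (P.one c) h.e 1 (by rw [h.eq, P.act_one]) x PUnit.unit

/-- The cut of `q` above its output. -/
def Cut.upUnit (Y : UpperModule P) (y : Y.obj q) (h : IsComp (P.one c) 0 q q) :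
    Cut (PointedModule.trivial P) Y q :=
  .mk h.hk (P.one c) 0 q h.e 1 (by rw [h.eq, P.act_one]) PUnit.unit y

/-- The cut of `p ∘ᵢ q` into `p` and `q`. -/
def Cut.ofComp {X : PointedModule P} {Y : UpperModule P} (x : X.obj p i) (y : Y.obj q)
    (h : IsComp p i q w) : Cut X Y w :=
  .mk h.hk p i q h.e 1 (by rw [h.eq, P.act_one]) x y

/-- The cut of `q` at its root and, in the next lemma, the cut of `p` at its input `i` are both
carried to the cut of `p ∘ᵢ q` along the edge joining `p` and `q`. The unit laws remove the identity
operation in each case. -/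
theorem Cut.map_be {Y : UpperModule P} (x : (PointedModule.trivial P).obj p i) (y : Y.obj q)
    (hi : IsComp p i (P.one c) p) (ho : IsComp (P.one c) 0 q q) (h : IsComp p i q w) :
    Cut.map h.be (Cut.upUnit Y y ho) = Cut.ofComp x y h := by
  refine (Cut.below_mk h.hk p i q h.e w h.eq (A := P.one c) (A₁ := p) (j₁ := i) (σ₁ := 1) hi.hk hi.eq
    ?_ ?_).trans rfl
  · rw [leafR_zero]
    rfl
  · exact (s.block_one ..).symm

theorem Cut.map_ab {X : PointedModule P} (x : X.obj p i) (y : (UpperModule.trivial P).obj q)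
    (hi : IsComp p i (P.one c) p) (ho : IsComp (P.one c) 0 q q) (h : IsComp p i q w) :
    Cut.map h.ab (Cut.lowUnit X x hi) = Cut.ofComp x y h := by
  refine (Cut.above_right h.hk p i q h.e w h.eq (b := P.one c) (b₁ := q) (l := 0) (σ₁ := 1) ?_ ho.hk
    ho.eq ?_).trans rfl
  · rw [leafR_zero]
    rfl
  · exact (s.block_one ..).symm

/-- This and the next two lemmas say that the initial cuts with identity decorations evaluate to
identities. They supply the starting point for recovering morphisms through `CutEval.eval_map`. -/
theorem CutEval.low_lowUnit (hi : IsComp p i (P.one c) p) :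
    (CutEval.low p i).eval (Cut.lowUnit _ (PointedHom.id p i) hi) = 𝟙 _ := by
  refine ((congrArg (· ≫ _) (Category.id_comp _))).trans ?_
  exact ab_permHom_one (.of_comp ..) _ rfl

theorem CutEval.up_upUnit (h : IsComp p i q w) (ho : IsComp (P.one c) 0 q q) :
    (CutEval.up h).eval (Cut.upUnit _ (UpperHom.id h) ho) = 𝟙 _ := by
  refine ((congrArg (· ≫ _) (Category.id_comp _))).trans ?_
  exact be_permHom_one (.of_comp ..) _

theorem CutEval.glue_ofComp (h : IsComp p i q w) :
    (CutEval.glue h).eval (Cut.ofComp (PointedHom.id p i) (UpperHom.id h) h) = 𝟙 _ := by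
  have key : ∀ (w' : P.Op k) (h' : IsComp p i q w') (hw : P.act w' 1 = w),
      glueHom h' (PointedHom.id p i) (UpperHom.id h) ≫ permHom 1 hw = 𝟙 _ := by
    intro w' h' hw
    obtain rfl := h.unique h'
    rw [permHom_one, Category.comp_id, glueHom_eq _ _ _ h]
    exact (Category.comp_id _).trans rfl
  exact key _ (.of_comp ..) _

section Glue

variable (h : IsComp p i q w) {n' m' k' : ℕ}

theorem ab_glueHom {A : P.Op n'} {j : Fin n'} {b : P.Op m'} {z : P.Op k'} (hz : IsComp A j b z)
    (x : PointedHom p i A j) (y : UpperHom h b) : h.ab ≫ glueHom hz x y = x.low ≫ hz.ab := by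
  obtain ⟨_, w, hw⟩ := IsComp.of_out y.col
  rw [glueHom_eq hz x y hw, ← Category.assoc, y.ab_ext, x.ab_app]

theorem be_glueHom {A : P.Op n'} {j : Fin n'} {b : P.Op m'} {z : P.Op k'} (hz : IsComp A j b z)
    (x : PointedHom p i A j) (y : UpperHom h b) : h.be ≫ glueHom hz x y = y.up ≫ hz.be := by
  obtain ⟨_, w, hw⟩ := IsComp.of_out y.col
  rw [glueHom_eq hz x y hw, ← Category.assoc, y.be_ext, Category.assoc, x.be_app]

theorem CutEval.ab_glue {r : P.Op k'} (x : Cut (PointedModule.hom p i) (UpperModule.hom h) r) :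
    h.ab ≫ (CutEval.glue h).eval x = (CutEval.low p i).eval x.fst := by
  induction x using Cut.ind with
  | @h _ _ hk A j b e σ hr ξ η =>
  exact (Category.assoc ..).symm.trans (congrArg (· ≫ _) (ab_glueHom h ⟨hk, e, rfl⟩ ξ η))

theorem CutEval.be_glue {r : P.Op k'} (x : Cut (PointedModule.hom p i) (UpperModule.hom h) r) :
    h.be ≫ (CutEval.glue h).eval x = (CutEval.up h).eval x.snd := by
  induction x using Cut.ind with
  | @h _ _ hk A j b e σ hr ξ η =>
  exact (Category.assoc ..).symm.trans (congrArg (· ≫ _) (be_glueHom h ⟨hk, e, rfl⟩ ξ η))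

end Glue

/-- Applying `F` and `G` to the initial cuts of `p` and `q` gives a cut of `r` with a decorated
lower part and one with a decorated upper part. They glue, and the evaluation of the glued cut
restricts to `F` and `G`. -/
theorem exists_desc (h : IsComp p i q w) (hi : IsComp p i (P.one c) p)
    (ho : IsComp (P.one c) 0 q q) {r : Tw P} (F : (⟨n, p⟩ : Tw P) ⟶ r) (G : (⟨m, q⟩ : Tw P) ⟶ r)
    (hFG : hi.be ≫ F = ho.ab ≫ G) : ∃ H : (⟨k, w⟩ : Tw P) ⟶ r, h.ab ≫ H = F ∧ h.be ≫ H = G := by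
  have h1 : IsComp (P.one c) 0 (P.one c) (P.one c) := .one_right _ _ (P.inp_one ..).symm
  obtain ⟨x, hx, hx'⟩ := Cut.exists_glue
    (Cut.map F (Cut.lowUnit (PointedModule.hom p i) (PointedHom.id p i) hi))
    (Cut.map G (Cut.upUnit (UpperModule.hom h) (UpperHom.id h) ho)) (by
      -- Without decorations, both initial cuts are images of the cut `1_c ∘ 1_c` of the identity
      -- operation. So the hypothesis that `F` and `G` agree on `1_c` identifies the two cuts of
      -- `r`.
      have e1 := Cut.map_be (Y := UpperModule.trivial P) PUnit.unit PUnit.unit hi h1 hi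
      have e2 := Cut.map_ab (X := PointedModule.trivial P) PUnit.unit PUnit.unit h1 ho ho
      rw [Cut.snd, Cut.fst, Cut.decorate_map, Cut.decorate_map]
      refine Eq.trans (congrArg (Cut.map F) e1.symm) (Eq.trans ?_ (congrArg (Cut.map G) e2))
      rw [← Cut.map_comp, hFG, Cut.map_comp]
      rfl)
  refine ⟨(CutEval.glue h).eval x, ?_, ?_⟩
  · rw [CutEval.ab_glue, hx, CutEval.eval_map, CutEval.low_lowUnit, Category.id_comp]
  · rw [CutEval.be_glue, hx', CutEval.eval_map, CutEval.up_upUnit, Category.id_comp]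

/-- The cut of `p ∘ᵢ q` decorated by identities evaluates to the identity, so `H` is recovered from
the image of this cut. The two halves of the image depend only on the restrictions of `H` to `p` and
`q`. -/
theorem hom_ext (h : IsComp p i q w) {r : Tw P} {H H' : (⟨k, w⟩ : Tw P) ⟶ r}
    (ha : h.ab ≫ H = h.ab ≫ H') (hb : h.be ≫ H = h.be ≫ H') : H = H' := by
  have hi : IsComp p i (P.one (P.out q)) p := .one_right _ _ h.e
  have ho : IsComp (P.one (P.out q)) 0 q q := .one_left _ _ rfl
  have e1 := Cut.map_ab (X := PointedModule.hom p i) (PointedHom.id p i) PUnit.unit hi ho h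
  have e2 := Cut.map_be (Y := UpperModule.hom h) PUnit.unit (UpperHom.id h) hi ho h
  have key : Cut.map H (Cut.ofComp (PointedHom.id p i) (UpperHom.id h) h :
      Cut (PointedModule.hom p i) (UpperModule.hom h) w) =
      Cut.map H' (Cut.ofComp (PointedHom.id p i) (UpperHom.id h) h) := by
    refine Cut.glue_ext ?_ ?_
    · rw [Cut.fst, Cut.fst, Cut.decorate_map, Cut.decorate_map]
      refine Eq.trans (congrArg (Cut.map H) e1.symm) (Eq.trans ?_ (congrArg (Cut.map H') e1))
      rw [← Cut.map_comp, ha, Cut.map_comp]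
    · rw [Cut.snd, Cut.snd, Cut.decorate_map, Cut.decorate_map]
      refine Eq.trans (congrArg (Cut.map H) e2.symm) (Eq.trans ?_ (congrArg (Cut.map H') e2))
      rw [← Cut.map_comp, hb, Cut.map_comp]
  have := congrArg (CutEval.glue h).eval key
  rwa [CutEval.eval_map, CutEval.eval_map, CutEval.glue_ofComp, Category.id_comp,
    Category.id_comp] at this

/-- The partial composite `p ∘ᵢ q` is the pushout of `p` and `q` over the common colour. -/
theorem isPushout_comp (h : IsComp p i q w) (hi : IsComp p i (P.one c) p)
    (ho : IsComp (P.one c) 0 q q) : IsPushout hi.be ho.ab h.ab h.be where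
  w := hi.be_ab_right h ho (by rw [leafR_zero]; rfl) h
  isColimit' := ⟨Limits.PushoutCocone.IsColimit.mk _
    (fun t => (exists_desc h hi ho t.inl t.inr t.condition).choose)
    (fun t => (exists_desc h hi ho t.inl t.inr t.condition).choose_spec.1)
    (fun t => (exists_desc h hi ho t.inl t.inr t.condition).choose_spec.2)
    (fun t H ha hb => hom_ext h
      (ha.trans (exists_desc h hi ho t.inl t.inr t.condition).choose_spec.1.symm)
      (hb.trans (exists_desc h hi ho t.inl t.inr t.condition).choose_spec.2.symm))⟩

end Pushout

end Tw

end Operad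

/-! ### Pushouts sent to pullbacks, and the reduction of the 2-Segal condition to partial
composites. -/

section PushoutToPullback

variable {C : Type u} [Category.{u} C] (Y : Cᵒᵖ ⥤ Type u)

/-- A pushout square that the presheaf `Y` sends to a pullback square. -/
structure PushoutToPullback {a b c d : C} (f : a ⟶ b) (g : a ⟶ c) (g' : b ⟶ d) (f' : c ⟶ d) :
    Prop where
  isPushout : IsPushout f g g' f'
  isPullback : IsPullback (Y.map g'.op) (Y.map f'.op) (Y.map f.op) (Y.map g.op)

namespace PushoutToPullback

variable {Y} {a b c d : C} {f : a ⟶ b} {g : a ⟶ c} {g' : b ⟶ d} {f' : c ⟶ d}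

theorem of_isIso_left [IsIso f] [IsIso f'] (h : f ≫ g' = g ≫ f') :
    PushoutToPullback Y f g g' f' where
  isPushout := .of_horiz_isIso ⟨h⟩
  isPullback := .of_vert_isIso ⟨by rw [← Y.map_comp, ← Y.map_comp, ← op_comp, ← op_comp, h]⟩

theorem flip (h : PushoutToPullback Y f g g' f') : PushoutToPullback Y g f f' g' :=
  ⟨h.isPushout.flip, h.isPullback.flip⟩

theorem paste {b₂ d₂ : C} {f₂ : b ⟶ b₂} {f₂' : d ⟶ d₂} {g₂ : b₂ ⟶ d₂}
    (h : PushoutToPullback Y f g g' f') (h₂ : PushoutToPullback Y f₂ g' g₂ f₂') :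
    PushoutToPullback Y (f ≫ f₂) g g₂ (f' ≫ f₂') where
  isPushout := h.isPushout.paste_horiz h₂.isPushout
  isPullback := by
    rw [op_comp, op_comp, Y.map_comp, Y.map_comp]
    exact h₂.isPullback.paste_vert h.isPullback

theorem of_left {b₂ d₂ : C} {f₂ : b ⟶ b₂} {f₂' : d ⟶ d₂} {g₂ : b₂ ⟶ d₂}
    (h₂ : PushoutToPullback Y (f ≫ f₂) g g₂ (f' ≫ f₂')) (h : PushoutToPullback Y f g g' f')
    (w : f₂ ≫ g₂ = g' ≫ f₂') : PushoutToPullback Y f₂ g' g₂ f₂' where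
  isPushout := h₂.isPushout.of_left w h.isPushout
  isPullback := by
    have h₃ := h₂.isPullback
    rw [op_comp, op_comp, Y.map_comp, Y.map_comp] at h₃
    exact h₃.of_bot (by rw [← Y.map_comp, ← Y.map_comp, ← op_comp, ← op_comp, w]) h.isPullback

/-- The 2-Segal condition quantifies over all pushout squares, but two pushouts of the same span are
isomorphic, so one good square for each span is enough. -/
theorem isPullback_of_isPushout (h : PushoutToPullback Y f g g' f') {d' : C} {g₁ : b ⟶ d'}
    {f₁ : c ⟶ d'} (h' : IsPushout f g g₁ f₁) :
    IsPullback (Y.map g₁.op) (Y.map f₁.op) (Y.map f.op) (Y.map g.op) := by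
  refine h.isPullback.of_iso (Y.mapIso (h.isPushout.isoIsPushout _ _ h').symm.op) (Iso.refl _)
    (Iso.refl _) (Iso.refl _) ?_ ?_ ?_ ?_
  · rw [Iso.refl_hom, Category.comp_id, Functor.mapIso_hom, Iso.op_hom, ← Y.map_comp, ← op_comp,
      Iso.symm_hom, IsPushout.inl_isoIsPushout_inv]
  · rw [Iso.refl_hom, Category.comp_id, Functor.mapIso_hom, Iso.op_hom, ← Y.map_comp, ← op_comp,
      Iso.symm_hom, IsPushout.inr_isoIsPushout_inv]
  · rw [Iso.refl_hom, Iso.refl_hom, Category.comp_id, Category.id_comp]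
  · rw [Iso.refl_hom, Iso.refl_hom, Category.comp_id, Category.id_comp]

end PushoutToPullback

end PushoutToPullback

namespace Operad

variable {s : OperadKind} {P : Operad.{u} s}

namespace Tw

instance {n : ℕ} {p : P.Op n} (σ : s.perms n) {z : P.Op n} (h : P.act p σ = z) :
    IsIso (permHom σ h) := by
  have h' : P.act z σ⁻¹ = p := by rw [← h, ← P.act_mul, mul_inv_cancel, P.act_one]
  refine ⟨permHom σ⁻¹ h', ?_, ?_⟩
  · rw [permHom_permHom h h' (mul_inv_cancel σ).symm (P.act_one p), permHom_one]
  · rw [permHom_permHom h' h (inv_mul_cancel σ).symm (P.act_one z), permHom_one]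

/-- The presheaf `Y` sends the pushout squares that present partial composites to pullbacks. -/
def SendsComp (Y : (Tw P)ᵒᵖ ⥤ Type u) : Prop :=
  ∀ {n m k : ℕ} {p : P.Op n} {i : Fin n} {q : P.Op m} {w : P.Op k} {c : P.Colour}
    (h : IsComp p i q w) (hi : IsComp p i (P.one c) p) (ho : IsComp (P.one c) 0 q q),
    IsPullback (Y.map h.ab.op) (Y.map h.be.op) (Y.map hi.be.op) (Y.map ho.ab.op)

/-- The morphism `f` keeps the output colour, and the presheaf `Y` sends its pushouts along the
steps `E ↦ A ∘ⱼ E` to pullbacks. -/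
structure IsGood (Y : (Tw P)ᵒᵖ ⥤ Type u) {a b : Tw P} (f : a ⟶ b) : Prop where
  out_eq : P.out b.op = P.out a.op
  exists_square : ∀ {n k k' : ℕ} {A : P.Op n} {j : Fin n} {z : P.Op k} {z' : P.Op k'}
    (h : IsComp A j a.op z) (h' : IsComp A j b.op z'),
    ∃ f' : (⟨k, z⟩ : Tw P) ⟶ ⟨k', z'⟩, PushoutToPullback Y f h.be h'.be f'

namespace IsGood

variable {Y : (Tw P)ᵒᵖ ⥤ Type u}

theorem id (a : Tw P) : IsGood Y (𝟙 a) where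
  out_eq := rfl
  exists_square {_ k k' _ _ z z'} h h' := by
    obtain rfl := Nat.succ.inj (h.hk.symm.trans h'.hk)
    obtain rfl := h.unique h'
    exact ⟨𝟙 _, .of_isIso_left ((Category.id_comp _).trans (Category.comp_id _).symm)⟩

theorem comp {a b c : Tw P} {f : a ⟶ b} {g : b ⟶ c} (hf : IsGood Y f) (hg : IsGood Y g) :
    IsGood Y (f ≫ g) where
  out_eq := hg.out_eq.trans hf.out_eq
  exists_square {_ _ _ _ _ _ _} h h' := by
    obtain ⟨_, w, hw⟩ := IsComp.of_out (hf.out_eq.trans h.e)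
    obtain ⟨f', hf'⟩ := hf.exists_square h hw
    obtain ⟨g', hg'⟩ := hg.exists_square hw h'
    exact ⟨f' ≫ g', hf'.paste hg'⟩

theorem perm {n : ℕ} (p : P.Op n) (σ : s.perms n) (z : P.Op n) (hz : P.act p σ = z) :
    IsGood Y (permHom σ hz) where
  out_eq := by
    subst hz
    exact P.out_act ..
  exists_square {_ k k' A j w w'} h h' := by
    obtain rfl := Nat.succ.inj (h.hk.symm.trans h'.hk)
    have hw := h.act_eq rfl (P.act_one A) hz rfl h'
    exact ⟨permHom _ hw, .of_isIso_left (permHom_be (P.act_one A) hz rfl h h' rfl hw)⟩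

/-- The square from `p` to `p ∘ᵢ q` and `A ∘ⱼ p` is attached to the square presenting `p ∘ᵢ q`. The
resulting rectangle presents the composite of `A ∘ⱼ p` with `q`. Both of these are good, so
cancellation applies. -/
theorem above (hY : SendsComp Y) {n m k : ℕ} {p : P.Op n} {i : Fin n} {q : P.Op m} {z : P.Op k}
    (h₁ : IsComp p i q z) : IsGood Y h₁.ab where
  out_eq := h₁.out_eq
  exists_square {_ k k' A j w w'} h h' := by
    have hi : IsComp p i (P.one (P.out q)) p := .one_right _ _ h₁.e
    have ho : IsComp (P.one (P.out q)) 0 q q := .one_left _ _ rfl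
    have g : IsComp w (leafR h.hk j i) q w' := (h.assoc h₁ rfl).2 h'
    have hi' : IsComp w (leafR h.hk j i) (P.one (P.out q)) w := .one_right _ _ g.e
    refine ⟨g.ab, PushoutToPullback.flip (.of_left (f := hi.be) (g := ho.ab) (f' := h₁.be) ?_
      ⟨isPushout_comp h₁ hi ho, hY h₁ hi ho⟩ (h.be_ab_right g h₁ rfl h'))⟩
    -- The outer legs `1_c ⟶ p ⟶ A ∘ⱼ p` and `q ⟶ p ∘ᵢ q ⟶ A ∘ⱼ (p ∘ᵢ q)` are themselves single
    -- steps placing an operation below the variable.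
    rw [hi.be_be h h rfl hi', h₁.be_be h' h rfl g]
    exact ⟨isPushout_comp g hi' ho, hY g hi' ho⟩

theorem of_isUpper (hY : SendsComp Y) {a b : Tw P} {f : a ⟶ b} (hf : IsUpper P f) :
    IsGood Y f := by
  induction hf with
  | id a => exact .id a
  | above hk p i q e z hz => exact .above hY ⟨hk, e, hz⟩
  | perm p σ z hz => exact .perm p σ z hz
  | comp f g _ _ hf hg => exact hf.comp hg

/-- Inverses are needed because an inert morphism starts with an upper isomorphism, which has to be
moved to the active side of the span. -/
theorem inv {a b : Tw P} {f : a ⟶ b} [IsIso f] (hf : IsGood Y f) : IsGood Y (CategoryTheory.inv f) where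
  out_eq := hf.out_eq.symm
  exists_square {_ _ _ _ _ _ _} h h' := by
    obtain ⟨f', hf'⟩ := hf.exists_square h' h
    have := hf'.isPushout.isIso_inr_of_isIso
    exact ⟨CategoryTheory.inv f', .of_isIso_left (by
      rw [IsIso.inv_comp_eq, ← Category.assoc, IsIso.eq_comp_inv, hf'.isPushout.w])⟩

end IsGood

/-- Up to isomorphisms, the span consists of an upper morphism and a step `x ↦ A ∘ⱼ x`. Its good
pushout comes from `IsGood`, and squares with two opposite sides invertible restore the original
legs. -/
theorem isTwoSegal_of_sendsComp {Y : (Tw P)ᵒᵖ ⥤ Type u} (hY : SendsComp Y) : IsTwoSegal P Y := by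
  rintro a b c d f g g' f' ⟨b₁, u, v, hu, -, hv, rfl⟩ ⟨c₁, u', l, hu', hu'', hl, rfl⟩ hpush
  have h1 : IsGood Y (inv u' ≫ u) := (IsGood.of_isUpper hY hu').inv.comp (.of_isUpper hY hu)
  obtain ⟨hk, A, j, q, e, y, hy, σ, z, hz, -⟩ := hl
  have h : IsComp A j q y := ⟨hk, e, hy⟩
  obtain ⟨_, w, hw⟩ := IsComp.of_out (h1.out_eq.trans e)
  obtain ⟨t, ht⟩ := h1.exists_square h hw
  -- Three squares are pasted on: `e1` replaces `inv u' ≫ u` by `u` and restores `u'` in the inert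
  -- leg, `e3` appends the lower isomorphism `v` to the active leg, and `e5` appends the permutation
  -- contained in the lower morphism.
  have e1 : PushoutToPullback Y u' (u' ≫ h.be) h.be (𝟙 _) :=
    .of_isIso_left (Category.comp_id _).symm
  have e2 := e1.paste ht
  rw [IsIso.hom_inv_id_assoc, Category.id_comp] at e2
  have e3 : PushoutToPullback Y v hw.be (inv v ≫ hw.be) (𝟙 _) :=
    .of_isIso_left ((IsIso.hom_inv_id_assoc v _).trans (Category.comp_id _).symm)
  have e4 := e2.paste e3
  have e5 : PushoutToPullback Y (permHom σ hz) (t ≫ 𝟙 _) (inv (permHom σ hz) ≫ t ≫ 𝟙 _) (𝟙 _) :=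
    .of_isIso_left ((IsIso.hom_inv_id_assoc _ _).trans (Category.comp_id _).symm)
  have e6 := (e4.flip.paste e5).flip
  rw [Category.assoc] at e6
  exact e6.isPullback_of_isPushout hpush

end Tw

end Operad

/-! ### Discrete fibrations between twisted arrow categories and partial composites. -/

theorem IsDiscreteFibration.hom_eq {E : Type u} [Category.{u} E] {B : Type u} [Category.{u} B]
    {F : E ⥤ B} (hF : IsDiscreteFibration F) {b b' : B} (g : b ⟶ b') {e₁ e : E} (h h' : e₁ ⟶ e)
    (hh : F.IsHomLift g h) (hh' : F.IsHomLift g h') : h = h' := by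
  have := (hF g e (IsHomLift.codomain_eq F g h)).unique (y₁ := ⟨e₁, h⟩) (y₂ := ⟨e₁, h'⟩) hh hh'
  cases this
  rfl

theorem IsDiscreteFibration.source_heq {E : Type u} [Category.{u} E] {B : Type u} [Category.{u} B]
    {F : E ⥤ B} (hF : IsDiscreteFibration F) {b b' : B} (g : b ⟶ b') {e₁ e₂ e : E} (h : e₁ ⟶ e)
    (h' : e₂ ⟶ e) (hh : F.IsHomLift g h) (hh' : F.IsHomLift g h') : e₁ = e₂ :=
  congrArg Sigma.fst ((hF g e (IsHomLift.codomain_eq F g h)).unique (y₁ := ⟨e₁, h⟩)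
    (y₂ := ⟨e₂, h'⟩) hh hh')

namespace Operad

variable {s : OperadKind} {P P₁ : Operad.{u} s}

theorem IsComp.hom (f : P₁ ⟶ P) {n m k : ℕ} {p : P₁.Op n} {i : Fin n} {q : P₁.Op m} {w : P₁.Op k}
    (h : IsComp p i q w) : IsComp (Hom.op f p) i (Hom.op f q) (Hom.op f w) := by
  obtain ⟨hk, e, rfl⟩ := h
  exact ⟨hk, Hom.compat f e, (Hom.op_comp f hk p i q e (Hom.compat f e)).symm⟩

namespace Tw

/-- Only one leaf lies above the variable, so the order condition on leaves is vacuous. -/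
theorem isInert_be {n : ℕ} {p : P.Op n} {i : Fin n} {c : P.Colour} (h : IsComp p i (P.one c) p) :
    IsInert P h.be := by
  refine ⟨_, 𝟙 _, h.be ≫ permHom 1 (P.act_one p), .id _, inferInstance,
    .mk h.hk p i _ h.e p h.eq 1 p (P.act_one p) ?_, ?_⟩
  · intro b b' hb
    exact absurd (Subsingleton.elim b b') hb.ne
  · rw [permHom_one, Category.comp_id, Category.id_comp]

theorem isActive_ab {n m k : ℕ} {p : P.Op n} {i : Fin n} {q : P.Op m} {w : P.Op k}
    (h : IsComp p i q w) : IsActive P h.ab := by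
  have ho : IsComp (P.one (P.out w)) 0 w w := .one_left _ _ rfl
  -- The identity of `w`, written as the lower morphism `x ↦ 1 ∘ x` with trivial permutation. It
  -- serves as the lower isomorphism of an active morphism.
  have hid : ho.be ≫ permHom 1 (P.act_one w) = 𝟙 _ := by
    rw [permHom_one, Category.comp_id, ho.be_one]
  refine ⟨_, h.ab, ho.be ≫ permHom 1 (P.act_one w), .above .., ?_, ?_, ?_⟩
  · refine .mk ho.hk _ 0 w ho.e w ho.eq 1 w (P.act_one w) ?_
    intro b b' hb
    exact Nat.add_lt_add_left hb 0
  · rw [hid]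
    infer_instance
  · rw [hid, Category.comp_id]

/-- The defining span of a partial composite has one active and one inert leg, so `SendsComp` is an
instance of the 2-Segal condition. -/
theorem IsTwoSegal.sendsComp {Y : (Tw P)ᵒᵖ ⥤ Type u} (hY : IsTwoSegal P Y) : SendsComp Y :=
  fun h hi ho => (hY _ _ _ _ (isActive_ab ho) (isInert_be hi) (isPushout_comp h hi ho).flip).flip

theorem eq_eqToHom {n m k k' : ℕ} {p : P.Op n} {i : Fin n} {q : P.Op m} {w : P.Op k} {w' : P.Op k'}
    (h : IsComp p i q w) (h' : IsComp p i q w') {H : (⟨k, w⟩ : Tw P) ⟶ ⟨k', w'⟩}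
    (ha : h.ab ≫ H = h'.ab) (hb : h.be ≫ H = h'.be) : H = eqToHom (h.tw_eq h') := by
  obtain rfl := Nat.succ.inj (h.hk.symm.trans h'.hk)
  obtain rfl := h.unique h'
  exact hom_ext h (ha.trans (Category.comp_id _).symm) (hb.trans (Category.comp_id _).symm)

section Fibres

variable {f : P₁ ⟶ P}

theorem exists_of_fibre {n : ℕ} {p : P.Op n} (x : {e : Tw P₁ // (map f).obj e = ⟨n, p⟩}) :
    ∃ (p₁ : P₁.Op n) (hp : Hom.op f p₁ = p), x = ⟨⟨n, p₁⟩, by rw [← hp]; rfl⟩ := by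
  obtain ⟨⟨n₁, p₁⟩, h⟩ := x
  cases h
  exact ⟨p₁, rfl, rfl⟩

/-- The element of the fibre given by an operation. -/
def fibreMk (f : P₁ ⟶ P) {n : ℕ} {p : P.Op n} (p₁ : P₁.Op n) (hp : Hom.op f p₁ = p) :
    {e : Tw P₁ // (map f).obj e = ⟨n, p⟩} := ⟨⟨n, p₁⟩, by rw [← hp]; rfl⟩

theorem fibreMk_injective {n : ℕ} {p : P.Op n} {p₁ p₂ : P₁.Op n} {hp : Hom.op f p₁ = p}
    {hp' : Hom.op f p₂ = p} (h : fibreMk f p₁ hp = fibreMk f p₂ hp') : p₁ = p₂ := by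
  cases h
  rfl

variable (hf : IsDiscreteFibration (map f))

variable {n m k : ℕ} {p₁ : P₁.Op n} {i : Fin n} {q₁ : P₁.Op m} {w₁ : P₁.Op k}
  {p : P.Op n} {q : P.Op m} {w : P.Op k}

theorem isHomLift_ab (h₁ : IsComp p₁ i q₁ w₁) (h : IsComp p i q w) (hp : Hom.op f p₁ = p)
    (hq : Hom.op f q₁ = q) (hw : Hom.op f w₁ = w) : (map f).IsHomLift h.ab h₁.ab := by
  subst hp hq hw
  exact IsHomLift.map (map f) h₁.ab

theorem isHomLift_be (h₁ : IsComp p₁ i q₁ w₁) (h : IsComp p i q w) (hp : Hom.op f p₁ = p)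
    (hq : Hom.op f q₁ = q) (hw : Hom.op f w₁ = w) : (map f).IsHomLift h.be h₁.be := by
  subst hp hq hw
  exact IsHomLift.map (map f) h₁.be

theorem isHomLift_permHom {σ : s.perms n} {pσ : P.Op n} {pσ₁ : P₁.Op n} (h₁ : P₁.act p₁ σ = pσ₁)
    (h : P.act p σ = pσ) (hp : Hom.op f p₁ = p) (hσ : Hom.op f pσ₁ = pσ) :
    (map f).IsHomLift (permHom σ h) (permHom σ h₁) := by
  subst hp hσ
  exact IsHomLift.map (map f) (permHom σ h₁)

theorem source_ab (h₁ : IsComp p₁ i q₁ w₁) (h : IsComp p i q w) (hp : Hom.op f p₁ = p)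
    (hq : Hom.op f q₁ = q) (hw : Hom.op f w₁ = w) :
    hf.source h.ab (fibreMk f w₁ hw) = fibreMk f p₁ hp :=
  hf.source_eq _ _ _ h₁.ab (isHomLift_ab h₁ h hp hq hw)

theorem source_be (h₁ : IsComp p₁ i q₁ w₁) (h : IsComp p i q w) (hp : Hom.op f p₁ = p)
    (hq : Hom.op f q₁ = q) (hw : Hom.op f w₁ = w) :
    hf.source h.be (fibreMk f w₁ hw) = fibreMk f q₁ hq :=
  hf.source_eq _ _ _ h₁.be (isHomLift_be h₁ h hp hq hw)

theorem source_permHom {σ : s.perms n} {pσ : P.Op n} {pσ₁ : P₁.Op n} (h₁ : P₁.act p₁ σ = pσ₁)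
    (h : P.act p σ = pσ) (hp : Hom.op f p₁ = p) (hσ : Hom.op f pσ₁ = pσ) :
    hf.source (permHom σ h) (fibreMk f pσ₁ hσ) = fibreMk f p₁ hp :=
  hf.source_eq _ _ _ (permHom σ h₁) (isHomLift_permHom h₁ h hp hσ)

/-- A composite in the total operad is determined by its image and its restrictions. -/
theorem isComp_of_source (h₁ : P₁.out q₁ = P₁.inp p₁ i) (h : IsComp p i q w)
    (hp : Hom.op f p₁ = p) (hq : Hom.op f q₁ = q) (hw : Hom.op f w₁ = w)
    (hab : hf.source h.ab (fibreMk f w₁ hw) = fibreMk f p₁ hp)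
    (hbe : hf.source h.be (fibreMk f w₁ hw) = fibreMk f q₁ hq) : IsComp p₁ i q₁ w₁ := by
  subst hp hq hw
  obtain ⟨F, hF⟩ := hf.source_spec h.ab (fibreMk f w₁ rfl)
  obtain ⟨G, hG⟩ := hf.source_spec h.be (fibreMk f w₁ rfl)
  -- The lifts with target `w₁` start at their abstract sources; the hypotheses identify these
  -- sources with `p₁` and `q₁`.
  revert F G
  rw [hab, hbe]
  intro F hF G hG
  obtain ⟨k', w', h'⟩ := IsComp.of_out h₁
  have hi : IsComp p₁ i (P₁.one (P₁.out q₁)) p₁ := .one_right _ _ h'.e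
  have ho : IsComp (P₁.one (P₁.out q₁)) 0 q₁ q₁ := .one_left _ _ rfl
  obtain ⟨H, hHa, hHb⟩ := exists_desc h' hi ho F G (by
    have e : (hi.hom f).be ≫ h.ab = (ho.hom f).ab ≫ h.be :=
      (hi.hom f).be_ab_right h (ho.hom f) (by rw [leafR_zero]; rfl) h
    -- The two morphisms from the identity operation to `w₁` lift the same morphism of `Tw P`, so
    -- they are equal and `F`, `G` descend to the composite of `p₁` and `q₁`.
    refine hf.hom_eq ((hi.hom f).be ≫ h.ab) _ _ ?_ ?_
    · exact @IsHomLift.comp _ _ _ _ (map f) _ _ _ _ _ _ _ _ _ _ (isHomLift_be hi _ rfl rfl rfl) hF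
    · rw [e]
      exact @IsHomLift.comp _ _ _ _ (map f) _ _ _ _ _ _ _ _ _ _ (isHomLift_ab ho _ rfl rfl rfl) hG)
  have hH : (map f).map H = eqToHom ((h'.hom f).tw_eq h) := by
    refine eq_eqToHom (h'.hom f) h ?_ ?_
    · refine ((map f).map_comp h'.ab H).symm.trans ?_
      rw [hHa]
      exact (@IsHomLift.eq_of_isHomLift _ _ _ _ (map f) ⟨n, p₁⟩ ⟨k, w₁⟩ h.ab F hF).symm
    · refine ((map f).map_comp h'.be H).symm.trans ?_
      rw [hHb]
      exact (@IsHomLift.eq_of_isHomLift _ _ _ _ (map f) ⟨m, q₁⟩ ⟨k, w₁⟩ h.be G hG).symm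
  -- Thus `H` is a lift of an identity with target `w₁`, as is the identity of `w₁`. Uniqueness of
  -- lifts then makes the composite `w'` equal to `w₁`.
  have hlift : (map f).IsHomLift (𝟙 ((map f).obj ⟨k, w₁⟩)) H := by
    refine IsHomLift.of_fac _ _ _ ((h'.hom f).tw_eq h) rfl ?_
    rw [hH]
    exact ((congrArg (_ ≫ ·) (eqToHom_trans _ _)).trans
      ((eqToHom_trans _ _).trans (eqToHom_refl _ _))).symm
  have := hf.source_heq _ H (𝟙 _) hlift (IsHomLift.id rfl)
  cases this
  exact h'

/-- The two sources are the identity operations of the colours `P₁.inp p₁ i` and `P₁.out q₁`, and an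
identity operation determines its colour as its output. -/
theorem out_eq_inp_of_source {c : P.Colour} (hi : IsComp p i (P.one c) p)
    (ho : IsComp (P.one c) 0 q q) (hp : Hom.op f p₁ = p) (hq : Hom.op f q₁ = q)
    (h : hf.source hi.be (fibreMk f p₁ hp) = hf.source ho.ab (fibreMk f q₁ hq)) :
    P₁.out q₁ = P₁.inp p₁ i := by
  subst hp hq
  have h1 : f.colour (P₁.inp p₁ i) = c := by rw [← Hom.inp_op f, ← hi.e, P.out_one]
  have h2 : f.colour (P₁.out q₁) = c := by rw [← Hom.out_op f, ho.e, P.inp_one]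
  rw [source_be hf (.one_right p₁ i rfl) hi rfl (by rw [Hom.op_one f, h1]) rfl,
    source_ab hf (.one_left q₁ 0 rfl) ho (by rw [Hom.op_one f, h2]) rfl rfl] at h
  have := congrArg P₁.out (fibreMk_injective h)
  rw [P₁.out_one, P₁.out_one] at this
  exact this.symm

theorem source_be_eq_source_ab {c : P.Colour} (h : IsComp p i q w) (hi : IsComp p i (P.one c) p)
    (ho : IsComp (P.one c) 0 q q) (x : {e : Tw P₁ // (map f).obj e = ⟨k, w⟩}) :
    hf.source hi.be (hf.source h.ab x) = hf.source ho.ab (hf.source h.be x) := by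
  have h1 : hf.presheaf.map h.ab.op ≫ hf.presheaf.map hi.be.op =
      hf.presheaf.map h.be.op ≫ hf.presheaf.map ho.ab.op := by
    rw [← Functor.map_comp, ← Functor.map_comp, ← op_comp, ← op_comp, (isPushout_comp h hi ho).w]
  exact ConcreteCategory.congr_hom h1 x

theorem isComp_of_source_eq (h : IsComp p i q w) (hp : Hom.op f p₁ = p) (hq : Hom.op f q₁ = q)
    (hw : Hom.op f w₁ = w) (hab : hf.source h.ab (fibreMk f w₁ hw) = fibreMk f p₁ hp)
    (hbe : hf.source h.be (fibreMk f w₁ hw) = fibreMk f q₁ hq) : IsComp p₁ i q₁ w₁ := by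
  have hi : IsComp p i (P.one (P.out q)) p := .one_right _ _ h.e
  have ho : IsComp (P.one (P.out q)) 0 q q := .one_left _ _ rfl
  have h1 := source_be_eq_source_ab hf h hi ho (fibreMk f w₁ hw)
  rw [hab, hbe] at h1
  exact isComp_of_source hf (out_eq_inp_of_source hf hi ho hp hq h1) h hp hq hw hab hbe

/-- Compatible elements of the fibres are composable in `P₁`, which gives existence. Two elements
with the same restrictions are both composites of the same operations, which gives uniqueness. -/
theorem sendsComp_presheaf : SendsComp hf.presheaf := by
  intro n m k p i q w c h hi ho
  rw [Limits.Types.isPullback_iff]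
  refine ⟨?_, ?_, ?_⟩
  · rw [← Functor.map_comp, ← Functor.map_comp, ← op_comp, ← op_comp, (isPushout_comp h hi ho).w]
  · rintro x y ⟨hab, hbe⟩
    obtain ⟨w₁, rfl, rfl⟩ := exists_of_fibre x
    obtain ⟨w₂, hw, rfl⟩ := exists_of_fibre y
    obtain ⟨p₁, hp, hp₁⟩ := exists_of_fibre (hf.source h.ab (fibreMk f w₁ rfl))
    obtain ⟨q₁, hq, hq₁⟩ := exists_of_fibre (hf.source h.be (fibreMk f w₁ rfl))
    have h1 := isComp_of_source_eq hf h hp hq rfl hp₁ hq₁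
    have h2 := isComp_of_source_eq hf h hp hq hw (hab.symm.trans hp₁) (hbe.symm.trans hq₁)
    cases h1.unique h2
    rfl
  · intro x y hxy
    obtain ⟨p₁, rfl, rfl⟩ := exists_of_fibre x
    obtain ⟨q₁, rfl, rfl⟩ := exists_of_fibre y
    have h' := IsComp.of_comp h.hk p₁ i q₁ (out_eq_inp_of_source hf hi ho rfl rfl hxy)
    have hw := (h'.hom f).unique h
    exact ⟨fibreMk f _ hw, source_ab hf h' h rfl rfl hw, source_be hf h' h rfl rfl hw⟩

end Fibres

end Tw

end Operad

namespace Operad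

variable {s : OperadKind} {P : Operad.{u} s}

namespace Tw

/-! ## The operad of elements of a 2-Segal presheaf -/

section Restriction

variable (Y : (Tw P)ᵒᵖ ⥤ Type u) {a b c : Tw P}

/-- The restriction of an element of a presheaf along a morphism. -/
def res (g : a ⟶ b) (y : Y.obj (Opposite.op b)) : Y.obj (Opposite.op a) := Y.map g.op y

theorem res_id (y : Y.obj (Opposite.op a)) : res Y (𝟙 a) y = y :=
  ConcreteCategory.congr_hom (Y.map_id _) y

theorem res_comp (f : a ⟶ b) (g : b ⟶ c) (y : Y.obj (Opposite.op c)) :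
    res Y (f ≫ g) y = res Y f (res Y g y) :=
  ConcreteCategory.congr_hom (Y.map_comp g.op f.op) y

theorem res_res_eq {b' : Tw P} {f : a ⟶ b} {g : b ⟶ c} {f' : a ⟶ b'} {g' : b' ⟶ c}
    (h : f ≫ g = f' ≫ g') (y : Y.obj (Opposite.op c)) :
    res Y f (res Y g y) = res Y f' (res Y g' y) := by
  rw [← res_comp, h, res_comp]

theorem res_res {f : a ⟶ b} {g : b ⟶ c} {h : a ⟶ c} (e : f ≫ g = h) (y : Y.obj (Opposite.op c)) :
    res Y f (res Y g y) = res Y h y := by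
  rw [← res_comp, e]

theorem res_injective (g : a ⟶ b) [IsIso g] : Function.Injective (res Y g) := by
  intro y y' h
  have := congrArg (res Y (inv g)) h
  rwa [res_res Y (IsIso.inv_hom_id g), res_res Y (IsIso.inv_hom_id g), res_id, res_id] at this

end Restriction

/-- The elements of a presheaf over the operations with `n` inputs. -/
abbrev Elt (Y : (Tw P)ᵒᵖ ⥤ Type u) (n : ℕ) : Type u :=
  Σ p : P.Op n, Y.obj (Opposite.op ⟨n, p⟩)

/-- The elements of a presheaf over the identity operations. -/
abbrev EltColour (Y : (Tw P)ᵒᵖ ⥤ Type u) : Type u :=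
  Σ c : P.Colour, Y.obj (Opposite.op ⟨1, P.one c⟩)

variable {Y : (Tw P)ᵒᵖ ⥤ Type u} {n m l k k₁ k₂ : ℕ}

/-- The colour of an input of an element of a presheaf. -/
def Elt.inp (X : Elt Y n) (i : Fin n) : EltColour Y :=
  ⟨P.inp X.1 i, res Y (IsComp.one_right X.1 i rfl).be X.2⟩

/-- The colour of the output of an element of a presheaf. -/
def Elt.out (X : Elt Y n) : EltColour Y :=
  ⟨P.out X.1, res Y (IsComp.one_left X.1 0 rfl).ab X.2⟩

/-- The colour is a variable here, since two elements with propositionally equal colours have to be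
compared over one and the same identity operation. -/
theorem Elt.inp_eq {X : Elt Y n} {i : Fin n} {c : P.Colour} (h : IsComp X.1 i (P.one c) X.1) :
    X.inp i = ⟨c, res Y h.be X.2⟩ := by
  have hc := h.e
  rw [P.out_one] at hc
  subst hc
  rfl

theorem Elt.out_eq {X : Elt Y n} {c : P.Colour} (h : IsComp (P.one c) 0 X.1 X.1) :
    X.out = ⟨c, res Y h.ab X.2⟩ := by
  have hc := h.e
  rw [P.inp_one] at hc
  subst hc
  rfl

theorem Elt.inp_congr {X : Elt Y n} {i : Fin n} {X' : Elt Y m} {j : Fin m} {c : P.Colour}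
    (h : IsComp X.1 i (P.one c) X.1) (h' : IsComp X'.1 j (P.one c) X'.1)
    (e : res Y h.be X.2 = res Y h'.be X'.2) : X.inp i = X'.inp j := by
  rw [Elt.inp_eq h, Elt.inp_eq h', e]

theorem Elt.out_congr {X : Elt Y n} {X' : Elt Y m} {c : P.Colour}
    (h : IsComp (P.one c) 0 X.1 X.1) (h' : IsComp (P.one c) 0 X'.1 X'.1)
    (e : res Y h.ab X.2 = res Y h'.ab X'.2) : X.out = X'.out := by
  rw [Elt.out_eq h, Elt.out_eq h', e]

theorem Elt.inp_one (c : EltColour Y) (a : Fin 1) :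
    Elt.inp (Y := Y) ⟨P.one c.1, c.2⟩ a = c := by
  have h : IsComp (P.one c.1) a (P.one c.1) (P.one c.1) := .one_right _ _ (P.inp_one ..).symm
  refine (Elt.inp_eq (X := ⟨P.one c.1, c.2⟩) h).trans ?_
  rw [h.be_one]
  exact congrArg _ (res_id ..)

theorem Elt.out_one (c : EltColour Y) : Elt.out (Y := Y) ⟨P.one c.1, c.2⟩ = c := by
  have h : IsComp (P.one c.1) 0 (P.one c.1) (P.one c.1) := .one_left _ _ (P.out_one ..)
  refine (Elt.out_eq (X := ⟨P.one c.1, c.2⟩) h).trans ?_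
  rw [h.ab_one]
  exact congrArg _ (res_id ..)

/-- The element `W` restricts to `X` and `Q` along the two morphisms into a composite. -/
structure Glue (X : Elt Y n) (i : Fin n) (Q : Elt Y m) (W : Elt Y k) : Prop where
  comp : IsComp X.1 i Q.1 W.1
  ab : res Y comp.ab W.2 = X.2
  be : res Y comp.be W.2 = Q.2

/-- The element `W` restricts to `X` along the morphism from an operation to its image under a
permutation. -/
structure Moved (X : Elt Y n) (σ : s.perms n) (W : Elt Y n) : Prop where
  act : P.act X.1 σ = W.1
  perm : res Y (permHom σ act) W.2 = X.2

theorem SendsComp.ext (hY : SendsComp Y) {p : P.Op n} {i : Fin n} {q : P.Op m} {w : P.Op k}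
    (h : IsComp p i q w) {y y' : Y.obj (Opposite.op ⟨k, w⟩)} (hab : res Y h.ab y = res Y h.ab y')
    (hbe : res Y h.be y = res Y h.be y') : y = y' :=
  Limits.Types.ext_of_isPullback (hY h (.one_right _ _ h.e) (.one_left _ _ rfl)) hab hbe

/-- Equality of the colours of elements is precisely the matching condition of the pullback, so it
supplies the element over the composite. -/
theorem SendsComp.exists_glue (hY : SendsComp Y) {X : Elt Y n} {i : Fin n} {Q : Elt Y m}
    {w : P.Op k} (e : Q.out = X.inp i) (h : IsComp X.1 i Q.1 w) :
    ∃ y : Y.obj (Opposite.op ⟨k, w⟩), Glue X i Q ⟨w, y⟩ := by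
  have hi : IsComp X.1 i (P.one (P.out Q.1)) X.1 := .one_right _ _ h.e
  have ho : IsComp (P.one (P.out Q.1)) 0 Q.1 Q.1 := .one_left _ _ rfl
  rw [Elt.inp_eq hi, Elt.out_eq ho] at e
  obtain ⟨y, h1, h2⟩ := Limits.Types.exists_of_isPullback (hY h hi ho) X.2 Q.2
    (eq_of_heq (Sigma.mk.inj e).2).symm
  exact ⟨y, h, h1, h2⟩

namespace Glue

theorem unique (hY : SendsComp Y) {X : Elt Y n} {i : Fin n} {Q : Elt Y m} {W W' : Elt Y k}
    (h : Glue X i Q W) (h' : Glue X i Q W') : W = W' := by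
  obtain ⟨w, y⟩ := W
  obtain ⟨w', y'⟩ := W'
  obtain rfl : w = w' := h.comp.unique h'.comp
  exact congrArg (Sigma.mk w) (hY.ext h.comp (h.ab.trans h'.ab.symm) (h.be.trans h'.be.symm))

theorem inp_left {X : Elt Y n} {i : Fin n} {Q : Elt Y m} {W : Elt Y k} (h : Glue X i Q W)
    {a : Fin n} (ha : a ≠ i) : W.inp (leafL h.comp.hk i a ha) = X.inp a := by
  have h₁ : IsComp X.1 a (P.one (P.inp X.1 a)) X.1 := .one_right _ _ rfl
  have h₄ : IsComp W.1 (leafL h.comp.hk i a ha) (P.one (P.inp X.1 a)) W.1 :=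
    .one_right _ _ (h.comp.inp_left ha rfl).symm
  refine Elt.inp_congr h₄ h₁ ?_
  rw [← h.ab, res_res Y (h₁.be_ab_left h.comp ha.symm (leafL_one ..).symm h.comp h₄ rfl)]

theorem inp_right {X : Elt Y n} {i : Fin n} {Q : Elt Y m} {W : Elt Y k} (h : Glue X i Q W)
    (b : Fin m) : W.inp (leafR h.comp.hk i b) = Q.inp b := by
  have h₃ : IsComp Q.1 b (P.one (P.inp Q.1 b)) Q.1 := .one_right _ _ rfl
  have h₂ : IsComp W.1 (leafR h.comp.hk i b) (P.one (P.inp Q.1 b)) W.1 :=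
    .one_right _ _ (h.comp.inp_right rfl).symm
  refine Elt.inp_congr h₂ h₃ ?_
  rw [← h.be, res_res Y (h₃.be_be h.comp h.comp rfl h₂)]

theorem out_eq {X : Elt Y n} {i : Fin n} {Q : Elt Y m} {W : Elt Y k} (h : Glue X i Q W) :
    W.out = X.out := by
  have h₁ : IsComp (P.one (P.out X.1)) 0 X.1 X.1 := .one_left _ _ rfl
  have h₄ : IsComp (P.one (P.out X.1)) 0 W.1 W.1 := .one_left _ _ h.comp.out_eq
  refine Elt.out_congr h₄ h₁ ?_
  rw [← h.ab, res_res Y (h₁.ab_ab_right h.comp h.comp (leafR_one ..).symm h₄)]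

/-- By the uniqueness part of the pullback, the restriction of `W` to the composite of `Q` and `R`
is determined by its restrictions to these two. The relations of `Tw P` compute them through the
other bracketing. -/
theorem assoc (hY : SendsComp Y) {X : Elt Y n} {i : Fin n} {Q : Elt Y m} {j : Fin m} {R : Elt Y l}
    {XQ : Elt Y k₁} {QR : Elt Y k₂} {t : Fin k₁} {W : Elt Y k} (h₁ : Glue X i Q XQ)
    (h₃ : Glue Q j R QR) (ht : t = leafR h₁.comp.hk i j) (h₂ : Glue XQ t R W) : Glue X i QR W := by
  have h₄ := (h₁.comp.assoc h₃.comp ht).1 h₂.comp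
  refine ⟨h₄, ?_, hY.ext h₃.comp ?_ ?_⟩
  · rw [← res_res Y (h₁.comp.ab_ab_right h₂.comp h₃.comp ht h₄), h₂.ab, h₁.ab]
  · rw [← res_res_eq Y (h₁.comp.be_ab_right h₂.comp h₃.comp ht h₄), h₂.ab, h₁.be, h₃.ab]
  · rw [res_res Y (h₃.comp.be_be h₄ h₁.comp ht h₂.comp), h₂.be, h₃.be]

theorem parallel (hY : SendsComp Y) {X : Elt Y n} {i a : Fin n} (ha : a ≠ i) {Q : Elt Y m}
    {R : Elt Y l} {XQ : Elt Y k₁} {XR : Elt Y k₂} {t : Fin k₁} {t' : Fin k₂} {W : Elt Y k}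
    (h₁ : Glue X i Q XQ) (h₃ : Glue X a R XR) (ht : t = leafL h₁.comp.hk i a ha)
    (ht' : t' = leafL h₃.comp.hk a i ha.symm) (h₂ : Glue XQ t R W) : Glue XR t' Q W := by
  have h₄ := h₁.comp.parallel ha h₃.comp ht ht' h₂.comp
  refine ⟨h₄, hY.ext h₃.comp ?_ ?_, ?_⟩
  · rw [← res_res_eq Y (h₁.comp.ab_ab_left h₂.comp ha ht h₃.comp h₄ ht'), h₂.ab, h₁.ab, h₃.ab]
  · rw [res_res Y (h₃.comp.be_ab_left h₄ ha.symm ht' h₁.comp h₂.comp ht), h₂.be, h₃.be]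
  · rw [← res_res Y (h₁.comp.be_ab_left h₂.comp ha ht h₃.comp h₄ ht'), h₂.ab, h₁.be]

theorem one_right {X : Elt Y n} {i : Fin n} {c : EltColour Y} (h : c = X.inp i) :
    Glue X i (⟨P.one c.1, c.2⟩ : Elt Y 1) X := by
  subst h
  refine ⟨.one_right _ _ rfl, ?_, rfl⟩
  rw [IsComp.ab_one]
  exact res_id ..

theorem one_left {X : Elt Y n} {i : Fin 1} {c : EltColour Y} (h : X.out = c) :
    Glue (⟨P.one c.1, c.2⟩ : Elt Y 1) i X X := by
  obtain rfl := Subsingleton.elim 0 i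
  subst h
  refine ⟨.one_left _ _ rfl, rfl, ?_⟩
  rw [IsComp.be_one]
  exact res_id ..

end Glue

namespace Moved

variable {X W W' : Elt Y n} {σ τ : s.perms n}

theorem unique (h : Moved X σ W) (h' : Moved X σ W') : W = W' := by
  obtain ⟨w, y⟩ := W
  obtain ⟨w', y'⟩ := W'
  obtain rfl : w = w' := h.act.symm.trans h'.act
  exact congrArg (Sigma.mk w) (res_injective Y _ (h.perm.trans h'.perm.symm))

/-- The morphism `p ⟶ p^σ` is an isomorphism, so restriction along its inverse transports the
element. -/
theorem exists_moved (X : Elt Y n) (σ : s.perms n) :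
    ∃ y : Y.obj (Opposite.op ⟨n, P.act X.1 σ⟩), Moved X σ ⟨P.act X.1 σ, y⟩ :=
  ⟨res Y (inv (permHom σ rfl)) X.2, rfl, by rw [res_res Y (IsIso.hom_inv_id _), res_id]⟩

theorem one : Moved X 1 X := ⟨P.act_one _, by rw [permHom_one, res_id]⟩

theorem mul (h : Moved X σ W) (h' : Moved W τ W') : Moved X (σ * τ) W' := by
  have e : P.act X.1 (σ * τ) = W'.1 := by rw [P.act_mul, h.act, h'.act]
  exact ⟨e, by rw [← res_res Y (permHom_permHom h.act h'.act rfl e), h'.perm, h.perm]⟩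

theorem inp_eq (h : Moved X σ W) (a : Fin n) : W.inp a = X.inp (σ.1 a) := by
  have hi : IsComp X.1 (σ.1 a) (P.one (P.inp X.1 (σ.1 a))) X.1 := .one_right _ _ rfl
  have hi' : IsComp W.1 a (P.one (P.inp X.1 (σ.1 a))) W.1 :=
    .one_right _ _ (by rw [← h.act, P.inp_act])
  refine Elt.inp_congr hi' hi ?_
  have := permHom_be h.act (P.act_one _) rfl hi hi' (s.block_unit_right hi.hk a σ 1).symm h.act
  rw [permHom_one, Category.id_comp] at this
  rw [← h.perm, ← res_comp, this]

theorem out_eq (h : Moved X σ W) : W.out = X.out := by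
  have ho : IsComp (P.one (P.out X.1)) 0 X.1 X.1 := .one_left _ _ rfl
  have ho' : IsComp (P.one (P.out X.1)) 0 W.1 W.1 := .one_left _ _ (by rw [← h.act, P.out_act])
  refine Elt.out_congr ho' ho ?_
  have := permHom_ab (P.act_one _) h.act rfl ho ho' (by rw [s.block_unit_left]) h.act
  rw [permHom_one, Category.id_comp] at this
  rw [← h.perm, ← res_comp, this]
  rfl

/-- Both restrictions may be compared after a further restriction along the invertible morphisms of
the permutations, where the equivariance relations of `Tw P` apply. -/
theorem glue {i i' : Fin n} {Q Qτ : Elt Y m} {Z Zρ : Elt Y k} {τ : s.perms m} {ρ : s.perms k}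
    (h : Moved X σ W) (h' : Moved Q τ Qτ) (g : Glue X i' Q Z) (hi : i' = σ.1 i)
    (hρ : ρ = s.block g.comp.hk i σ τ) (hz : Moved Z ρ Zρ) : Glue W i Qτ Zρ := by
  have g' := g.comp.act hi h.act h'.act hρ hz.act
  refine ⟨g', res_injective Y (permHom σ h.act) ?_, res_injective Y (permHom τ h'.act) ?_⟩
  · rw [res_res_eq Y (permHom_ab h.act h'.act hi g.comp g' hρ hz.act), hz.perm, g.ab, h.perm]
  · rw [res_res_eq Y (permHom_be h.act h'.act hi g.comp g' hρ hz.act), hz.perm, g.be, h'.perm]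

end Moved

namespace SendsComp

variable (hY : SendsComp Y)

/-- The composite of two elements. -/
noncomputable def comp (hk : n + m = k + 1) (X : Elt Y n) (i : Fin n) (Q : Elt Y m)
    (e : Q.out = X.inp i) : Elt Y k :=
  ⟨_, (hY.exists_glue e (.of_comp hk X.1 i Q.1 (congrArg Sigma.fst e))).choose⟩

theorem glue_comp (hk : n + m = k + 1) (X : Elt Y n) (i : Fin n) (Q : Elt Y m)
    (e : Q.out = X.inp i) : Glue X i Q (hY.comp hk X i Q e) :=
  (hY.exists_glue e (.of_comp hk X.1 i Q.1 (congrArg Sigma.fst e))).choose_spec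

theorem comp_eq {hk : n + m = k + 1} {X : Elt Y n} {i : Fin n} {Q : Elt Y m}
    {e : Q.out = X.inp i} {W : Elt Y k} (h : Glue X i Q W) : hY.comp hk X i Q e = W :=
  (hY.glue_comp hk X i Q e).unique hY h

end SendsComp

/-- The image of an element under a permutation. -/
noncomputable def Elt.act (X : Elt Y n) (σ : s.perms n) : Elt Y n :=
  ⟨_, (Moved.exists_moved X σ).choose⟩

theorem Elt.moved_act (X : Elt Y n) (σ : s.perms n) : Moved X σ (X.act σ) :=
  (Moved.exists_moved X σ).choose_spec

/-- The operad whose operations are the elements of a 2-Segal presheaf. -/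
noncomputable def SendsComp.elements (hY : SendsComp Y) : Operad.{u} s where
  Colour := EltColour Y
  Op n := Elt Y n
  inp := Elt.inp
  out := Elt.out
  one c := ⟨P.one c.1, c.2⟩
  comp hk X i Q e := hY.comp hk X i Q e
  act := Elt.act
  inp_one := Elt.inp_one
  out_one := Elt.out_one
  inp_comp_left hk X i Q e _ ha := (hY.glue_comp hk X i Q e).inp_left ha
  inp_comp_right hk X i Q e b := (hY.glue_comp hk X i Q e).inp_right b
  out_comp hk X i Q e := (hY.glue_comp hk X i Q e).out_eq
  inp_act X σ a := (X.moved_act σ).inp_eq a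
  out_act X σ := (X.moved_act σ).out_eq
  -- Each remaining axiom follows the same pattern: one side is shown to have the characterizing
  -- restrictions of the other, and these determine the element.
  assoc _ _ _ _ _ _ _ _ _ _ _ _ _ := ((hY.glue_comp ..).assoc hY (hY.glue_comp ..) rfl
    (hY.glue_comp ..)).unique hY (hY.glue_comp ..)
  parallel _ _ _ _ _ _ _ ha _ _ _ _ _ _ := ((hY.glue_comp ..).parallel hY ha (hY.glue_comp ..) rfl
    rfl (hY.glue_comp ..)).unique hY (hY.glue_comp ..)
  comp_one _ _ _ c e := hY.comp_eq (.one_right ((Elt.out_one c).symm.trans e))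
  one_comp _ c i _ e := hY.comp_eq (.one_left (e.trans (Elt.inp_one c i)))
  act_one X := (X.moved_act 1).unique .one
  act_mul X σ τ := (X.moved_act (σ * τ)).unique ((X.moved_act σ).mul ((X.act σ).moved_act τ))
  act_comp hk X _ Q σ τ _ e' := hY.comp_eq ((X.moved_act σ).glue (Q.moved_act τ)
    (hY.glue_comp hk X _ Q e') rfl rfl (Elt.moved_act _ _))

end Tw

end Operad

/-! ### The projection from the operad of elements is a decomposition morphism. -/

namespace Operad

variable {s : OperadKind} {P : Operad.{u} s}

theorem IsComp.out_eq_inp_of_act {n m k : ℕ} {p : P.Op n} {i : Fin n} {q : P.Op m} {z : P.Op k}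
    {σ : s.perms n} {τ : s.perms m} {pσ : P.Op n} {qτ : P.Op m} (h : IsComp pσ i qτ z)
    (hσ : P.act p σ = pσ) (hτ : P.act q τ = qτ) : P.out q = P.inp p (σ.1 i) := by
  rw [← P.out_act q τ, hτ, h.e, ← hσ, P.inp_act]

namespace Tw

variable {Y : (Tw P)ᵒᵖ ⥤ Type u} {n m l k k₁ k₂ : ℕ}

theorem Glue.out_eq_inp {X : Elt Y n} {i : Fin n} {Q : Elt Y m} {W : Elt Y k} (h : Glue X i Q W) :
    Q.out = X.inp i := by
  have hi : IsComp X.1 i (P.one (P.out Q.1)) X.1 := .one_right _ _ h.comp.e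
  have ho : IsComp (P.one (P.out Q.1)) 0 Q.1 Q.1 := .one_left _ _ rfl
  rw [Elt.inp_eq hi, Elt.out_eq ho, ← h.ab, ← h.be,
    res_res_eq Y (hi.be_ab_right h.comp ho (leafR_zero ..).symm h.comp)]

namespace SendsComp

variable (hY : SendsComp Y)

/-- The projection from the operad of elements. -/
noncomputable def proj : hY.elements ⟶ P where
  colour := Sigma.fst
  op := Sigma.fst
  inp_op _ _ := rfl
  out_op _ := rfl
  op_one _ := rfl
  op_comp _ _ _ _ _ _ := rfl
  op_act _ _ := rfl

theorem isComp_iff {X : hY.elements.Op n} {i : Fin n} {Q : hY.elements.Op m}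
    {W : hY.elements.Op k} : IsComp X i Q W ↔ Glue (Y := Y) X i Q W := by
  refine ⟨?_, fun h => ⟨h.comp.hk, h.out_eq_inp, hY.comp_eq (e := h.out_eq_inp) h⟩⟩
  rintro ⟨hk, e, rfl⟩
  exact hY.glue_comp hk X i Q e

/-- Every element over a composite is the composite of its own restrictions. This is what allows a
step of `Tw P` to be lifted when only its target is given. -/
theorem isComp_res {p : P.Op n} {i : Fin n} {q : P.Op m} {z : P.Op k} (h : IsComp p i q z)
    (y : Y.obj (Opposite.op ⟨k, z⟩)) :
    IsComp (P := hY.elements) ⟨p, res Y h.ab y⟩ i ⟨q, res Y h.be y⟩ ⟨z, y⟩ :=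
  hY.isComp_iff.2 ⟨h, rfl, rfl⟩

theorem act_res {p : P.Op n} {σ : s.perms n} {z : P.Op n} (h : P.act p σ = z)
    (y : Y.obj (Opposite.op ⟨n, z⟩)) :
    hY.elements.act ⟨p, res Y (permHom σ h) y⟩ σ = ⟨z, y⟩ :=
  (Elt.moved_act _ _).unique ⟨h, rfl⟩

theorem exists_isComp {X : hY.elements.Op n} {i : Fin n} {Q : hY.elements.Op m} {w : P.Op k}
    (e : hY.elements.out Q = hY.elements.inp X i) (h : IsComp X.1 i Q.1 w) :
    ∃ y, IsComp (P := hY.elements) X i Q ⟨w, y⟩ := by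
  obtain ⟨y, hy⟩ := hY.exists_glue e h
  exact ⟨y, hY.isComp_iff.2 hy⟩

/-- An element of a presheaf as an object of the twisted arrow category of the operad of
elements. -/
noncomputable def objOver (a : Tw P) (x : Y.obj (Opposite.op a)) : Tw hY.elements := ⟨a.arity, a.op, x⟩

/-- The morphisms with given target and with source over `a`. -/
abbrev Lifting (a : Tw P) {b : Tw P} (y : Y.obj (Opposite.op b)) : Type u :=
  Σ x : Y.obj (Opposite.op a), hY.objOver a x ⟶ hY.objOver b y

variable {hY} in
/-- The composite of lifts. -/
noncomputable def Lifting.comp {a b c : Tw P} {z : Y.obj (Opposite.op c)}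
    (F : ∀ y : Y.obj (Opposite.op b), hY.Lifting a y) (r : hY.Lifting b z) : hY.Lifting a z :=
  ⟨(F r.1).1, (F r.1).2 ≫ r.2⟩

/-- The lift of a step. -/
noncomputable def liftStep : {a b : Tw P} → Step P a b → (y : Y.obj (Opposite.op b)) → hY.Lifting a y
  | _, _, .above hk _ _ _ e _ hz, y => ⟨_, (hY.isComp_res ⟨hk, e, hz⟩ y).ab⟩
  | _, _, .below hk _ _ _ e _ hz, y => ⟨_, (hY.isComp_res ⟨hk, e, hz⟩ y).be⟩
  | _, _, .perm _ σ _ hz, y => ⟨_, permHom σ (hY.act_res hz y)⟩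

/-- The lift of an expression. -/
noncomputable def liftExpr {a : Tw P} : {b : Tw P} → Expr P a b → (y : Y.obj (Opposite.op b)) →
    hY.Lifting a y
  | _, .var, y => ⟨y, 𝟙 _⟩
  | _, .step E g, y => Lifting.comp (liftExpr E) (hY.liftStep g y)

theorem liftExpr_step_step {a b c d : Tw P} (E : Expr P a b) (g : Step P b c) (g' : Step P c d)
    (y : Y.obj (Opposite.op d)) : hY.liftExpr ((E.step g).step g') y =
      Lifting.comp (hY.liftExpr E) (Lifting.comp (hY.liftStep g) (hY.liftStep g' y)) :=
  congrArg (Sigma.mk _) (Category.assoc _ _ _)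

theorem liftExpr_step_eq {a b c : Tw P} (E : Expr P a b) {g : Step P b c}
    {y : Y.obj (Opposite.op c)} {x} {f : hY.objOver b x ⟶ hY.objOver c y} (h : hY.liftStep g y = ⟨x, f⟩) :
    hY.liftExpr (E.step g) y = Lifting.comp (hY.liftExpr E) ⟨x, f⟩ := by
  rw [← h]
  rfl

theorem liftExpr_step_step_eq {a b c d : Tw P} (E : Expr P a b) {g : Step P b c} {g' : Step P c d}
    {y : Y.obj (Opposite.op d)} {y' x} {f : hY.objOver b x ⟶ hY.objOver c y'}
    {f' : hY.objOver c y' ⟶ hY.objOver d y}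
    (h : hY.liftStep g y' = ⟨x, f⟩) (h' : hY.liftStep g' y = ⟨y', f'⟩) :
    hY.liftExpr ((E.step g).step g') y = Lifting.comp (hY.liftExpr E) ⟨x, f ≫ f'⟩ := by
  rw [liftExpr_step_step, h']
  refine congrArg (Lifting.comp _) ?_
  exact congrArg (fun r : hY.Lifting b y' => (⟨r.1, r.2 ≫ f'⟩ : hY.Lifting b y)) h

variable {hY} in
-- Any composite of elements ending at `W` computes the lift, because its factors are forced to be
-- the restrictions of `W`.
theorem liftStep_above {X : hY.elements.Op n} {i : Fin n} {Q : hY.elements.Op m}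
    {W : hY.elements.Op k} (H : IsComp X i Q W) (hk : n + m = k + 1) (e : P.out Q.1 = P.inp X.1 i)
    (hz : P.comp hk X.1 i Q.1 e = W.1) :
    hY.liftStep (.above hk X.1 i Q.1 e W.1 hz) W.2 = ⟨X.2, H.ab⟩ := by
  obtain ⟨p, x⟩ := X
  obtain ⟨q, x'⟩ := Q
  obtain ⟨h, h₁, h₂⟩ := hY.isComp_iff.1 H
  change IsComp p i q W.1 at h
  change res Y h.ab W.2 = x at h₁
  change res Y h.be W.2 = x' at h₂
  subst h₁ h₂
  rfl

variable {hY} in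
theorem liftStep_below {X : hY.elements.Op n} {i : Fin n} {Q : hY.elements.Op m}
    {W : hY.elements.Op k} (H : IsComp X i Q W) (hk : n + m = k + 1) (e : P.out Q.1 = P.inp X.1 i)
    (hz : P.comp hk X.1 i Q.1 e = W.1) :
    hY.liftStep (.below hk X.1 i Q.1 e W.1 hz) W.2 = ⟨Q.2, H.be⟩ := by
  obtain ⟨p, x⟩ := X
  obtain ⟨q, x'⟩ := Q
  obtain ⟨h, h₁, h₂⟩ := hY.isComp_iff.1 H
  change IsComp p i q W.1 at h
  change res Y h.ab W.2 = x at h₁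
  change res Y h.be W.2 = x' at h₂
  subst h₁ h₂
  rfl

variable {hY} in
theorem liftStep_perm {X : hY.elements.Op n} {σ : s.perms n} {W : hY.elements.Op n}
    (H : hY.elements.act X σ = W) (hz : P.act X.1 σ = W.1) :
    hY.liftStep (.perm X.1 σ W.1 hz) W.2 = ⟨X.2, permHom σ H⟩ := by
  have h : Moved (Y := Y) X σ W := H ▸ Elt.moved_act (Y := Y) X σ
  obtain ⟨p, x⟩ := X
  change P.act p σ = W.1 at hz
  have h₁ : res Y (permHom σ hz) W.2 = x := h.perm
  clear h
  subst h₁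
  rfl

/-- A relation in `Tw P` lifts to the same relation in the twisted arrow category of the operad of
elements. All that is required is to produce the lifted operations on both of its sides. -/
theorem liftExpr_eq {a b : Tw P} {E E' : Expr P a b} (h : ExprRel P E E')
    (y : Y.obj (Opposite.op b)) : hY.liftExpr E y = hY.liftExpr E' y := by
  induction h with
  | step g _ ih => exact congrArg (fun L => Lifting.comp L _) (funext ih)
  | assoc₁ h₁ h₂ h₃ h₄ p i q j r e₁ pq hpq e₃ qr hqr e₂ e₄ z hz hz' E =>
    -- The lifts are constructed backwards from the target `y`: the last step gives `H₂` and the one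
    -- before it `H₁`. Their colours match those needed for `H₃`, and associativity in the operad of
    -- elements gives `H₄`. The remaining associativity and parallel cases proceed in the same way.
    have H₂ := hY.isComp_res ⟨h₂, e₂, hz⟩ y
    have H₁ := hY.isComp_res ⟨h₁, e₁, hpq⟩ (res Y (IsComp.ab ⟨h₂, e₂, hz⟩) y)
    obtain ⟨_, H₃⟩ := hY.exists_isComp (H₂.e.trans (H₁.inp_right rfl)) ⟨h₃, e₃, hqr⟩
    have H₄ := (H₁.assoc H₃ rfl).1 H₂
    refine (hY.liftExpr_step_step_eq E (liftStep_above H₁ ..) (liftStep_above H₂ ..)).trans (.trans ?_ (hY.liftExpr_step_eq E (liftStep_above H₄ ..)).symm)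
    exact congrArg (fun f => Lifting.comp (hY.liftExpr E) ⟨_, f⟩) (H₁.ab_ab_right H₂ H₃ rfl H₄)
  | assoc₂ h₁ h₂ h₃ h₄ p i q j r e₁ pq hpq e₃ qr hqr e₂ e₄ z hz hz' E =>
    have H₂ := hY.isComp_res ⟨h₂, e₂, hz⟩ y
    have H₁ := hY.isComp_res ⟨h₁, e₁, hpq⟩ (res Y (IsComp.ab ⟨h₂, e₂, hz⟩) y)
    obtain ⟨_, H₃⟩ := hY.exists_isComp (H₂.e.trans (H₁.inp_right rfl)) ⟨h₃, e₃, hqr⟩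
    have H₄ := (H₁.assoc H₃ rfl).1 H₂
    refine (hY.liftExpr_step_step_eq E (liftStep_below H₁ ..) (liftStep_above H₂ ..)).trans (.trans ?_ (hY.liftExpr_step_step_eq E (liftStep_above H₃ ..) (liftStep_below H₄ ..)).symm)
    exact congrArg (fun f => Lifting.comp (hY.liftExpr E) ⟨_, f⟩) (H₁.be_ab_right H₂ H₃ rfl H₄)
  | assoc₃ h₁ h₂ h₃ h₄ p i q j r e₁ pq hpq e₃ qr hqr e₂ e₄ z hz hz' E =>
    have H₂ := hY.isComp_res ⟨h₂, e₂, hz⟩ y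
    have H₁ := hY.isComp_res ⟨h₁, e₁, hpq⟩ (res Y (IsComp.ab ⟨h₂, e₂, hz⟩) y)
    obtain ⟨_, H₃⟩ := hY.exists_isComp (H₂.e.trans (H₁.inp_right rfl)) ⟨h₃, e₃, hqr⟩
    have H₄ := (H₁.assoc H₃ rfl).1 H₂
    refine Eq.symm ((hY.liftExpr_step_step_eq E (liftStep_below H₃ ..) (liftStep_below H₄ ..)).trans (.trans ?_ (hY.liftExpr_step_eq E (liftStep_below H₂ ..)).symm))
    exact congrArg (fun f => Lifting.comp (hY.liftExpr E) ⟨_, f⟩) (H₃.be_be H₄ H₁ rfl H₂)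
  | parallel₁ h₁ h₂ h₃ h₄ p i a ha q r e₁ pq hpq e₃ pr hpr e₂ e₄ z hz hz' E =>
    have H₂ := hY.isComp_res ⟨h₂, e₂, hz⟩ y
    have H₁ := hY.isComp_res ⟨h₁, e₁, hpq⟩ (res Y (IsComp.ab ⟨h₂, e₂, hz⟩) y)
    obtain ⟨_, H₃⟩ := hY.exists_isComp (H₂.e.trans (H₁.inp_left ha rfl)) ⟨h₃, e₃, hpr⟩
    have H₄ := H₁.parallel ha H₃ rfl rfl H₂
    refine (hY.liftExpr_step_step_eq E (liftStep_above H₁ ..) (liftStep_above H₂ ..)).trans (.trans ?_ (hY.liftExpr_step_step_eq E (liftStep_above H₃ ..) (liftStep_above H₄ ..)).symm)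
    exact congrArg (fun f => Lifting.comp (hY.liftExpr E) ⟨_, f⟩) (H₁.ab_ab_left H₂ ha rfl H₃ H₄ rfl)
  | parallel₂ h₁ h₂ h₃ h₄ p i a ha q r e₁ pq hpq e₃ pr hpr e₂ e₄ z hz hz' E =>
    have H₂ := hY.isComp_res ⟨h₂, e₂, hz⟩ y
    have H₁ := hY.isComp_res ⟨h₁, e₁, hpq⟩ (res Y (IsComp.ab ⟨h₂, e₂, hz⟩) y)
    obtain ⟨_, H₃⟩ := hY.exists_isComp (H₂.e.trans (H₁.inp_left ha rfl)) ⟨h₃, e₃, hpr⟩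
    have H₄ := H₁.parallel ha H₃ rfl rfl H₂
    refine (hY.liftExpr_step_step_eq E (liftStep_below H₁ ..) (liftStep_above H₂ ..)).trans (.trans ?_ (hY.liftExpr_step_eq E (liftStep_below H₄ ..)).symm)
    exact congrArg (fun f => Lifting.comp (hY.liftExpr E) ⟨_, f⟩) (H₁.be_ab_left H₂ ha rfl H₃ H₄ rfl)
  | comp_one hk p i c e hz E =>
    obtain rfl : c = P.inp p i := (P.out_one c).symm.trans e
    have H := IsComp.one_right (P := hY.elements) ⟨p, y⟩ i rfl
    refine (hY.liftExpr_step_eq E (liftStep_above H ..)).trans (congrArg (Sigma.mk _) ?_)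
    exact (congrArg (_ ≫ ·) H.ab_one).trans (Category.comp_id _)
  | one_comp hk c i p e hz E =>
    obtain rfl : P.out p = c := e.trans (P.inp_one c i)
    have H := IsComp.one_left (P := hY.elements) ⟨p, y⟩ i rfl
    refine (hY.liftExpr_step_eq E (liftStep_below H ..)).trans (congrArg (Sigma.mk _) ?_)
    exact (congrArg (_ ≫ ·) H.be_one).trans (Category.comp_id _)
  | act_one p hz E =>
    have H := hY.elements.act_one ⟨p, y⟩
    refine (hY.liftExpr_step_eq E (liftStep_perm H ..)).trans (congrArg (Sigma.mk _) ?_)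
    exact (congrArg (_ ≫ ·) (permHom_one H)).trans (Category.comp_id _)
  | act_mul p σ τ pσ z hpσ hz hz' E =>
    have H' := hY.act_res hz' y
    have H := hY.act_res hpσ (res Y (permHom τ hz') y)
    have H'' := hY.elements.act_mul ⟨p, res Y (permHom σ hpσ) (res Y (permHom τ hz') y)⟩ σ τ
    rw [H, H'] at H''
    refine Eq.symm ((hY.liftExpr_step_step_eq E (liftStep_perm H ..) (liftStep_perm H' ..)).trans (.trans ?_ (hY.liftExpr_step_eq E (liftStep_perm H'' ..)).symm))
    exact congrArg (fun f => Lifting.comp (hY.liftExpr E) ⟨_, f⟩) (permHom_permHom H H' rfl H'')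
  | act_comp₁ hk p i q σ τ pσ hpσ qτ hqτ e e' pq hpq z hz hz' E =>
    have H' := hY.isComp_res ⟨hk, e, hz⟩ y
    have Hp := hY.act_res hpσ (res Y (IsComp.ab ⟨hk, e, hz⟩) y)
    have Hq := hY.act_res hqτ (res Y (IsComp.be ⟨hk, e, hz⟩) y)
    obtain ⟨_, H⟩ := hY.exists_isComp (H'.out_eq_inp_of_act Hp Hq) ⟨hk, e', hpq⟩
    have Hz := H.act_eq rfl Hp Hq rfl H'
    refine (hY.liftExpr_step_step_eq E (liftStep_perm Hp ..) (liftStep_above H' ..)).trans (.trans ?_ (hY.liftExpr_step_step_eq E (liftStep_above H ..) (liftStep_perm Hz ..)).symm)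
    exact congrArg (fun f => Lifting.comp (hY.liftExpr E) ⟨_, f⟩) (permHom_ab Hp Hq rfl H H' rfl Hz)
  | act_comp₂ hk p i q σ τ pσ hpσ qτ hqτ e e' pq hpq z hz hz' E =>
    have H' := hY.isComp_res ⟨hk, e, hz⟩ y
    have Hp := hY.act_res hpσ (res Y (IsComp.ab ⟨hk, e, hz⟩) y)
    have Hq := hY.act_res hqτ (res Y (IsComp.be ⟨hk, e, hz⟩) y)
    obtain ⟨_, H⟩ := hY.exists_isComp (H'.out_eq_inp_of_act Hp Hq) ⟨hk, e', hpq⟩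
    have Hz := H.act_eq rfl Hp Hq rfl H'
    refine (hY.liftExpr_step_step_eq E (liftStep_perm Hq ..) (liftStep_below H' ..)).trans (.trans ?_ (hY.liftExpr_step_step_eq E (liftStep_below H ..) (liftStep_perm Hz ..)).symm)
    exact congrArg (fun f => Lifting.comp (hY.liftExpr E) ⟨_, f⟩) (permHom_be Hp Hq rfl H H' rfl Hz)

/-- The lift of a morphism. -/
noncomputable def lift {a b : Tw P} (g : a ⟶ b) (y : Y.obj (Opposite.op b)) : hY.Lifting a y :=
  Quot.lift (fun E => hY.liftExpr E y) (fun _ _ h => hY.liftExpr_eq h y) g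

theorem map_liftStep {a b : Tw P} (g : Step P a b) (y : Y.obj (Opposite.op b)) :
    (map hY.proj).map (hY.liftStep g y).2 = g.hom := by
  cases g <;> rfl

theorem map_lift {a b : Tw P} (g : a ⟶ b) (y : Y.obj (Opposite.op b)) :
    (map hY.proj).map (hY.lift g y).2 = g := by
  induction g using Quot.ind with | mk E => ?_
  change (map hY.proj).map (hY.liftExpr E y).2 = E.hom
  induction E with
  | var => exact (map hY.proj).map_id _
  | step E g ih =>
    exact ((map hY.proj).map_comp _ _).trans
      (congrArg₂ (· ≫ ·) (ih (hY.liftStep g y).1) (hY.map_liftStep g y))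

theorem lift_fst {a b : Tw P} (g : a ⟶ b) (y : Y.obj (Opposite.op b)) :
    (hY.lift g y).1 = res Y g y := by
  induction g using Quot.ind with | mk E => ?_
  change (hY.liftExpr E y).1 = res Y E.hom y
  induction E with
  | var => exact (res_id _ _).symm
  | step E g ih =>
    refine (ih _).trans (Eq.trans ?_ (res_comp Y E.hom g.hom y).symm)
    cases g <;> rfl

theorem liftStep_map {a b : Tw hY.elements} (g : Step hY.elements a b) :
    hY.liftStep (g.map hY.proj) b.op.2 = ⟨a.op.2, g.hom⟩ := by
  cases g with
  | above hk p i q e z hz => exact liftStep_above ⟨hk, e, hz⟩ ..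
  | below hk p i q e z hz => exact liftStep_below ⟨hk, e, hz⟩ ..
  | perm p σ z hz => exact liftStep_perm hz ..

/-- Every morphism of the twisted arrow category of the operad of elements is the chosen lift of its
image. This is the uniqueness of lifts. -/
theorem lift_map {a b : Tw hY.elements} (g : a ⟶ b) :
    hY.lift ((map hY.proj).map g) b.op.2 = ⟨a.op.2, g⟩ := by
  induction g using Quot.ind with | mk E => ?_
  change hY.liftExpr (E.map hY.proj) b.op.2 = ⟨a.op.2, E.hom⟩
  induction E with
  | var => rfl
  | @step b c E g ih =>
    refine (hY.liftExpr_step_eq _ (hY.liftStep_map g)).trans ?_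
    let g' : hY.objOver (mapObj hY.proj b) b.op.2 ⟶ hY.objOver (mapObj hY.proj c) c.op.2 := g.hom
    exact congrArg (fun r : hY.Lifting (mapObj hY.proj a) (b := mapObj hY.proj b) b.op.2 =>
      (⟨r.1, r.2 ≫ g'⟩ : hY.Lifting (mapObj hY.proj a) _)) ih

/-- Existence of lifts is `map_lift`, and uniqueness is `lift_map`. -/
theorem isDiscreteFibration_proj : IsDiscreteFibration (map hY.proj) := by
  intro b b' g e he
  subst he
  refine ⟨⟨hY.objOver b (hY.lift g e.op.2).1, (hY.lift g e.op.2).2⟩, ?_, ?_⟩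
  · exact IsHomLift.of_fac (map hY.proj) _ _ rfl rfl
      ((Category.id_comp _).trans ((Category.comp_id _).trans (hY.map_lift g _))).symm
  · rintro ⟨e', h⟩ hh
    dsimp only at hh
    obtain rfl := IsHomLift.domain_eq (map hY.proj) g h
    obtain rfl := IsHomLift.eq_of_isHomLift (map hY.proj) g h
    exact (congrArg (fun r : hY.Lifting ((map hY.proj).obj e') (b := (map hY.proj).obj e) e.op.2 =>
      (⟨hY.objOver _ r.1, r.2⟩ : Σ e', e' ⟶ e)) (hY.lift_map h)).symm

theorem objOver_bijective (b : Tw P) : Function.Bijective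
    (fun y => (⟨hY.objOver b y, rfl⟩ : {e : Tw hY.elements // (map hY.proj).obj e = b})) := by
  refine ⟨fun y y' h => ?_, ?_⟩
  · cases h
    rfl
  · rintro ⟨e, rfl⟩
    exact ⟨e.op.2, rfl⟩

/-- A 2-Segal presheaf is isomorphic to the presheaf of fibres of the projection from its operad of
elements. -/
noncomputable def presheafIso : Y ≅ IsDiscreteFibration.presheaf hY.isDiscreteFibration_proj :=
  NatIso.ofComponents (fun b => (Equiv.ofBijective _ (hY.objOver_bijective b.unop)).toIso) (by
    intro b b' g
    ext y
    have hlift : (map hY.proj).IsHomLift g.unop (hY.lift g.unop y).2 :=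
      IsHomLift.of_fac (map hY.proj) _ _ rfl rfl
        ((Category.id_comp _).trans ((Category.comp_id _).trans (hY.map_lift g.unop y))).symm
    have := IsDiscreteFibration.source_eq hY.isDiscreteFibration_proj g.unop
      ⟨hY.objOver b.unop y, rfl⟩ ⟨_, rfl⟩ _ hlift
    rw [hY.lift_fst] at this
    exact this.symm)

end SendsComp

end Tw

end Operad

namespace Operad

variable {s : OperadKind} {P P₁ P₂ : Operad.{u} s}

namespace Tw

/-! ## Morphisms of presheaves of fibres -/

/-- The morphism `1 ⟶ 1 ∘ u = u` lies over an identity. So its source, an identity operation, equals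
its target `u`. -/
theorem eq_one_of_map_eq_one {f : P₁ ⟶ P} (hf : IsDiscreteFibration (map f)) {u : P₁.Op 1}
    {c : P.Colour} (hu : Hom.op f u = P.one c) : u = P₁.one (P₁.out u) := by
  have h : IsComp (P₁.one (P₁.out u)) 0 u u := .one_left _ _ rfl
  have h' : IsComp (P.one c) 0 (P.one c) (P.one c) := .one_left _ _ (P.out_one c)
  have hc : Hom.op f (P₁.one (P₁.out u)) = P.one c := by
    rw [Hom.op_one f, ← Hom.out_op f, hu, P.out_one]
  have h1 := source_ab hf h h' hc hu hu
  rw [h'.ab_one] at h1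
  exact fibreMk_injective ((res_id hf.presheaf (fibreMk f u hu)).symm.trans h1)

section

variable {f : P₁ ⟶ P} {f' : P₂ ⟶ P} {hf : IsDiscreteFibration (map f)}
  {hf' : IsDiscreteFibration (map f')} (θ : hf.presheaf ⟶ hf'.presheaf)

theorem app_source {a b : Tw P} (g : a ⟶ b) (x : {e : Tw P₁ // (map f).obj e = b}) :
    θ.app (Opposite.op a) (hf.source g x) = hf'.source g (θ.app (Opposite.op b) x) :=
  ConcreteCategory.congr_hom (θ.naturality g.op) x

theorem exists_app_eq {n : ℕ} (p₁ : P₁.Op n) : ∃ (p₂ : P₂.Op n) (h : Hom.op f' p₂ = Hom.op f p₁),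
    θ.app (Opposite.op ⟨n, Hom.op f p₁⟩) (fibreMk f p₁ rfl) = fibreMk f' p₂ h :=
  exists_of_fibre _

/-- The operation assigned to an operation by a morphism of presheaves of fibres. -/
noncomputable def opOfApp {n : ℕ} (p₁ : P₁.Op n) : P₂.Op n := (exists_app_eq θ p₁).choose

theorem op_opOfApp {n : ℕ} (p₁ : P₁.Op n) : Hom.op f' (opOfApp θ p₁) = Hom.op f p₁ :=
  (exists_app_eq θ p₁).choose_spec.choose

theorem app_fibreMk {n : ℕ} {p : P.Op n} (p₁ : P₁.Op n) (hp : Hom.op f p₁ = p) :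
    θ.app (Opposite.op ⟨n, p⟩) (fibreMk f p₁ hp) =
      fibreMk f' (opOfApp θ p₁) ((op_opOfApp θ p₁).trans hp) := by
  subst hp
  exact (exists_app_eq θ p₁).choose_spec.choose_spec

theorem source_opOfApp {n m : ℕ} {p : P.Op n} {q : P.Op m} {p₁ : P₁.Op n} {q₁ : P₁.Op m}
    {hp : Hom.op f p₁ = p} {hq : Hom.op f q₁ = q} {g : (⟨n, p⟩ : Tw P) ⟶ ⟨m, q⟩}
    (h : hf.source g (fibreMk f q₁ hq) = fibreMk f p₁ hp) :
    hf'.source g (fibreMk f' (opOfApp θ q₁) ((op_opOfApp θ q₁).trans hq)) =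
      fibreMk f' (opOfApp θ p₁) ((op_opOfApp θ p₁).trans hp) :=
  (congrArg (hf'.source g) (app_fibreMk θ q₁ hq)).symm.trans ((app_source θ g _).symm.trans
    ((congrArg (fun x => θ.app (Opposite.op ⟨n, p⟩) x) h).trans (app_fibreMk θ p₁ hp)))

/-- Composites are characterized by their restrictions to the factors, and naturality of `θ`
preserves these restrictions. -/
theorem isComp_opOfApp {n m k : ℕ} {p : P₁.Op n} {i : Fin n} {q : P₁.Op m} {w : P₁.Op k}
    (h : IsComp p i q w) : IsComp (opOfApp θ p) i (opOfApp θ q) (opOfApp θ w) :=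
  isComp_of_source_eq hf' (h.hom f) (op_opOfApp θ p) (op_opOfApp θ q) (op_opOfApp θ w)
    (source_opOfApp θ (source_ab hf h (h.hom f) rfl rfl rfl))
    (source_opOfApp θ (source_be hf h (h.hom f) rfl rfl rfl))

/-- Both sides restrict to the image of `p` along the isomorphism `p ⟶ p^σ`, and restriction along
an isomorphism is injective. -/
theorem act_opOfApp {n : ℕ} (p : P₁.Op n) (σ : s.perms n) :
    opOfApp θ (P₁.act p σ) = P₂.act (opOfApp θ p) σ := by
  have hσ := (Hom.op_act f p σ).symm
  have hp : Hom.op f' (P₂.act (opOfApp θ p) σ) = Hom.op f (P₁.act p σ) := by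
    rw [Hom.op_act f', op_opOfApp, hσ]
  refine fibreMk_injective (f := f') (hp := op_opOfApp θ _) (hp' := hp)
    (res_injective hf'.presheaf (permHom σ hσ) ?_)
  exact (source_opOfApp θ (source_permHom hf rfl hσ rfl rfl)).trans
    (source_permHom hf' rfl hσ (op_opOfApp θ p) hp).symm

/-- The morphism of operads given by a morphism of presheaves of fibres. -/
noncomputable def homOfApp : P₁ ⟶ P₂ where
  -- A colour is encoded by its identity operation. The image of that operation lies over an
  -- identity of `P`, so it is an identity, whose output is the new colour.
  colour c := P₂.out (opOfApp θ (P₁.one c))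
  op := opOfApp θ
  inp_op p a := (isComp_opOfApp θ (.one_right p a rfl)).e.symm
  out_op p := (isComp_opOfApp θ (.one_left p 0 rfl)).out_eq
  op_one c := eq_one_of_map_eq_one hf' ((op_opOfApp θ _).trans (Hom.op_one f c))
  op_comp hk p i q e _ := (isComp_opOfApp θ (.of_comp hk p i q e)).eq.symm
  op_act := act_opOfApp θ

theorem homOfApp_comp : homOfApp θ ≫ f' = f := by
  refine Hom.ext (funext fun c => ?_) ?_
  · change Hom.colour f' (P₂.out (opOfApp θ (P₁.one c))) = Hom.colour f c
    rw [← Hom.out_op f', op_opOfApp, Hom.out_op f, P₁.out_one]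
  · funext n p
    exact op_opOfApp θ p

theorem homOfApp_app {b : Tw P} (e : {e : Tw P₁ // (map f).obj e = b}) :
    (θ.app (Opposite.op b) e).1 = (map (homOfApp θ)).obj e.1 := by
  obtain ⟨n, p⟩ := b
  obtain ⟨p₁, hp, rfl⟩ := exists_of_fibre e
  exact congrArg Subtype.val (app_fibreMk θ p₁ hp)

end

/-- Objects are operations, so the values on operations are determined, and a colour is the output
of its identity operation. -/
theorem hom_eq_of_obj_eq {g g' : P₁ ⟶ P₂} (h : ∀ e, (map g).obj e = (map g').obj e) : g = g' := by
  have key : ∀ {n : ℕ} (p : P₁.Op n), Hom.op g p = Hom.op g' p := by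
    intro n p
    exact eq_of_heq (Tw.mk.inj (h ⟨n, p⟩)).2
  refine Hom.ext (funext fun c => ?_) ?_
  · have := congrArg P₂.out (key (P₁.one c))
    rwa [Hom.out_op g, Hom.out_op g', P₁.out_one] at this
  · funext n p
    exact key p

theorem IsTwoSegal.of_iso {Y Y' : (Tw P)ᵒᵖ ⥤ Type u} (e : Y ≅ Y') (h : IsTwoSegal P Y) :
    IsTwoSegal P Y' := by
  intro a b c d f g g' f' hf hg hp
  exact (h f g g' f' hf hg hp).of_iso (e.app _) (e.app _) (e.app _) (e.app _)
    (e.hom.naturality _) (e.hom.naturality _) (e.hom.naturality _)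
    (e.hom.naturality _)

end Tw

/-- The functor sending a decomposition morphism to its 2-Segal presheaf of fibres. -/
noncomputable def fibreTwoSegal (P : Operad.{u} s) : DecompositionOver P ⥤ TwoSegal P :=
  (Tw.IsTwoSegal P).lift (fibrePresheaf P)
    fun f => Tw.isTwoSegal_of_sendsComp (Tw.sendsComp_presheaf f.property)

/-! ### The fibre functor is an equivalence onto 2-Segal presheaves. -/

instance : (fibreTwoSegal P).Faithful where
  map_injective {f f'} g g' h := by
    refine ObjectProperty.hom_ext _ (Over.OverMorphism.ext (Tw.hom_eq_of_obj_eq fun e => ?_))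
    have h' := congrArg (fun φ => (φ.hom.app (Opposite.op ((Tw.map f.obj.hom).obj e))) ⟨e, rfl⟩) h
    exact congrArg Subtype.val h'

instance : (fibreTwoSegal P).Full where
  map_surjective {f f'} θ := by
    refine ⟨⟨Over.homMk (Tw.homOfApp θ.hom) (Tw.homOfApp_comp θ.hom)⟩, ?_⟩
    refine ObjectProperty.hom_ext _ ?_
    ext b e
    exact Subtype.ext (Tw.homOfApp_app θ.hom e).symm

/-- The preimage of a 2-Segal presheaf is the projection from its operad of elements. -/
instance : (fibreTwoSegal P).EssSurj where
  mem_essImage Y := by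
    have hY : Tw.SendsComp Y.obj := Tw.IsTwoSegal.sendsComp Y.property
    exact ⟨⟨Over.mk hY.proj, hY.isDiscreteFibration_proj⟩,
      ⟨(Tw.IsTwoSegal P).isoMk hY.presheafIso.symm⟩⟩

instance : (fibreTwoSegal P).IsEquivalence where

end Operad

theorem mainTheorem9 (s : OperadKind) (P : Operad.{u} s) :
    (∀ Y : (Operad.Tw P)ᵒᵖ ⥤ Type u,
      (∃ (P₁ : Operad.{u} s) (f : P₁ ⟶ P) (hf : IsDiscreteFibration (Operad.Tw.map f)),
        Nonempty (Y ≅ hf.presheaf)) ↔ Operad.Tw.IsTwoSegal P Y) ∧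
    ∃ e : Operad.DecompositionOver P ≌ Operad.TwoSegal P,
      Nonempty (e.functor ⋙ (Operad.Tw.IsTwoSegal P).ι ≅ Operad.fibrePresheaf P) := by
  -- The equivalence is the corestriction of `fibrePresheaf`, so composing it with the inclusion
  -- returns `fibrePresheaf` by definition.
  refine ⟨fun Y => ⟨?_, fun h => ?_⟩, (Operad.fibreTwoSegal P).asEquivalence, ⟨Iso.refl _⟩⟩
  · rintro ⟨P₁, f, hf, ⟨e⟩⟩
    exact Operad.Tw.IsTwoSegal.of_iso e.symm
      (Operad.Tw.isTwoSegal_of_sendsComp (Operad.Tw.sendsComp_presheaf hf))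
  · have hY : Operad.Tw.SendsComp Y := Operad.Tw.IsTwoSegal.sendsComp h
    exact ⟨_, hY.proj, hY.isDiscreteFibration_proj, ⟨hY.presheafIso⟩⟩
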